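/- **Setting.** Let $\mathcal E,\omega,\mu>0$. Let $D\subset\mathbb R^2$ be a bounded connected open set with $0\in D$ and $\overline D\subset\{\|z\|<\sqrt{2\mathcal E}/\omega\}$, whose boundary is a simple closed curve parametrized by arc length, positively oriented, by an $L$-periodic $\gamma\in C^1(\mathbb R,\mathbb R^2)$ that is injective on $[0,L)$. Let $t(\xi)=\dot\gamma(\xi)$ and let $n(\xi)$ be the outward unit normal. For $h\in\mathbb R$ put $V_E(z)=\mathcal E-\frac{\omega^2}{2}\|z\|^2$ and $V_I(z)=\mathcal E+h+\frac{\mu}{\|z\|}$. Outer arcs are solutions of $z''=-\omega^2z$ on some $[0,T]$, $T>0$, with $z(s)\notin\overline D$ for $0<s<T$. Inner arcs are continuous solutions of $z''=-\mu z/\|z\|^3$ on some $[0,T]$, $T>0$, with $z(s)\in D$ for $0<s<T$; the equation is required only when $z(s)\ne0$, and if $z(c)=0$ then $z(c+\tau)=z(c-\tau)$ whenever $c\pm\tau\in[0,T]$ (regularized collision). The refraction map is $R_\xi(a\,t(\xi)+b\,n(\xi))=a\,t(\xi)+\operatorname{sgn}(b)\sqrt{2V_I(\gamma(\xi))-a^2}\;n(\xi)$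 (Snell's law). Parameters $\xi,\eta$ are antipodal if $0$ lies on the segment $[\gamma(\xi),\gamma(\eta)]$; two intervals are non-antipodal if no point of the first is antipodal to a point of the second. A central configuration is a critical point $\bar\xi$ of $\|\gamma(\cdot)\|$ such that the half-line from $0$ through $\gamma(\bar\xi)$ meets $\partial D$ only at $\gamma(\bar\xi)$; it is non-degenerate if $\gamma$ is $C^2$ near $\bar\xi$ and $\frac{d^2}{d\xi^2}\|\gamma(\xi)\|\big|_{\xi=\bar\xi}\neq0$. Let $m\ge2$, and for $i\in\{1,\dots,m\}$ let $\bar\xi_i$ be given with intervals $[\alpha_i,\beta_i]\subset(a_i,b_i)$ and $\bar\xi_i\in(\alpha_i,\beta_i)$. Write $j\in NA(i)$ if $(a_i,b_i)$ and $(a_j,b_j)$ are non-antipodal, and put $\mathcal L=\{\ell\in\{1,\dots,m\}^{\mathbb Z}:\ell_{k+1}\in NA(\ell_k)\ \forall k\}$ with the product topology and $(\sigma\ell)_k=\ell_{k+1}$. Let $0<\kappa<1$. Let $\Xi_r^{+}$ (resp. $\Xi_r^-$) be the set of $(\xi,v)$ with $\xi\in[\alpha_r,\beta_r]$, $\|v\|^2=2V_E(\gamma(\xi))$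 and $\langle v,n(\xi)\rangle>\kappa\|v\|$ (resp. $<-\kappa\|v\|$). The first return map $F$ is defined by $F(\xi_0,v_0)=(\xi_2,v_2)$ when, for some $r$ and some $r'\in NA(r)$: $(\xi_0,v_0)\in\Xi_r^+$; an outer arc leads from $\gamma(\xi_0)$ with velocity $v_0$ to $\gamma(\xi_1)$ with velocity $v_1$, where $(\xi_1,v_1)\in\Xi_r^-$; an inner arc leads from $\gamma(\xi_1)$ with velocity $R_{\xi_1}(v_1)$ to $\gamma(\xi_2)$, $\xi_2\in[\alpha_{r'},\beta_{r'}]$, with a velocity $v_2'$ such that $\langle v_2',n(\xi_2)\rangle>0$; and $v_2'=R_{\xi_2}(v_2)$ with $\|v_2\|^2=2V_E(\gamma(\xi_2))$. Let $X\subset\mathbb R\times\mathbb R^2$ be the set of points at which all iterates $F^k$, $k\in\mathbb Z$, are defined, and let $\pi(\xi,v)=(\ell_k)_{k\in\mathbb Z}$, where $\ell_k=r$ if the first component of $F^k(\xi,v)$ lies in $[\alpha_r,\beta_r]$. **Theorem.** Let $\bar\xi_1,\dots,\bar\xi_m$, $m\ge2$, be non-degenerate central configurations with distinct points $\gamma(\bar\xi_i)$,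 and not antipodal if $m=2$. Let $0<\kappa<1$. Then there is $\varepsilon>0$ such that for all intervals with $\bar\xi_i-\varepsilon<a_i<\alpha_i<\bar\xi_i<\beta_i<b_i<\bar\xi_i+\varepsilon$ ($i=1,\dots,m$) the following holds. The intervals $(a_i,b_i)$ are pairwise disjoint, $\gamma$ is injective on their union, and for every $i$ we have $i\in NA(i)$ and $j\in NA(i)$ for some $j\neq i$. Moreover there is $h_1$ such that for every $h>h_1$: $F$ restricts to a well-defined bijection $X\to X$; $\pi$ is a well-defined map $X\to\mathcal L$; $\pi\circ F=\sigma\circ\pi$; and $\pi$ is continuous, surjective and also injective, and in fact a homeomorphism. Hence the refraction billiard has a topologically chaotic subsystem: $F|_X$ is topologically conjugate to the shift on $\mathcal L$, in which every symbol has at least two admissible successors. -/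

import Mathlib

open Set Filter Topology

namespace RefractionBilliard

/-! The plane is `ℂ`, with its Euclidean norm and its real inner product `inner ℝ`. -/

/-- `γ` is a positively oriented arc-length parametrization, of class `C¹` and of period `L`, of the
boundary of the bounded domain `D`, which contains the origin. By positive orientation the unit
vector `-i γ'(ξ)` is the outward normal. -/
structure IsDomainWithBoundary (D : Set ℂ) (γ : ℝ → ℂ) (L : ℝ) : Prop where
  isOpen : IsOpen D
  isConnected : IsConnected D
  isBounded : Bornology.IsBounded D
  zero_mem : (0 : ℂ) ∈ D
  period_pos : 0 < L
  periodic : Function.Periodic γ L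
  injOn : InjOn γ (Ico 0 L)
  contDiff : ContDiff ℝ 1 γ
  unit_speed : ∀ ξ, ‖deriv γ ξ‖ = 1
  range_eq : range γ = frontier D
  outward : ∀ ξ, ∀ᶠ ε : ℝ in 𝓝[>] 0,
    γ ξ - (ε : ℂ) * (-Complex.I * deriv γ ξ) ∈ D ∧
      γ ξ + (ε : ℂ) * (-Complex.I * deriv γ ξ) ∉ closure D

/-- The half-line from the origin through `γ ξ` meets the boundary curve only at `γ ξ`. -/
def LocalStarConvex (γ : ℝ → ℂ) (ξ : ℝ) : Prop :=
  ∀ t : ℝ, 0 ≤ t → t • γ ξ ∈ range γ → t • γ ξ = γ ξ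

/-- Central configuration: a critical point of `‖γ‖` at which the domain is locally star-convex. -/
def IsCentralConfiguration (γ : ℝ → ℂ) (ξ : ℝ) : Prop :=
  HasDerivAt (fun x => ‖γ x‖) 0 ξ ∧ LocalStarConvex γ ξ

/-- Non-degenerate central configuration (`ContDiffAt ℝ 2` is `C²` in a neighbourhood). -/
def IsNondegenerateCC (γ : ℝ → ℂ) (ξ : ℝ) : Prop :=
  IsCentralConfiguration γ ξ ∧ ContDiffAt ℝ 2 γ ξ ∧ deriv (deriv fun x => ‖γ x‖) ξ ≠ 0

/-- `ξ₁` and `ξ₂` are antipodal: the origin lies on the segment from `γ ξ₁` to `γ ξ₂`. -/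
def Antipodal (γ : ℝ → ℂ) (ξ₁ ξ₂ : ℝ) : Prop :=
  (0 : ℂ) ∈ segment ℝ (γ ξ₁) (γ ξ₂)

/-- The data of the refraction billiard: the physical constants `𝓔`, `ω`, `μ`, the energy jump `h`,
the domain, and the parametrization of its boundary. -/
structure Billiard where
  E : ℝ
  ω : ℝ
  μ : ℝ
  h : ℝ
  D : Set ℂ
  γ : ℝ → ℂ

namespace Billiard

variable (B : Billiard)

/-- Outer (harmonic) potential. -/
noncomputable def outerPotential (z : ℂ) : ℝ := B.E - B.ω ^ 2 / 2 * ‖z‖ ^ 2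

/-- Inner (Keplerian) potential. -/
noncomputable def innerPotential (z : ℂ) : ℝ := B.E + B.h + B.μ / ‖z‖

/-- Unit tangent vector. -/
noncomputable def tangent (ξ : ℝ) : ℂ := deriv B.γ ξ

/-- Outward unit normal vector. -/
noncomputable def normal (ξ : ℝ) : ℂ := -Complex.I * deriv B.γ ξ

/-- The refraction map from outer to inner velocities at `γ ξ` (Snell's law): the tangential
component and the sign of the normal component are kept, and the speed becomes `√(2 V_I)`. -/
noncomputable def refract (ξ : ℝ) (v : ℂ) : ℂ :=
  (inner ℝ v (B.tangent ξ)) • B.tangent ξ +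
    (Real.sign (inner ℝ v (B.normal ξ)) *
      √(2 * B.innerPotential (B.γ ξ) - (inner ℝ v (B.tangent ξ)) ^ 2)) • B.normal ξ

/-- `z`, with velocity `v`, is on `[0, T]` a solution of `z'' = -ω² z` which stays outside the
closure of `D` for `0 < s < T`. -/
structure IsOuterArc (z v : ℝ → ℂ) (T : ℝ) : Prop where
  pos : 0 < T
  deriv_pos : ∀ s ∈ Icc 0 T, HasDerivWithinAt z (v s) (Icc 0 T) s
  deriv_vel : ∀ s ∈ Icc 0 T, HasDerivWithinAt v (-(B.ω ^ 2) • z s) (Icc 0 T) s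
  outside : ∀ s ∈ Ioo 0 T, z s ∉ closure B.D

/-- `z`, with velocity `v`, is on `[0, T]` a (regularized) solution of the Kepler problem
`z'' = -μ z / ‖z‖³` which stays in `D` for `0 < s < T`. The equation holds at all times without
collision, and at a collision the motion is reflected back along the path by which it came. -/
structure IsInnerArc (z v : ℝ → ℂ) (T : ℝ) : Prop where
  pos : 0 < T
  continuousOn : ContinuousOn z (Icc 0 T)
  deriv_pos : ∀ s ∈ Icc 0 T, z s ≠ 0 → HasDerivWithinAt z (v s) (Icc 0 T) s
  deriv_vel : ∀ s ∈ Icc 0 T, z s ≠ 0 →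
    HasDerivWithinAt v (-(B.μ / ‖z s‖ ^ 3) • z s) (Icc 0 T) s
  reflect : ∀ c ∈ Icc 0 T, z c = 0 →
    ∀ τ, c - τ ∈ Icc 0 T → c + τ ∈ Icc 0 T → z (c + τ) = z (c - τ)
  inside : ∀ s ∈ Ioo 0 T, z s ∈ B.D

end Billiard

/-- For each `i`, an open parameter interval `(a i, b i)` and a compact one `[α i, β i]`. -/
structure Windows (m : ℕ) where
  a : Fin m → ℝ
  α : Fin m → ℝ
  β : Fin m → ℝ
  b : Fin m → ℝ

namespace Windows

variable {m : ℕ} (W : Windows m)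

/-- `[α i, β i] ⊂ (a i, b i)`, and `ξ i` is interior to `[α i, β i]`, and `(a i, b i)` is contained
in the `ε`-neighbourhood of `ξ i`. -/
def IsAround (ξ : Fin m → ℝ) (ε : ℝ) : Prop :=
  ∀ i, ξ i - ε < W.a i ∧ W.a i < W.α i ∧ W.α i < ξ i ∧ ξ i < W.β i ∧ W.β i < W.b i ∧
    W.b i < ξ i + ε

/-- The compact interval labelled by the symbol `i`. -/
def I (i : Fin m) : Set ℝ := Icc (W.α i) (W.β i)

/-- The intervals `(a i, b i)` and `(a j, b j)` are not antipodal, i.e. `j ∈ NA(i)`. -/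
def NA (γ : ℝ → ℂ) (i j : Fin m) : Prop :=
  ∀ x ∈ Ioo (W.a i) (W.b i), ∀ y ∈ Ioo (W.a j) (W.b j), ¬ Antipodal γ x y

/-- The bi-infinite admissible words. -/
def words (γ : ℝ → ℂ) : Set (ℤ → Fin m) := {ℓ | ∀ j, W.NA γ (ℓ j) (ℓ (j + 1))}

end Windows

/-- The Bernoulli shift. -/
def shift {m : ℕ} (ℓ : ℤ → Fin m) : ℤ → Fin m := fun j => ℓ (j + 1)

section Dynamics

variable {m : ℕ} (B : Billiard) (W : Windows m) (κ : ℝ)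

/-- Initial conditions `(ξ, v)` on the outer energy shell with `ξ` in the `r`-th interval and `v`
pointing outward, the cosine of its angle with the outward normal being larger than `κ`. -/
def outgoing (r : Fin m) : Set (ℝ × ℂ) :=
  {x | x.1 ∈ W.I r ∧ ‖x.2‖ ^ 2 = 2 * B.outerPotential (B.γ x.1) ∧
    κ * ‖x.2‖ < inner ℝ x.2 (B.normal x.1)}

/-- The same with `v` pointing inward. -/
def ingoing (r : Fin m) : Set (ℝ × ℂ) :=
  {x | x.1 ∈ W.I r ∧ ‖x.2‖ ^ 2 = 2 * B.outerPotential (B.γ x.1) ∧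
    inner ℝ x.2 (B.normal x.1) < -(κ * ‖x.2‖)}

/-- The graph of the first return map `F`. From `x = (ξ, v)` an outer arc leads to `x₁ = (ξ₁, v₁)`
over the same interval; `v₁` is refracted; the inner arc that follows leads to a point `γ ξ₂` over
a non-antipodal interval with an outward velocity `v₂'`, which is refracted to the outer velocity
`v₂` (so `v₂'` is the image of `v₂` under the refraction map); and `y = (ξ₂, v₂)`. -/
def FirstReturn (x y : ℝ × ℂ) : Prop :=
  ∃ (r r' : Fin m) (x₁ : ℝ × ℂ), x ∈ outgoing B W κ r ∧ x₁ ∈ ingoing B W κ r ∧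
    W.NA B.γ r r' ∧ y.1 ∈ W.I r' ∧
    (∃ (z v : ℝ → ℂ) (T : ℝ), B.IsOuterArc z v T ∧
      z 0 = B.γ x.1 ∧ v 0 = x.2 ∧ z T = B.γ x₁.1 ∧ v T = x₁.2) ∧
    (∃ (z v : ℝ → ℂ) (T : ℝ), B.IsInnerArc z v T ∧
      z 0 = B.γ x₁.1 ∧ v 0 = B.refract x₁.1 x₁.2 ∧ z T = B.γ y.1 ∧
      v T = B.refract y.1 y.2 ∧ 0 < inner ℝ (v T) (B.normal y.1)) ∧
    ‖y.2‖ ^ 2 = 2 * B.outerPotential (B.γ y.1)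

/-- The set `X` of initial conditions at which all positive and negative iterates of the first
return map are defined. -/
def invariantSet : Set (ℝ × ℂ) :=
  {x | ∃ o : ℤ → ℝ × ℂ, o 0 = x ∧ ∀ j, FirstReturn B W κ (o j) (o (j + 1))}

end Dynamics

end RefractionBilliard

/-! ### The boundary curve and nearly radial rays at a central configuration. -/

namespace RefractionBilliard

open scoped InnerProductSpace

/-! Orbits are found by solving a boundary value problem along each word, not by following the flow.

Put `ρ = 2E/ω²`. The cosine of the phase of an outer arc between nearby boundary points `p`, `q`
solves a quadratic equation. The root `outC` gives an arc that runs out almost radially and comes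
back; the root `outC'` gives an arc almost along the chord, which the angle condition with `κ`
forbids. So the admissible outer arc is unique, with explicit smooth initial velocity `outV`
(`OuterGood.exists_arc`, `OuterGood.velocity_eq`).

For inner arcs, `w² = z` and `ds = ‖w‖² dτ` turn the Kepler problem at energy `2l²` into `w'' = l²
w`. For non-antipodal ends the square roots are not orthogonal, and the sign of their inner product
separates an arc passing near the center from a direct one. Snell's law keeps the tangential
velocity, at most `√(2E)`, while the inner speed is at least `2l`. For large `l` the inner velocity
is therefore almost normal, hence almost radial near a central configuration, and the direct arc has
too much angular momentum. What remains is the arc with initial velocity `l • inU`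
(`InnerGood.exists_arc`, `InnerGood.velocity_eq`). The vector `inU` depends on `ν = μ/(2l²)` in a
`C¹` way up to `ν = 0`, where it equals `-2p/‖p‖` whatever `q` is. Local star-convexity keeps both
kinds of arc on the correct side of the boundary.

Both families of arcs are reversible, so at every boundary point Snell's law is one equation
`balance = 0` in the point `x`, its outer partner `y`, its inner partner `z` and `δ = 1/l`. At `δ =
0` it reads `-2 (d/dx)‖γ x‖ = 0`, without `y` and `z`. By non-degeneracy the Newton step in `x` is a
contraction with factor `1/2`, uniformly for small `δ` (`IsNondegenerateCC.exists_contraction`).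

A word thus becomes an infinite system with two unknowns per letter. Simultaneous relaxation has
exactly one fixed point near the centers, and the influence of distant letters decays geometrically
(`IsContraction.exists_isSolution`, `IsContraction.abs_solution_sub_le`). Complete orbits of the
return map correspond exactly to these fixed points, so the map from words to orbits is a continuous
bijection from a compact space to a Hausdorff space; `π` is its inverse. -/

theorem eq_of_periodic_injOn {γ : ℝ → ℂ} {L : ℝ} (hL : 0 < L) (hp : Function.Periodic γ L)
    (hinj : InjOn γ (Ico 0 L)) {a b : ℝ} (h : γ a = γ b) (hab : |a - b| < L) : a = b := by
  have ha : γ (toIcoMod hL 0 a) = γ a := by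
    rw [toIcoMod]; exact hp.sub_zsmul_eq _
  have hb : γ (toIcoMod hL 0 b) = γ b := by
    rw [toIcoMod]; exact hp.sub_zsmul_eq _
  have h0 : toIcoMod hL 0 a = toIcoMod hL 0 b := by
    apply hinj
    · simpa using toIcoMod_mem_Ico hL 0 a
    · simpa using toIcoMod_mem_Ico hL 0 b
    · rw [ha, hb, h]
  simp only [toIcoMod, zsmul_eq_mul] at h0
  have h1 : a - b = ((toIcoDiv hL 0 a - toIcoDiv hL 0 b : ℤ) : ℝ) * L := by
    push_cast; linarith
  rw [h1, abs_mul, abs_of_pos hL] at hab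
  have h2 : |((toIcoDiv hL 0 a - toIcoDiv hL 0 b : ℤ) : ℝ)| < 1 := by
    by_contra hcon
    push Not at hcon
    nlinarith
  rw [← Int.cast_abs] at h2
  have h3 : |toIcoDiv hL 0 a - toIcoDiv hL 0 b| < 1 := by exact_mod_cast h2
  have h4 := Int.abs_lt_one_iff.mp h3
  rw [h4] at h1
  simp at h1
  linarith

/-- Near a point where the curve is transversal to the radial direction, a segment that starts on
the curve in a nearly radial direction leaves the curve at once. -/
theorem eventually_ne_of_transversal {γ : ℝ → ℂ} {t : ℂ} {ξ : ℝ} (hd : HasStrictDerivAt γ t ξ)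
    (ht : ‖t‖ = 1) (hp : γ ξ ≠ 0) (hperp : ⟪t, γ ξ⟫_ℝ = 0) :
    ∀ᶠ z : (ℝ × ℂ) × (ℝ × ℝ) in 𝓝 ((ξ, 0), (0, ξ)), z.2.1 ≠ 0 →
      γ z.1.1 + z.2.1 • (γ z.1.1 + z.1.2) ≠ γ z.2.2 := by
  have hP : 0 < ‖γ ξ‖ := norm_pos_iff.mpr hp
  have hstr : ∀ᶠ w : ℝ × ℝ in 𝓝 (ξ, ξ),
      ‖γ w.1 - γ w.2 - (w.1 - w.2) • t‖ ≤ 1 / 32 * ‖w.1 - w.2‖ := by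
    have := (hasStrictDerivAt_iff_hasStrictFDerivAt.mp hd).isLittleO.def
      (show (0 : ℝ) < 1 / 32 by norm_num)
    simpa using this
  have hcont : ContinuousAt γ ξ := hd.hasDerivAt.continuousAt
  have h1 : Tendsto (fun z : (ℝ × ℂ) × (ℝ × ℝ) => (z.2.2, z.1.1)) (𝓝 ((ξ, 0), (0, ξ)))
      (𝓝 (ξ, ξ)) := by
    have : Continuous (fun z : (ℝ × ℂ) × (ℝ × ℝ) => (z.2.2, z.1.1)) := by fun_prop
    exact this.tendsto' _ _ rfl
  have hg : ContinuousAt (fun z : (ℝ × ℂ) × (ℝ × ℝ) => γ z.1.1 + z.1.2) ((ξ, 0), (0, ξ)) := by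
    have : ContinuousAt (fun z : (ℝ × ℂ) × (ℝ × ℝ) => γ z.1.1) ((ξ, 0), (0, ξ)) :=
      ContinuousAt.comp (g := γ) hcont (by fun_prop)
    exact this.add (by fun_prop)
  have h2 : ∀ᶠ z : (ℝ × ℂ) × (ℝ × ℝ) in 𝓝 ((ξ, 0), (0, ξ)),
      ‖γ z.1.1 + z.1.2‖ < 2 * ‖γ ξ‖ := by
    apply (hg.norm).eventually_lt continuousAt_const
    simp; linarith
  have h3 : ∀ᶠ z : (ℝ × ℂ) × (ℝ × ℝ) in 𝓝 ((ξ, 0), (0, ξ)),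
      ‖γ ξ‖ ^ 2 / 2 < ⟪γ z.1.1 + z.1.2, γ ξ⟫_ℝ := by
    apply continuousAt_const.eventually_lt (hg.inner continuousAt_const)
    simp only [add_zero, real_inner_self_eq_norm_sq]
    nlinarith
  filter_upwards [h1.eventually hstr, h2, h3] with z hz1 hz2 hz3 hk heq
  obtain ⟨⟨x, e⟩, ⟨k, y⟩⟩ := z
  simp only at *
  have e1 : γ y - γ x = k • (γ x + e) := by rw [← heq]; ring
  rw [e1] at hz1
  set g := γ x + e with hgdef
  set d := y - x with hddef
  have hk0 : 0 < |k| := abs_pos.mpr hk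
  -- An intersection would give `|d| ≤ 4|k|‖γ ξ‖`. Projecting on the radius, to which `t` is
  -- orthogonal, then gives `|k|‖γ ξ‖²/2 ≤ |k|‖γ ξ‖²/8`, which is impossible for `k ≠ 0`.
  have n1 : |d| ≤ 2 * (|k| * (2 * ‖γ ξ‖)) := by
    have a1 : ‖d • t‖ ≤ ‖k • g‖ + ‖k • g - d • t‖ := by
      have := norm_sub_le (k • g) (k • g - d • t)
      simpa using this
    rw [norm_smul, norm_smul, ht, mul_one, Real.norm_eq_abs, Real.norm_eq_abs] at a1
    have a2 : |k| * ‖g‖ ≤ |k| * (2 * ‖γ ξ‖) := by gcongr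
    rw [Real.norm_eq_abs] at hz1
    linarith [abs_nonneg d]
  have n2 : |k| * (‖γ ξ‖ ^ 2 / 2) ≤ 1 / 32 * |d| * ‖γ ξ‖ := by
    have b1 : ⟪k • g - d • t, γ ξ⟫_ℝ = k * ⟪g, γ ξ⟫_ℝ := by
      rw [inner_sub_left, real_inner_smul_left, real_inner_smul_left, hperp]; ring
    have b2 : |k * ⟪g, γ ξ⟫_ℝ| ≤ ‖k • g - d • t‖ * ‖γ ξ‖ := by
      rw [← b1]; exact abs_real_inner_le_norm _ _
    rw [abs_mul] at b2
    have b3 : ‖γ ξ‖ ^ 2 / 2 ≤ |⟪g, γ ξ⟫_ℝ| := hz3.le.trans (le_abs_self _)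
    calc |k| * (‖γ ξ‖ ^ 2 / 2) ≤ |k| * |⟪g, γ ξ⟫_ℝ| := by gcongr
      _ ≤ ‖k • g - d • t‖ * ‖γ ξ‖ := b2
      _ ≤ _ := by rw [Real.norm_eq_abs] at hz1; gcongr
  have n3 : 1 / 32 * |d| * ‖γ ξ‖ ≤ 1 / 32 * (2 * (|k| * (2 * ‖γ ξ‖))) * ‖γ ξ‖ := by gcongr
  have : 0 < |k| * ‖γ ξ‖ ^ 2 := by positivity
  nlinarith

/-- Compactness in `k` and in one period of the curve parameter. At the base point star-convexity
leaves `(k, y) = (0, ξ)` as the only intersection; near it transversality applies, elsewhere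
continuity does. The bound `-1 ≤ k` keeps the factor `1 + k` on the half-line. -/
theorem eventually_ray_notMem_range {γ : ℝ → ℂ} {L : ℝ} (hL : 0 < L)
    (hp : Function.Periodic γ L) (hinj : InjOn γ (Ico 0 L)) (hc : Continuous γ) {t : ℂ} {ξ : ℝ}
    (hd : HasStrictDerivAt γ t ξ) (ht : ‖t‖ = 1) (h0 : γ ξ ≠ 0) (hperp : ⟪t, γ ξ⟫_ℝ = 0)
    (hstar : LocalStarConvex γ ξ) (K : ℝ) :
    ∀ᶠ z : ℝ × ℂ in 𝓝 (ξ, 0), ∀ k ∈ Icc (-1) K, k ≠ 0 →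
      γ z.1 + k • (γ z.1 + z.2) ∉ range γ := by
  have hcomp : IsCompact (Icc (-1) K ×ˢ Icc (ξ - L / 2) (ξ + L / 2)) :=
    isCompact_Icc.prod isCompact_Icc
  have key : ∀ᶠ z : ℝ × ℂ in 𝓝 (ξ, 0), ∀ w ∈ (Icc (-1) K ×ˢ Icc (ξ - L / 2) (ξ + L / 2)),
      w.1 ≠ 0 → γ z.1 + w.1 • (γ z.1 + z.2) ≠ γ w.2 := by
    apply hcomp.eventually_forall_of_forall_eventually
    rintro ⟨k, y⟩ ⟨hk, hy⟩
    simp only at hk hy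
    by_cases hne : γ ξ + k • (γ ξ + 0) = γ y
    · have e1 : (1 + k) • γ ξ = γ y := by rw [← hne, add_zero, add_smul, one_smul]
      have e2 := hstar (1 + k) (by linarith [hk.1]) ⟨y, e1.symm⟩
      have hk0 : k = 0 := by
        have : k • γ ξ = 0 := by
          rw [add_smul, one_smul] at e2; simpa using e2
        exact (smul_eq_zero.mp this).resolve_right h0
      have hyξ : y = ξ := by
        apply eq_of_periodic_injOn hL hp hinj (by rw [← e1, e2])
        rw [abs_lt]; constructor <;> linarith [hy.1, hy.2]
      subst hk0; subst hyξ
      exact eventually_ne_of_transversal hd ht h0 hperp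
    · have : ContinuousAt (fun z : (ℝ × ℂ) × (ℝ × ℝ) =>
          γ z.1.1 + z.2.1 • (γ z.1.1 + z.1.2) - γ z.2.2) ((ξ, 0), (k, y)) := by fun_prop
      have h2 := this.eventually_ne (sub_ne_zero.mpr hne)
      filter_upwards [h2] with z hz _ h
      exact hz (sub_eq_zero.mpr h)
  filter_upwards [key] with z hz k hk hk0 hmem
  obtain ⟨y, hy⟩ := hmem
  set y' := toIcoMod hL (ξ - L / 2) y with hy'
  have h1 : y' ∈ Ico (ξ - L / 2) (ξ - L / 2 + L) := toIcoMod_mem_Ico hL _ y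
  have h2 : γ y' = γ y := by
    rw [hy', toIcoMod]; exact hp.sub_zsmul_eq _
  exact hz (k, y') ⟨hk, h1.1, by simp only; linarith [h1.2]⟩ hk0 (by rw [h2, hy])

theorem _root_.IsPreconnected.inter_frontier_nonempty_of_isOpen {X : Type*} [TopologicalSpace X]
    {s t : Set X} (ht : IsPreconnected t) (hs : IsOpen s) (h1 : (t ∩ s).Nonempty)
    (h2 : (t ∩ sᶜ).Nonempty) : (t ∩ frontier s).Nonempty := by
  by_contra! hcon
  have hsub : ∀ x ∈ t, x ∈ closure s → x ∈ s := by
    intro x hx hxs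
    by_contra hno
    have : x ∈ t ∩ frontier s := ⟨hx, by rw [hs.frontier_eq]; exact ⟨hxs, hno⟩⟩
    simp [hcon] at this
  obtain ⟨x, hx, hxs⟩ := h2
  obtain ⟨y, -, hy1, hy2⟩ := ht s (closure s)ᶜ hs isClosed_closure.isOpen_compl
    (fun x hx => by
      by_cases h : x ∈ closure s
      · exact Or.inl (hsub x hx h)
      · exact Or.inr h) h1 ⟨x, hx, fun h => hxs (hsub x hx h)⟩
  exact hy2 (subset_closure hy1)

section Domain

variable {D : Set ℂ} {γ : ℝ → ℂ} {L : ℝ}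

theorem IsDomainWithBoundary.hasStrictDerivAt (hD : IsDomainWithBoundary D γ L) (ξ : ℝ) :
    HasStrictDerivAt γ (deriv γ ξ) ξ :=
  hD.contDiff.contDiffAt.hasStrictDerivAt (by norm_num)

theorem IsDomainWithBoundary.continuous_deriv (hD : IsDomainWithBoundary D γ L) :
    Continuous (deriv γ) := hD.contDiff.continuous_deriv (by norm_num)

theorem IsDomainWithBoundary.mem_frontier (hD : IsDomainWithBoundary D γ L) (ξ : ℝ) :
    γ ξ ∈ frontier D := hD.range_eq ▸ mem_range_self ξ

theorem IsDomainWithBoundary.notMem (hD : IsDomainWithBoundary D γ L) (ξ : ℝ) : γ ξ ∉ D := by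
  have := hD.mem_frontier ξ
  rw [hD.isOpen.frontier_eq] at this
  exact this.2

theorem IsDomainWithBoundary.mem_closure (hD : IsDomainWithBoundary D γ L) (ξ : ℝ) :
    γ ξ ∈ closure D := frontier_subset_closure (hD.mem_frontier ξ)

theorem IsDomainWithBoundary.ne_zero (hD : IsDomainWithBoundary D γ L) (ξ : ℝ) : γ ξ ≠ 0 :=
  fun h => hD.notMem ξ (h ▸ hD.zero_mem)

theorem IsCentralConfiguration.inner_eq_zero (hD : IsDomainWithBoundary D γ L) {ξ : ℝ}
    (h : IsCentralConfiguration γ ξ) : ⟪deriv γ ξ, γ ξ⟫_ℝ = 0 := by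
  have h1 : HasDerivAt (fun x => ‖γ x‖ ^ 2) (2 * ⟪γ ξ, deriv γ ξ⟫_ℝ) ξ :=
    (hD.hasStrictDerivAt ξ).hasDerivAt.norm_sq
  have h2 := h.1.pow 2
  have h3 := h1.unique h2
  rw [real_inner_comm]
  simpa using h3

theorem IsDomainWithBoundary.norm_lt {R : ℝ} (hD : IsDomainWithBoundary D γ L)
    (hR : closure D ⊆ Metric.ball 0 R) (ξ : ℝ) : ‖γ ξ‖ < R := by
  simpa using hR (hD.mem_closure ξ)

/-- At `k = -1` the segment is at `-z.2`, close to the origin and so in `D`; it cannot leave `D`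
without meeting the boundary curve. -/
theorem IsCentralConfiguration.eventually_inside (hD : IsDomainWithBoundary D γ L) {ξ : ℝ}
    (h : IsCentralConfiguration γ ξ) :
    ∀ᶠ z : ℝ × ℂ in 𝓝 (ξ, 0), ∀ k ∈ Ico (-1 : ℝ) 0, γ z.1 + k • (γ z.1 + z.2) ∈ D := by
  have h1 := eventually_ray_notMem_range hD.period_pos hD.periodic hD.injOn
    hD.contDiff.continuous (hD.hasStrictDerivAt ξ) (hD.unit_speed ξ) (hD.ne_zero ξ)
    (h.inner_eq_zero hD) h.2 0
  have h2 : ∀ᶠ z : ℝ × ℂ in 𝓝 (ξ, 0), -z.2 ∈ D := by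
    have : Continuous fun z : ℝ × ℂ => -z.2 := by fun_prop
    apply this.continuousAt.eventually_mem
    simpa using hD.isOpen.mem_nhds hD.zero_mem
  filter_upwards [h1, h2] with z hz1 hz2
  by_contra! hcon
  obtain ⟨k, hk, hkD⟩ := hcon
  have hpre : IsPreconnected ((fun k : ℝ => γ z.1 + k • (γ z.1 + z.2)) '' Ico (-1 : ℝ) 0) :=
    isPreconnected_Ico.image _ (by fun_prop)
  have := hpre.inter_frontier_nonempty_of_isOpen (t := (fun k : ℝ => γ z.1 + k • (γ z.1 + z.2)) ''
      Ico (-1 : ℝ) 0) (s := D) hD.isOpen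
    ⟨-z.2, ⟨-1, by simp, by simp⟩, hz2⟩ ⟨_, ⟨k, hk, rfl⟩, hkD⟩
  obtain ⟨_, ⟨k', hk', rfl⟩, hfr⟩ := this
  rw [← hD.range_eq] at hfr
  exact hz1 k' ⟨hk'.1, hk'.2.le⟩ hk'.2.ne hfr

theorem IsCentralConfiguration.eventually_outside (hD : IsDomainWithBoundary D γ L) {ξ : ℝ}
    (h : IsCentralConfiguration γ ξ) :
    ∀ᶠ z : ℝ × ℂ in 𝓝 (ξ, 0), ∀ k : ℝ, 0 < k → γ z.1 + k • (γ z.1 + z.2) ∉ closure D := by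
  obtain ⟨R, hR⟩ := hD.isBounded.closure.subset_ball (0 : ℂ)
  have hP : 0 < ‖γ ξ‖ := norm_pos_iff.mpr (hD.ne_zero ξ)
  have hR0 : 0 < R := by
    have := hD.norm_lt hR ξ
    linarith
  -- Beyond this `K` the ray is outside the ball of radius `R` containing `closure D`: its norm is
  -- at least `(1 + k)‖γ ξ‖/2 - k‖γ ξ‖/4`.
  set K := 4 * R / ‖γ ξ‖ with hK
  have hK0 : 0 < K := by positivity
  have h1 := eventually_ray_notMem_range hD.period_pos hD.periodic hD.injOn
    hD.contDiff.continuous (hD.hasStrictDerivAt ξ) (hD.unit_speed ξ) (hD.ne_zero ξ)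
    (h.inner_eq_zero hD) h.2 K
  have hc : Continuous γ := hD.contDiff.continuous
  have h2 : ∀ᶠ z : ℝ × ℂ in 𝓝 (ξ, 0), ‖γ ξ‖ / 2 < ‖γ z.1‖ := by
    have : Continuous fun z : ℝ × ℂ => ‖γ z.1‖ := by fun_prop
    exact this.continuousAt.eventually (lt_mem_nhds (by simp only; linarith))
  have h3 : ∀ᶠ z : ℝ × ℂ in 𝓝 (ξ, 0), ‖z.2‖ < ‖γ ξ‖ / 4 := by
    have : Continuous fun z : ℝ × ℂ => ‖z.2‖ := by fun_prop
    exact this.continuousAt.eventually (gt_mem_nhds (by simp only [norm_zero]; linarith))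
  filter_upwards [h1, h2, h3] with z hz1 hz2 hz3
  have hfar : ∀ k : ℝ, K ≤ k → γ z.1 + k • (γ z.1 + z.2) ∉ closure D := by
    intro k hk hmem
    have hk0 : 0 < k := hK0.trans_le hk
    have := hR hmem
    rw [mem_ball_zero_iff] at this
    have e1 : γ z.1 + k • (γ z.1 + z.2) = (1 + k) • γ z.1 - (-(k • z.2)) := by
      rw [add_smul, one_smul, smul_add]; ring
    have e2 := norm_sub_norm_le ((1 + k) • γ z.1) (-(k • z.2))
    rw [← e1, norm_neg, norm_smul, norm_smul, Real.norm_eq_abs, Real.norm_eq_abs,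
      abs_of_pos hk0, abs_of_pos (by linarith)] at e2
    have e3 : 4 * R ≤ k * ‖γ ξ‖ := by
      rw [hK, div_le_iff₀ hP] at hk; exact hk
    nlinarith
  by_contra! hcon
  obtain ⟨k, hk, hkD⟩ := hcon
  have hpre : IsPreconnected ((fun k : ℝ => γ z.1 + k • (γ z.1 + z.2)) '' Ioi (0 : ℝ)) :=
    isPreconnected_Ioi.image _ (by fun_prop)
  have hnf : ∀ k' : ℝ, 0 < k' → γ z.1 + k' • (γ z.1 + z.2) ∉ frontier D := by
    intro k' hk' hfr
    rcases le_total K k' with hle | hle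
    · exact hfar k' hle (frontier_subset_closure hfr)
    · rw [← hD.range_eq] at hfr
      exact hz1 k' ⟨by linarith, hle⟩ hk'.ne' hfr
  have hkD' : γ z.1 + k • (γ z.1 + z.2) ∈ D := by
    by_contra hno
    apply hnf k hk
    rw [hD.isOpen.frontier_eq]
    exact ⟨hkD, hno⟩
  have := hpre.inter_frontier_nonempty_of_isOpen (t := (fun k : ℝ => γ z.1 + k • (γ z.1 + z.2)) ''
      Ioi (0 : ℝ)) (s := D) hD.isOpen
    ⟨_, ⟨k, hk, rfl⟩, hkD'⟩ ⟨_, ⟨K, hK0, rfl⟩, fun hm => hfar K le_rfl (subset_closure hm)⟩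
  obtain ⟨_, ⟨k', hk', rfl⟩, hfr⟩ := this
  exact hnf k' hk' hfr

/-- At a central configuration the outward normal is radial. -/
theorem IsCentralConfiguration.normal_eq (hD : IsDomainWithBoundary D γ L) {ξ : ℝ}
    (h : IsCentralConfiguration γ ξ) : γ ξ = (‖γ ξ‖ : ℂ) * (-Complex.I * deriv γ ξ) := by
  set t := deriv γ ξ with ht
  have hperp := h.inner_eq_zero hD
  have hunit : t.re ^ 2 + t.im ^ 2 = 1 := by
    have := hD.unit_speed ξ
    have h2 : ‖t‖ ^ 2 = 1 := by rw [ht, this]; norm_num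
    rw [← Complex.normSq_eq_norm_sq, Complex.normSq_apply] at h2
    linarith
  have hP : 0 < ‖γ ξ‖ := norm_pos_iff.mpr (hD.ne_zero ξ)
  rw [Complex.inner] at hperp
  simp at hperp
  rw [← ht] at hperp
  set a := (γ ξ).re * t.im - (γ ξ).im * t.re with ha
  have e1 : γ ξ = (a : ℂ) * (-Complex.I * t) := by
    apply Complex.ext
    · simp [ha]
      linear_combination (-(γ ξ).re) * hunit + t.re * hperp
    · simp [ha]
      linear_combination (-(γ ξ).im) * hunit + t.im * hperp
  have hn : ‖-Complex.I * t‖ = 1 := by simp [ht, hD.unit_speed ξ]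
  have e2 : ‖γ ξ‖ = |a| := by
    conv_lhs => rw [e1]
    rw [norm_mul, hn, mul_one, Complex.norm_real, Real.norm_eq_abs]
  rcases le_total 0 a with hpos | hneg
  · rw [e2, abs_of_nonneg hpos]; exact e1
  -- If the outward normal pointed towards the origin, a small step along it would stay on the
  -- radial segment, which is inside `D`.
  · exfalso
    rw [abs_of_nonpos hneg] at e2
    have h1 := (h.eventually_inside hD).self_of_nhds
    have h3 : ∀ᶠ ε : ℝ in 𝓝[>] 0, ε < ‖γ ξ‖ := mem_nhdsWithin_of_mem_nhds (gt_mem_nhds hP)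
    obtain ⟨ε, ⟨⟨-, hout⟩, hε⟩, hε0⟩ := (((hD.outward ξ).and h3).and
      self_mem_nhdsWithin).exists
    replace hε0 : 0 < ε := hε0
    apply hout
    apply subset_closure
    have := h1 (-ε / ‖γ ξ‖) ⟨by rw [le_div_iff₀ hP]; linarith, by
      apply div_neg_of_neg_of_pos <;> linarith⟩
    convert this using 2
    rw [add_zero, Complex.real_smul]
    rw [e2]
    conv_rhs => rw [e1]
    have ha0 : (a : ℂ) ≠ 0 := by
      rw [e2] at hP
      exact_mod_cast (by linarith : a < 0).ne
    rw [← ht]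
    push_cast
    field_simp

end Domain

end RefractionBilliard

/-! ### Harmonic arcs between two boundary points. -/

namespace RefractionBilliard
open scoped InnerProductSpace

/-- A function with vanishing derivative on `[0, T]` is constant. -/
theorem eq_of_hasDerivWithinAt_zero {F : Type*} [NormedAddCommGroup F] [NormedSpace ℝ F]
    {f : ℝ → F} {T : ℝ} (h : ∀ s ∈ Icc 0 T, HasDerivWithinAt f 0 (Icc 0 T) s) {s : ℝ}
    (hs : s ∈ Icc 0 T) : f s = f 0 := by
  rcases eq_or_lt_of_le (hs.1.trans hs.2) with h0 | h0
  · have : s = 0 := le_antisymm (h0 ▸ hs.2) hs.1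
    rw [this]
  · exact constant_of_derivWithin_zero (fun x hx => (h x hx).differentiableWithinAt)
      (fun x hx => (h x ⟨hx.1, hx.2.le⟩).derivWithin
        (uniqueDiffOn_Icc h0 x ⟨hx.1, hx.2.le⟩)) s hs

/-- The discriminant of the quadratic equation for the cosine of the phase of a harmonic arc of
squared amplitude radius `ρ` that joins `p` to `q`. -/
noncomputable def outDisc (ρ : ℝ) (p q : ℂ) : ℝ :=
  ⟪p, q⟫_ℝ ^ 2 - ρ * (‖p‖ ^ 2 + ‖q‖ ^ 2 - ρ)

/-- The cosine of the phase of the long harmonic arc from `p` to `q`. -/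
noncomputable def outC (ρ : ℝ) (p q : ℂ) : ℝ := (⟪p, q⟫_ℝ - √(outDisc ρ p q)) / ρ

/-- The cosine of the phase of the short harmonic arc from `p` to `q`. -/
noncomputable def outC' (ρ : ℝ) (p q : ℂ) : ℝ := (⟪p, q⟫_ℝ + √(outDisc ρ p q)) / ρ

/-- The initial velocity of the long harmonic arc from `p` to `q`. -/
noncomputable def outV (ρ ω : ℝ) (p q : ℂ) : ℂ :=
  (ω / √(1 - outC ρ p q ^ 2)) • (q - outC ρ p q • p)

theorem outDisc_comm (ρ : ℝ) (p q : ℂ) : outDisc ρ p q = outDisc ρ q p := by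
  rw [outDisc, outDisc, real_inner_comm]; ring

theorem outC_comm (ρ : ℝ) (p q : ℂ) : outC ρ p q = outC ρ q p := by
  rw [outC, outC, real_inner_comm, outDisc_comm]

/-- Elimination of the velocity from `q = c p + (s/ω) v` with `s² + c² = 1` and `‖v‖² = ω²(ρ -
‖p‖²)` leaves this quadratic in `c`; its other root is `outC'`. -/
theorem outC_root {ρ : ℝ} (hρ : 0 < ρ) {p q : ℂ} (h : 0 ≤ outDisc ρ p q) :
    ρ * outC ρ p q ^ 2 - 2 * outC ρ p q * ⟪p, q⟫_ℝ + ‖p‖ ^ 2 + ‖q‖ ^ 2 - ρ = 0 := by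
  have h1 := Real.sq_sqrt h
  have h2 : ρ * outC ρ p q = ⟪p, q⟫_ℝ - √(outDisc ρ p q) := by rw [outC]; field_simp
  have h3 : ρ * (ρ * outC ρ p q ^ 2 - 2 * outC ρ p q * ⟪p, q⟫_ℝ + ‖p‖ ^ 2 + ‖q‖ ^ 2 - ρ) = 0 := by
    have : ρ * (ρ * outC ρ p q ^ 2 - 2 * outC ρ p q * ⟪p, q⟫_ℝ + ‖p‖ ^ 2 + ‖q‖ ^ 2 - ρ)
        = (ρ * outC ρ p q) ^ 2 - 2 * (ρ * outC ρ p q) * ⟪p, q⟫_ℝ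
          + ρ * (‖p‖ ^ 2 + ‖q‖ ^ 2 - ρ) := by ring
    rw [this, h2]
    rw [outDisc] at h1 ⊢
    linear_combination h1
  exact (mul_eq_zero.mp h3).resolve_left hρ.ne'

theorem eq_outC_or_of_root {ρ : ℝ} (hρ : 0 < ρ) {p q : ℂ} (h : 0 ≤ outDisc ρ p q) {c : ℝ}
    (hc : ρ * c ^ 2 - 2 * c * ⟪p, q⟫_ℝ + ‖p‖ ^ 2 + ‖q‖ ^ 2 - ρ = 0) :
    c = outC ρ p q ∨ c = outC' ρ p q := by
  have h1 := Real.sq_sqrt h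
  have h2 : (ρ * c - (⟪p, q⟫_ℝ - √(outDisc ρ p q))) * (ρ * c - (⟪p, q⟫_ℝ + √(outDisc ρ p q)))
      = 0 := by
    have : (ρ * c - (⟪p, q⟫_ℝ - √(outDisc ρ p q))) * (ρ * c - (⟪p, q⟫_ℝ + √(outDisc ρ p q)))
      = (ρ * c) ^ 2 - 2 * (ρ * c) * ⟪p, q⟫_ℝ + ⟪p, q⟫_ℝ ^ 2 - √(outDisc ρ p q) ^ 2 := by ring
    rw [this, h1, outDisc]
    linear_combination ρ * hc
  rcases mul_eq_zero.mp h2 with h3 | h3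
  · left; rw [outC, eq_div_iff hρ.ne']; linarith
  · right; rw [outC', eq_div_iff hρ.ne']; linarith

theorem norm_outV_sq {ρ ω : ℝ} (hρ : 0 < ρ) {p q : ℂ} (h : 0 ≤ outDisc ρ p q)
    (h1 : -1 < outC ρ p q) (h2 : outC ρ p q < 1) :
    ‖outV ρ ω p q‖ ^ 2 = ω ^ 2 * (ρ - ‖p‖ ^ 2) := by
  have hs : 0 < 1 - outC ρ p q ^ 2 := by nlinarith
  have hr := outC_root hρ h
  rw [outV, norm_smul, mul_pow, Real.norm_eq_abs, sq_abs, div_pow, Real.sq_sqrt hs.le,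
    norm_sub_sq_real, norm_smul, real_inner_smul_right, mul_pow, Real.norm_eq_abs, sq_abs,
    real_inner_comm, div_mul_eq_mul_div, div_eq_iff hs.ne']
  linear_combination ω ^ 2 * hr

/-- In half-angles `a = φ/2`, `b = θ/2` the difference of the two sides is `4 sin a sin b (sin b cos
a - 2 cos b sin a)`, and `a ≤ b - a` gives `sin b cos a - cos b sin a ≥ sin a ≥ cos b sin a`. -/
theorem sin_mul_le_of_le_half {φ θ : ℝ} (h0 : 0 < φ) (h1 : φ ≤ θ / 2) (h2 : θ < Real.pi) :
    Real.sin φ * (1 - Real.cos θ) ≤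
      2 * (Real.sin (θ - φ) + Real.sin φ - Real.sin θ) := by
  obtain ⟨a, rfl⟩ : ∃ a, φ = 2 * a := ⟨φ / 2, by ring⟩
  obtain ⟨b, rfl⟩ : ∃ b, θ = 2 * b := ⟨θ / 2, by ring⟩
  have hab : Real.sin a ≤ Real.sin (b - a) :=
    Real.sin_le_sin_of_le_of_le_pi_div_two (by linarith) (by linarith) (by linarith)
  have ha : 0 < Real.sin a := Real.sin_pos_of_pos_of_lt_pi (by linarith) (by linarith)
  have hb : 0 < Real.sin b := Real.sin_pos_of_pos_of_lt_pi (by linarith) (by linarith)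
  have hcb := Real.cos_le_one b
  rw [Real.sin_sub] at hab
  have e1 : Real.cos b * Real.sin a ≤ 1 * Real.sin a := by gcongr
  rw [Real.sin_sub, Real.sin_two_mul, Real.sin_two_mul, Real.cos_two_mul, Real.cos_two_mul]
  have s1 := Real.sin_sq_add_cos_sq a
  have s2 := Real.sin_sq_add_cos_sq b
  have key : 0 ≤ 4 * Real.sin a * Real.sin b *
      (Real.sin b * Real.cos a - 2 * (Real.cos b * Real.sin a)) :=
    mul_nonneg (by positivity) (by linarith)
  have c1 : Real.cos a ^ 2 = 1 - Real.sin a ^ 2 := by linarith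
  have c2 : Real.cos b ^ 2 = 1 - Real.sin b ^ 2 := by linarith
  rw [c1, c2]
  linarith

/-- Two points, with unit vectors attached, that are close enough to each other and to a central
configuration for the long harmonic arc to be the only transversal outer arc between them. -/
structure OuterGood (D : Set ℂ) (ρ ω κ : ℝ) (p n q n' : ℂ) : Prop where
  norm_eq : ‖n‖ = 1
  disc : 0 < outDisc ρ p q
  neg_one_lt : -1 < outC ρ p q
  lt_one : outC ρ p q < 1
  pos' : 0 < outC' ρ p q
  denom_pos : 0 < ρ * (1 + outC' ρ p q) - 2 * ⟪p, q⟫_ℝ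
  dist_le : ‖q - p‖ * ‖p‖ ≤ κ / 4 * (ρ * (1 + outC' ρ p q) - 2 * ⟪p, q⟫_ℝ)
  chord_le : |⟪q - p, n⟫_ℝ| ≤ κ / 2 * ‖q - p‖
  normal_sub : ‖n - n'‖ ≤ 2 * κ
  transversal : κ * ‖outV ρ ω p q‖ < ⟪outV ρ ω p q, n⟫_ℝ
  transversal' : κ * ‖outV ρ ω q p‖ < ⟪outV ρ ω q p, n'⟫_ℝ
  outside : ∀ e : ℂ, ‖e‖ ≤ 2 * ‖q - p‖ / (1 - outC ρ p q) → ∀ k : ℝ, 0 < k →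
    p + k • (p + e) ∉ closure D
  outside' : ∀ e : ℂ, ‖e‖ ≤ 2 * ‖q - p‖ / (1 - outC ρ p q) → ∀ k : ℝ, 0 < k →
    q + k • (q + e) ∉ closure D

/-- Puts the first half of a harmonic arc in the form treated by `eventually_outside`. The scalar
`k` is the excess over `1` of the sum of the coefficients of `p` and `q`; `e` is the multiple of `q
- p` that is left over, and `sin_mul_le_of_le_half` bounds it. -/
theorem exists_eq_add_smul_of_phase {p q : ℂ} {φ θ : ℝ} (h0 : 0 < φ) (h1 : φ ≤ θ / 2)
    (h2 : θ < Real.pi) :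
    ∃ (k : ℝ) (e : ℂ), 0 < k ∧ ‖e‖ ≤ 2 * ‖q - p‖ / (1 - Real.cos θ) ∧
      (Real.sin (θ - φ) / Real.sin θ) • p + (Real.sin φ / Real.sin θ) • q = p + k • (p + e) := by
  have hsθ : 0 < Real.sin θ := Real.sin_pos_of_pos_of_lt_pi (by linarith) h2
  have hsφ : 0 < Real.sin φ := Real.sin_pos_of_pos_of_lt_pi h0 (by linarith)
  have hc : 0 < 1 - Real.cos θ := by
    nlinarith [Real.sin_sq_add_cos_sq θ, Real.cos_le_one θ, Real.neg_one_le_cos θ]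
  have hb := sin_mul_le_of_le_half h0 h1 h2
  set k' := Real.sin (θ - φ) + Real.sin φ - Real.sin θ with hk'
  have hk0 : 0 < k' := by nlinarith [mul_pos hsφ hc]
  refine ⟨k' / Real.sin θ, (Real.sin φ / k') • (q - p), by positivity, ?_, ?_⟩
  · rw [norm_smul, Real.norm_eq_abs, abs_of_pos (by positivity), div_mul_eq_mul_div,
      div_le_div_iff₀ hk0 hc]
    nlinarith [mul_le_mul_of_nonneg_right hb (norm_nonneg (q - p))]
  · simp only [Complex.real_smul]
    have : Complex.sin θ ≠ 0 := by rw [← Complex.ofReal_sin]; exact_mod_cast hsθ.ne'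
    have : (k' : ℂ) ≠ 0 := by exact_mod_cast hk0.ne'
    push_cast
    field_simp
    rw [hk']
    push_cast
    ring

variable {B : Billiard}

/-- Applying the inverse harmonic flow to `(z, v)` gives two vectors with zero derivative. -/
theorem Billiard.IsOuterArc.eq_solution (hω : B.ω ≠ 0) {z v : ℝ → ℂ} {T : ℝ}
    (h : B.IsOuterArc z v T) {s : ℝ} (hs : s ∈ Icc 0 T) :
    z s = Real.cos (B.ω * s) • z 0 + (Real.sin (B.ω * s) / B.ω) • v 0 ∧
      v s = -(B.ω * Real.sin (B.ω * s)) • z 0 + Real.cos (B.ω * s) • v 0 := by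
  have hcos : ∀ s : ℝ, HasDerivAt (fun s => Real.cos (B.ω * s))
      (-Real.sin (B.ω * s) * B.ω) s := fun s =>
    (Real.hasDerivAt_cos _).comp s (by simpa using (hasDerivAt_id s).const_mul B.ω)
  have hsin : ∀ s : ℝ, HasDerivAt (fun s => Real.sin (B.ω * s))
      (Real.cos (B.ω * s) * B.ω) s := fun s =>
    (Real.hasDerivAt_sin _).comp s (by simpa using (hasDerivAt_id s).const_mul B.ω)
  have h1 : ∀ s ∈ Icc 0 T, HasDerivWithinAt
      (fun s => Real.cos (B.ω * s) • z s - (Real.sin (B.ω * s) / B.ω) • v s) 0 (Icc 0 T) s := by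
    intro s hs
    refine (((hcos s).hasDerivWithinAt.smul (h.deriv_pos s hs)).sub
      (((hsin s).div_const B.ω).hasDerivWithinAt.smul (h.deriv_vel s hs))).congr_deriv ?_
    simp only [Complex.real_smul]
    push_cast
    have : (B.ω : ℂ) ≠ 0 := by exact_mod_cast hω
    field_simp
    ring
  have h2 : ∀ s ∈ Icc 0 T, HasDerivWithinAt
      (fun s => (B.ω * Real.sin (B.ω * s)) • z s + Real.cos (B.ω * s) • v s) 0 (Icc 0 T) s := by
    intro s hs
    refine ((((hsin s).const_mul B.ω).hasDerivWithinAt.smul (h.deriv_pos s hs)).add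
      ((hcos s).hasDerivWithinAt.smul (h.deriv_vel s hs))).congr_deriv ?_
    simp only [Complex.real_smul]
    push_cast
    ring
  have e1 := eq_of_hasDerivWithinAt_zero h1 hs
  have e2 := eq_of_hasDerivWithinAt_zero h2 hs
  simp only [mul_zero, Real.cos_zero, Real.sin_zero, zero_div, zero_smul, one_smul, sub_zero,
    zero_add] at e1 e2
  rw [← e1, ← e2]
  have hsc : (Real.sin (B.ω * s) : ℂ) ^ 2 + (Real.cos (B.ω * s) : ℂ) ^ 2 = 1 := by
    exact_mod_cast Real.sin_sq_add_cos_sq (B.ω * s)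
  have : (B.ω : ℂ) ≠ 0 := by exact_mod_cast hω
  simp only [Complex.real_smul]
  push_cast at hsc ⊢
  constructor
  · field_simp
    linear_combination (-z s * B.ω) * hsc
  · field_simp
    linear_combination (-v s) * hsc

/-- Outer arcs with the same initial data and both ends in the closure of the domain agree. -/
theorem Billiard.IsOuterArc.end_eq (hω : B.ω ≠ 0) {z v z' v' : ℝ → ℂ} {T T' : ℝ}
    (h : B.IsOuterArc z v T) (h' : B.IsOuterArc z' v' T') (hz : z 0 = z' 0) (hv : v 0 = v' 0)
    (hT : z T ∈ closure B.D) (hT' : z' T' ∈ closure B.D) : z T = z' T' := by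
  rcases lt_trichotomy T T' with hlt | heq | hlt
  · exfalso
    apply h'.outside T ⟨h.pos, hlt⟩
    rw [(h'.eq_solution hω ⟨h.pos.le, hlt.le⟩).1, ← hz, ← hv,
      ← (h.eq_solution hω ⟨h.pos.le, le_rfl⟩).1]
    exact hT
  · subst heq
    rw [(h'.eq_solution hω ⟨h.pos.le, le_rfl⟩).1, ← hz, ← hv,
      ← (h.eq_solution hω ⟨h.pos.le, le_rfl⟩).1]
  · exfalso
    apply h.outside T' ⟨h'.pos, hlt⟩
    rw [(h.eq_solution hω ⟨h'.pos.le, hlt.le⟩).1, hz, hv,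
      ← (h'.eq_solution hω ⟨h'.pos.le, le_rfl⟩).1]
    exact hT'

theorem OuterGood.exists_arc {ρ κ : ℝ} {p n q n' : ℂ} (hω : 0 < B.ω)
    (h : OuterGood B.D ρ B.ω κ p n q n') :
    ∃ (z v : ℝ → ℂ) (T : ℝ), B.IsOuterArc z v T ∧ z 0 = p ∧ v 0 = outV ρ B.ω p q ∧
      z T = q ∧ v T = -outV ρ B.ω q p := by
  set c := outC ρ p q with hc
  set θ := Real.arccos c with hθ
  have hcos : Real.cos θ = c := Real.cos_arccos h.neg_one_lt.le h.lt_one.le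
  have hsin : Real.sin θ = √(1 - c ^ 2) := Real.sin_arccos c
  have hθ0 : 0 < θ := Real.arccos_pos.mpr h.lt_one
  have hθπ : θ < Real.pi := Real.arccos_lt_pi.mpr h.neg_one_lt
  have hsθ : 0 < Real.sin θ := Real.sin_pos_of_pos_of_lt_pi hθ0 hθπ
  have hV : outV ρ B.ω p q = (B.ω / Real.sin θ) • (q - c • p) := by rw [outV, hsin]
  have hV' : outV ρ B.ω q p = (B.ω / Real.sin θ) • (p - c • q) := by
    rw [outV, outC_comm, hsin]
  have hωC : (B.ω : ℂ) ≠ 0 := by exact_mod_cast hω.ne'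
  have hsC : (Real.sin θ : ℂ) ≠ 0 := by exact_mod_cast hsθ.ne'
  have hscC : (Real.sin θ : ℂ) ^ 2 + (c : ℂ) ^ 2 = 1 := by
    rw [← hcos]; exact_mod_cast Real.sin_sq_add_cos_sq θ
  have hcosd : ∀ s : ℝ, HasDerivAt (fun s => Real.cos (B.ω * s))
      (-Real.sin (B.ω * s) * B.ω) s := fun s =>
    (Real.hasDerivAt_cos _).comp s (by simpa using (hasDerivAt_id s).const_mul B.ω)
  have hsind : ∀ s : ℝ, HasDerivAt (fun s => Real.sin (B.ω * s))
      (Real.cos (B.ω * s) * B.ω) s := fun s =>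
    (Real.hasDerivAt_sin _).comp s (by simpa using (hasDerivAt_id s).const_mul B.ω)
  refine ⟨fun s => Real.cos (B.ω * s) • p + (Real.sin (B.ω * s) / B.ω) • outV ρ B.ω p q,
    fun s => -(B.ω * Real.sin (B.ω * s)) • p + Real.cos (B.ω * s) • outV ρ B.ω p q, θ / B.ω,
    ⟨by positivity, ?_, ?_, ?_⟩, by simp, by simp, ?_, ?_⟩
  · intro s _
    apply HasDerivAt.hasDerivWithinAt
    refine (((hcosd s).smul_const p).add (((hsind s).div_const B.ω).smul_const
      (outV ρ B.ω p q))).congr_deriv ?_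
    simp only [Complex.real_smul]
    push_cast
    field_simp
  · intro s _
    apply HasDerivAt.hasDerivWithinAt
    refine (((((hsind s).const_mul B.ω).neg).smul_const p).add ((hcosd s).smul_const
      (outV ρ B.ω p q))).congr_deriv ?_
    simp only [Complex.real_smul]
    push_cast
    field_simp
    ring
  · intro s hs
    have hφ : B.ω * s < θ := by
      have := hs.2
      rwa [lt_div_iff₀ hω, mul_comm] at this
    have hφ0 : 0 < B.ω * s := mul_pos hω hs.1
    have e1 : Real.cos (B.ω * s) • p + (Real.sin (B.ω * s) / B.ω) • outV ρ B.ω p q =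
        (Real.sin (θ - B.ω * s) / Real.sin θ) • p + (Real.sin (B.ω * s) / Real.sin θ) • q := by
      rw [hV, Real.sin_sub, hcos]
      simp only [Complex.real_smul]
      push_cast
      push_cast at hsC
      field_simp
      ring
    rw [e1]
    -- The first half of the arc is compared with the ray through `p`, the second half, run
    -- backwards, with the ray through `q`.
    rcases le_total (B.ω * s) (θ / 2) with hle | hle
    · obtain ⟨k, e, hk, he, heq⟩ := exists_eq_add_smul_of_phase (p := p) (q := q) hφ0 hle hθπ
      rw [heq]
      exact h.outside e (by rwa [hcos] at he) k hk
    · obtain ⟨k, e, hk, he, heq⟩ := exists_eq_add_smul_of_phase (p := q) (q := p)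
        (φ := θ - B.ω * s) (θ := θ) (by linarith) (by linarith) hθπ
      rw [sub_sub_cancel] at heq
      rw [add_comm, heq]
      exact h.outside' e (by rwa [hcos, norm_sub_rev] at he) k hk
  · beta_reduce
    rw [mul_div_cancel₀ _ hω.ne', hcos, hV]
    simp only [Complex.real_smul]
    push_cast
    push_cast at hsC
    field_simp
    ring
  · beta_reduce
    rw [mul_div_cancel₀ _ hω.ne', hcos, hV, hV']
    simp only [Complex.real_smul]
    push_cast
    push_cast at hsC hscC
    field_simp
    linear_combination (-p) * hscC

/-- The energy makes the cosine of the final phase a root of the quadratic. For the root `outC` the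
outgoing direction fixes the sign of the sine; the root `outC'` is incompatible with the cone
conditions at the two ends. -/
theorem OuterGood.velocity_eq {ρ κ : ℝ} {p n q n' : ℂ} (hω : 0 < B.ω) (hρ : 0 < ρ)
    (hκ : κ ∈ Ioo (0 : ℝ) 1)
    (h : OuterGood B.D ρ B.ω κ p n q n') {z v : ℝ → ℂ} {T : ℝ} (ha : B.IsOuterArc z v T)
    (hz0 : z 0 = p) (hzT : z T = q) (hv0 : ‖v 0‖ ^ 2 = B.ω ^ 2 * (ρ - ‖p‖ ^ 2))
    (hout : κ * ‖v 0‖ < ⟪v 0, n⟫_ℝ) (hin : ⟪v T, n'⟫_ℝ < -(κ * ‖v T‖)) :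
    v 0 = outV ρ B.ω p q ∧ v T = -outV ρ B.ω q p := by
  obtain ⟨e1, e2⟩ := ha.eq_solution hω.ne' ⟨ha.pos.le, le_rfl⟩
  set C := Real.cos (B.ω * T) with hC
  set S := Real.sin (B.ω * T) with hS
  have hSC : S ^ 2 + C ^ 2 = 1 := Real.sin_sq_add_cos_sq _
  rw [hz0] at e1 e2
  rw [hzT] at e1
  have e3 : q - C • p = (S / B.ω) • v 0 := by rw [e1]; abel
  have hroot : ρ * C ^ 2 - 2 * C * ⟪p, q⟫_ℝ + ‖p‖ ^ 2 + ‖q‖ ^ 2 - ρ = 0 := by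
    have : ‖q - C • p‖ ^ 2 = ‖(S / B.ω) • v 0‖ ^ 2 := by rw [e3]
    rw [norm_smul, mul_pow, hv0, norm_sub_sq_real, norm_smul, real_inner_smul_right, mul_pow,
      Real.norm_eq_abs, sq_abs, Real.norm_eq_abs, sq_abs, div_pow, real_inner_comm] at this
    have h5 : S ^ 2 / B.ω ^ 2 * (B.ω ^ 2 * (ρ - ‖p‖ ^ 2)) = S ^ 2 * (ρ - ‖p‖ ^ 2) := by
      field_simp
    rw [h5] at this
    linear_combination this + (ρ - ‖p‖ ^ 2) * hSC
  have hv0pos : 0 < ⟪v 0, n⟫_ℝ := lt_of_le_of_lt (mul_nonneg hκ.1.le (norm_nonneg _)) hout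
  have hωC : (B.ω : ℂ) ≠ 0 := by exact_mod_cast hω.ne'
  rcases eq_outC_or_of_root hρ h.disc.le hroot with hc | hc
  · have hs : 0 < 1 - C ^ 2 := by nlinarith [h.neg_one_lt, h.lt_one]
    have hS0 : S ≠ 0 := by
      intro h0; rw [h0] at hSC; nlinarith
    have hSabs : √(1 - C ^ 2) = |S| := by
      rw [← Real.sqrt_sq_eq_abs]; congr 1; linarith
    have hv0' : v 0 = (B.ω / S) • (q - C • p) := by
      rw [e3, smul_smul]
      have : B.ω / S * (S / B.ω) = 1 := by field_simp
      rw [this, one_smul]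
    rcases lt_or_gt_of_ne hS0 with hneg | hpos
    · exfalso
      have : v 0 = -outV ρ B.ω p q := by
        rw [hv0', outV, ← hc, hSabs, abs_of_neg hneg, div_neg, neg_smul, neg_neg]
      have htr := h.transversal
      rw [this, inner_neg_left] at hv0pos
      have := mul_nonneg hκ.1.le (norm_nonneg (outV ρ B.ω p q))
      linarith
    · rw [abs_of_pos hpos] at hSabs
      refine ⟨by rw [hv0', outV, ← hc, hSabs], ?_⟩
      rw [e2, hv0', outV, outC_comm, ← hc, hSabs]
      have hSC' : (S : ℂ) ^ 2 + (C : ℂ) ^ 2 = 1 := by exact_mod_cast hSC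
      have hS0' : (S : ℂ) ≠ 0 := by exact_mod_cast hS0
      simp only [Complex.real_smul]
      push_cast
      field_simp
      linear_combination (-p) * hSC'
  -- For the root near `1`, `(1 - C) m = ‖q - p‖²`, so `1 - C` is quadratically small and the arc
  -- follows the chord. If `S = 0` the arc closes up with `v T = v 0`, against `normal_sub`.
  -- Otherwise the normal component is at most `(κ/2 + κ/4)‖q - p‖`, while the cone condition needs
  -- more than `κ(1 - κ/4)‖q - p‖`; this contradicts `κ < 1`.
  · exfalso
    set m := ρ * (1 + C) - 2 * ⟪p, q⟫_ℝ with hm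
    have hm0 : 0 < m := by rw [hm, hc]; exact h.denom_pos
    have hdle : ‖q - p‖ * ‖p‖ ≤ κ / 4 * m := by rw [hm, hc]; exact h.dist_le
    have hCpos : 0 < C := by rw [hc]; exact h.pos'
    have hprod : (1 - C) * m = ‖q - p‖ ^ 2 := by
      rw [norm_sub_sq_real, real_inner_comm, hm]
      linear_combination -hroot
    by_cases hS0 : S = 0
    · have hC1 : C = 1 := by rw [hS0] at hSC; nlinarith
      rw [hS0, hC1] at e2
      simp only [mul_zero, neg_zero, zero_smul, one_smul, zero_add] at e2
      rw [e2] at hin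
      have h6 : ⟪v 0, n - n'⟫_ℝ ≤ ‖v 0‖ * ‖n - n'‖ := real_inner_le_norm _ _
      rw [inner_sub_right] at h6
      have h7 : ‖v 0‖ * ‖n - n'‖ ≤ ‖v 0‖ * (2 * κ) := by
        have := h.normal_sub; gcongr
      nlinarith
    · have hd0 : 0 < ‖q - p‖ := by
        rcases eq_or_lt_of_le (norm_nonneg (q - p)) with h0 | h0
        · rw [← h0] at hprod
          have : (1 - C) * m = 0 := by rw [hprod]; ring
          have hC1 : 1 - C = 0 := (mul_eq_zero.mp this).resolve_right hm0.ne'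
          exfalso; apply hS0
          have : C = 1 := by linarith
          rw [this] at hSC; nlinarith
        · exact h0
      have hC1 : (1 - C) * ‖p‖ ≤ κ / 4 * ‖q - p‖ := by
        have : (1 - C) * ‖p‖ * m ≤ κ / 4 * ‖q - p‖ * m := by
          calc (1 - C) * ‖p‖ * m = ‖q - p‖ * (‖q - p‖ * ‖p‖) := by
                linear_combination ‖p‖ * hprod
            _ ≤ ‖q - p‖ * (κ / 4 * m) := by gcongr
            _ = _ := by ring
        exact le_of_mul_le_mul_right this hm0
      have hC1' : 0 ≤ 1 - C := by
        by_contra hno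
        push Not at hno
        nlinarith [mul_neg_of_neg_of_pos hno hm0, sq_nonneg ‖q - p‖]
      have h8 : (S / B.ω) • v 0 = (q - p) + (1 - C) • p := by
        rw [← e3, sub_smul, one_smul]; abel
      have h9 : |⟪(S / B.ω) • v 0, n⟫_ℝ| = |S / B.ω| * ⟪v 0, n⟫_ℝ := by
        rw [real_inner_smul_left, abs_mul, abs_of_pos hv0pos]
      have hfac : 0 < |S / B.ω| := abs_pos.mpr (div_ne_zero hS0 hω.ne')
      have h10 : κ * ‖(S / B.ω) • v 0‖ < |⟪(S / B.ω) • v 0, n⟫_ℝ| := by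
        rw [h9, norm_smul, Real.norm_eq_abs]
        nlinarith
      rw [h8, inner_add_left, real_inner_smul_left] at h10
      have h11 : ‖q - p‖ - (1 - C) * ‖p‖ ≤ ‖(q - p) + (1 - C) • p‖ := by
        have := norm_sub_le ((q - p) + (1 - C) • p) ((1 - C) • p)
        rw [add_sub_cancel_right, norm_smul, Real.norm_eq_abs, abs_of_nonneg hC1'] at this
        linarith
      have h12 : |⟪q - p, n⟫_ℝ + (1 - C) * ⟪p, n⟫_ℝ| ≤ κ / 2 * ‖q - p‖ + (1 - C) * ‖p‖ := by
        refine (abs_add_le _ _).trans (add_le_add h.chord_le ?_)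
        rw [abs_mul, abs_of_nonneg hC1']
        have := abs_real_inner_le_norm p n
        rw [h.norm_eq, mul_one] at this
        gcongr
      have h13 : κ * (‖q - p‖ - κ / 4 * ‖q - p‖) ≤ κ * ‖(q - p) + (1 - C) • p‖ :=
        mul_le_mul_of_nonneg_left (by linarith) hκ.1.le
      have h14 : 0 < κ * ‖q - p‖ * (1 - κ) :=
        mul_pos (mul_pos hκ.1 hd0) (by linarith [hκ.2])
      nlinarith

end RefractionBilliard

/-! ### Smooth dependence of the outer arcs on their ends, and their behaviour near a central
configuration. -/

namespace RefractionBilliard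
open scoped InnerProductSpace

theorem contDiffAt_outDisc {ρ : ℝ} (w : ℂ × ℂ) :
    ContDiffAt ℝ 1 (fun z : ℂ × ℂ => outDisc ρ z.1 z.2) w := by
  unfold outDisc
  exact ((contDiffAt_fst.inner ℝ contDiffAt_snd).pow 2).sub (contDiffAt_const.mul
    (((contDiffAt_fst.norm_sq ℝ).add (contDiffAt_snd.norm_sq ℝ)).sub contDiffAt_const))

theorem contDiffAt_outC {ρ : ℝ} {w : ℂ × ℂ} (h : 0 < outDisc ρ w.1 w.2) :
    ContDiffAt ℝ 1 (fun z : ℂ × ℂ => outC ρ z.1 z.2) w := by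
  unfold outC
  exact ((contDiffAt_fst.inner ℝ contDiffAt_snd).sub
    ((contDiffAt_outDisc w).sqrt h.ne')).div_const _

theorem contDiffAt_outC' {ρ : ℝ} {w : ℂ × ℂ} (h : 0 < outDisc ρ w.1 w.2) :
    ContDiffAt ℝ 1 (fun z : ℂ × ℂ => outC' ρ z.1 z.2) w := by
  unfold outC'
  exact ((contDiffAt_fst.inner ℝ contDiffAt_snd).add
    ((contDiffAt_outDisc w).sqrt h.ne')).div_const _

theorem contDiffAt_outV {ρ ω : ℝ} {w : ℂ × ℂ} (h : 0 < outDisc ρ w.1 w.2)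
    (h1 : -1 < outC ρ w.1 w.2) (h2 : outC ρ w.1 w.2 < 1) :
    ContDiffAt ℝ 1 (fun z : ℂ × ℂ => outV ρ ω z.1 z.2) w := by
  unfold outV
  have hpos : 0 < 1 - outC ρ w.1 w.2 ^ 2 := by nlinarith
  have hC := contDiffAt_outC h
  exact (contDiffAt_const.div ((contDiffAt_const.sub (hC.pow 2)).sqrt hpos.ne')
    (Real.sqrt_pos.mpr hpos).ne').smul (contDiffAt_snd.sub (hC.smul contDiffAt_fst))

theorem outDisc_self (ρ : ℝ) (p : ℂ) : outDisc ρ p p = (ρ - ‖p‖ ^ 2) ^ 2 := by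
  rw [outDisc, real_inner_self_eq_norm_sq]; ring

theorem outC_self {ρ : ℝ} {p : ℂ} (hρ : 0 < ρ) (h : ‖p‖ ^ 2 < ρ) :
    outC ρ p p = 2 * ‖p‖ ^ 2 / ρ - 1 := by
  rw [outC, outDisc_self, Real.sqrt_sq (by linarith), real_inner_self_eq_norm_sq]
  field_simp; ring

theorem outC'_self {ρ : ℝ} {p : ℂ} (hρ : 0 < ρ) (h : ‖p‖ ^ 2 < ρ) : outC' ρ p p = 1 := by
  rw [outC', outDisc_self, Real.sqrt_sq (by linarith), real_inner_self_eq_norm_sq]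
  field_simp; ring

theorem outC_self_mem {ρ : ℝ} {p : ℂ} (hp : p ≠ 0) (h : ‖p‖ ^ 2 < ρ) :
    outC ρ p p ∈ Ioo (-1 : ℝ) 1 := by
  have hP : 0 < ‖p‖ ^ 2 := by positivity
  have hρ : 0 < ρ := hP.trans h
  rw [outC_self hρ h]
  have h1 : 0 < 2 * ‖p‖ ^ 2 / ρ := by positivity
  have h2 : 2 * ‖p‖ ^ 2 / ρ < 2 := by rw [div_lt_iff₀ hρ]; linarith
  constructor <;> linarith

section Domain

variable {D : Set ℂ} {γ : ℝ → ℂ} {L : ℝ}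

/-- Close to a point, a chord is nearly tangent. -/
theorem IsDomainWithBoundary.eventually_chord (hD : IsDomainWithBoundary D γ L) (ξ : ℝ) {η : ℝ}
    (hη : 0 < η) : ∀ᶠ w : ℝ × ℝ in 𝓝 (ξ, ξ),
      ‖γ w.2 - γ w.1 - (w.2 - w.1) • deriv γ ξ‖ ≤ η * |w.2 - w.1| := by
  have h1 := (hasStrictDerivAt_iff_hasStrictFDerivAt.mp (hD.hasStrictDerivAt ξ)).isLittleO.def hη
  have h2 : Tendsto (fun w : ℝ × ℝ => (w.2, w.1)) (𝓝 (ξ, ξ)) (𝓝 (ξ, ξ)) :=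
    (continuous_swap (X := ℝ) (Y := ℝ)).tendsto' _ _ rfl
  simpa using h2.eventually h1

theorem IsDomainWithBoundary.norm_normal (hD : IsDomainWithBoundary D γ L) (ξ : ℝ) :
    ‖-Complex.I * deriv γ ξ‖ = 1 := by simp [hD.unit_speed ξ]

theorem inner_normal_tangent (t : ℂ) : ⟪-Complex.I * t, t⟫_ℝ = 0 := by
  rw [Complex.inner]; simp; ring

theorem IsDomainWithBoundary.eventually_chord_le (hD : IsDomainWithBoundary D γ L) (ξ : ℝ)
    {κ : ℝ} (hκ : κ ∈ Ioo (0 : ℝ) 1) : ∀ᶠ w : ℝ × ℝ in 𝓝 (ξ, ξ),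
      |⟪γ w.2 - γ w.1, -Complex.I * deriv γ w.1⟫_ℝ| ≤ κ / 2 * ‖γ w.2 - γ w.1‖ := by
  have h1 := hD.eventually_chord ξ (show 0 < κ / 8 by linarith [hκ.1])
  have h2 : ∀ᶠ w : ℝ × ℝ in 𝓝 (ξ, ξ),
      |⟪deriv γ ξ, -Complex.I * deriv γ w.1⟫_ℝ| < κ / 8 := by
    have hc := hD.continuous_deriv
    have : Continuous fun w : ℝ × ℝ => |⟪deriv γ ξ, -Complex.I * deriv γ w.1⟫_ℝ| := by fun_prop
    apply this.continuousAt.eventually_lt continuousAt_const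
    rw [real_inner_comm, inner_normal_tangent]
    simp only [abs_zero]
    linarith [hκ.1]
  filter_upwards [h1, h2] with w hw1 hw2
  set g := γ w.2 - γ w.1
  set d := w.2 - w.1
  set n := -Complex.I * deriv γ w.1
  set t := deriv γ ξ
  have e1 : |⟪g, n⟫_ℝ| ≤ κ / 8 * |d| + |d| * (κ / 8) := by
    have : g = (g - d • t) + d • t := by abel
    rw [this, inner_add_left, real_inner_smul_left]
    refine (abs_add_le _ _).trans (add_le_add ?_ ?_)
    · refine (abs_real_inner_le_norm _ _).trans ?_
      rw [hD.norm_normal, mul_one]; exact hw1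
    · rw [abs_mul]; gcongr
  have e2 : |d| ≤ ‖g‖ + κ / 8 * |d| := by
    have := norm_sub_le g (g - d • t)
    rw [sub_sub_cancel, norm_smul, hD.unit_speed, mul_one, Real.norm_eq_abs] at this
    linarith
  have e3 : κ / 2 * |d| ≤ κ / 2 * (‖g‖ + κ / 8 * |d|) :=
    mul_le_mul_of_nonneg_left e2 (by linarith [hκ.1])
  have e4 : 0 ≤ (κ * (1 - κ)) * |d| :=
    mul_nonneg (mul_nonneg hκ.1.le (by linarith [hκ.2])) (abs_nonneg d)
  have e5 : 0 ≤ κ * |d| := mul_nonneg hκ.1.le (abs_nonneg d)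
  nlinarith

-- All conditions except the chord bound are open and hold strictly when both points are `γ ξ`:
-- there `outC' = 1`, `outC` lies strictly between `-1` and `1`, and the error vectors vanish. The
-- chord bound comes from strict differentiability.
set_option maxHeartbeats 1000000 in
theorem IsCentralConfiguration.eventually_outerGood (hD : IsDomainWithBoundary D γ L) {ξ : ℝ}
    (h : IsCentralConfiguration γ ξ) {ρ ω κ : ℝ} (hρ : ‖γ ξ‖ ^ 2 < ρ) (hω : 0 < ω)
    (hκ : κ ∈ Ioo (0 : ℝ) 1) :
    ∀ᶠ w : ℝ × ℝ in 𝓝 (ξ, ξ), OuterGood D ρ ω κ (γ w.1) (-Complex.I * deriv γ w.1)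
      (γ w.2) (-Complex.I * deriv γ w.2) := by
  have hp := hD.ne_zero ξ
  have hP : 0 < ‖γ ξ‖ := norm_pos_iff.mpr hp
  have hρ0 : 0 < ρ := lt_trans (by positivity) hρ
  have hcγ : Continuous γ := hD.contDiff.continuous
  have hct := hD.continuous_deriv
  have hmem := outC_self_mem hp hρ
  have hdisc0 : 0 < outDisc ρ (γ ξ) (γ ξ) := by
    rw [outDisc_self]; have : 0 < ρ - ‖γ ξ‖ ^ 2 := by linarith
    positivity
  have hg : Continuous (fun w : ℝ × ℝ => (γ w.1, γ w.2)) := by fun_prop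
  have hg' : Continuous (fun w : ℝ × ℝ => (γ w.2, γ w.1)) := by fun_prop
  have cC : ContinuousAt (fun w : ℝ × ℝ => outC ρ (γ w.1) (γ w.2)) (ξ, ξ) :=
    ContinuousAt.comp (g := fun z : ℂ × ℂ => outC ρ z.1 z.2) (f := fun w : ℝ × ℝ => (γ w.1, γ w.2))
      (x := (ξ, ξ)) (contDiffAt_outC hdisc0).continuousAt hg.continuousAt
  have cC' : ContinuousAt (fun w : ℝ × ℝ => outC' ρ (γ w.1) (γ w.2)) (ξ, ξ) :=
    ContinuousAt.comp (g := fun z : ℂ × ℂ => outC' ρ z.1 z.2)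
      (f := fun w : ℝ × ℝ => (γ w.1, γ w.2))
      (x := (ξ, ξ)) (contDiffAt_outC' hdisc0).continuousAt hg.continuousAt
  have cD : ContinuousAt (fun w : ℝ × ℝ => outDisc ρ (γ w.1) (γ w.2)) (ξ, ξ) :=
    ContinuousAt.comp (g := fun z : ℂ × ℂ => outDisc ρ z.1 z.2)
      (f := fun w : ℝ × ℝ => (γ w.1, γ w.2))
      (x := (ξ, ξ)) (contDiffAt_outDisc _).continuousAt hg.continuousAt
  have cV : ContinuousAt (fun w : ℝ × ℝ => outV ρ ω (γ w.1) (γ w.2)) (ξ, ξ) :=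
    ContinuousAt.comp (g := fun z : ℂ × ℂ => outV ρ ω z.1 z.2)
      (f := fun w : ℝ × ℝ => (γ w.1, γ w.2))
      (x := (ξ, ξ)) (contDiffAt_outV hdisc0 hmem.1 hmem.2).continuousAt hg.continuousAt
  have cV' : ContinuousAt (fun w : ℝ × ℝ => outV ρ ω (γ w.2) (γ w.1)) (ξ, ξ) :=
    ContinuousAt.comp (g := fun z : ℂ × ℂ => outV ρ ω z.1 z.2)
      (f := fun w : ℝ × ℝ => (γ w.2, γ w.1))
      (x := (ξ, ξ)) (contDiffAt_outV hdisc0 hmem.1 hmem.2).continuousAt hg'.continuousAt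
  have hden : 0 < ρ * (1 + 1) - 2 * ‖γ ξ‖ ^ 2 := by linarith
  -- For coincident ends `outV` is a positive multiple of the normal, which is radial here, so the
  -- cosine of the angle is `1 > κ`.
  have htr : κ * ‖outV ρ ω (γ ξ) (γ ξ)‖ < ⟪outV ρ ω (γ ξ) (γ ξ), -Complex.I * deriv γ ξ⟫_ℝ := by
    have hs : 0 < 1 - outC ρ (γ ξ) (γ ξ) ^ 2 := by nlinarith [hmem.1, hmem.2]
    set n := -Complex.I * deriv γ ξ
    have hn : ‖n‖ = 1 := hD.norm_normal ξ
    obtain ⟨l, hl, hl2⟩ : ∃ l : ℝ, 0 < l ∧ outV ρ ω (γ ξ) (γ ξ) = l • n := by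
      refine ⟨ω / √(1 - outC ρ (γ ξ) (γ ξ) ^ 2) * (1 - outC ρ (γ ξ) (γ ξ)) * ‖γ ξ‖, ?_, ?_⟩
      · have := Real.sqrt_pos.mpr hs
        have : 0 < 1 - outC ρ (γ ξ) (γ ξ) := by linarith [hmem.2]
        positivity
      · rw [outV]
        have := h.normal_eq hD
        have e1 : γ ξ - outC ρ (γ ξ) (γ ξ) • γ ξ = ((1 - outC ρ (γ ξ) (γ ξ)) * ‖γ ξ‖) • n := by
          rw [mul_smul, sub_smul, one_smul]
          have e2 : ‖γ ξ‖ • n = γ ξ := by rw [Complex.real_smul]; exact this.symm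
          rw [e2]
        rw [e1, smul_smul, mul_assoc]
    rw [hl2, norm_smul, real_inner_smul_left, real_inner_self_eq_norm_sq, hn,
      Real.norm_eq_abs, abs_of_pos hl]
    nlinarith [hκ.2]
  have hout := Metric.eventually_nhds_iff.mp (h.eventually_outside hD)
  obtain ⟨δ, hδ, hout⟩ := hout
  have x1 : ∀ᶠ w : ℝ × ℝ in 𝓝 (ξ, ξ), dist w.1 ξ < δ := by
    have : Continuous fun w : ℝ × ℝ => dist w.1 ξ := by fun_prop
    exact this.continuousAt.eventually_lt continuousAt_const (by simpa using hδ)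
  have x2 : ∀ᶠ w : ℝ × ℝ in 𝓝 (ξ, ξ), dist w.2 ξ < δ := by
    have : Continuous fun w : ℝ × ℝ => dist w.2 ξ := by fun_prop
    exact this.continuousAt.eventually_lt continuousAt_const (by simpa using hδ)
  have x3 : ∀ᶠ w : ℝ × ℝ in 𝓝 (ξ, ξ),
      2 * ‖γ w.2 - γ w.1‖ / (1 - outC ρ (γ w.1) (γ w.2)) < δ := by
    have : ContinuousAt (fun w : ℝ × ℝ => 2 * ‖γ w.2 - γ w.1‖ /
        (1 - outC ρ (γ w.1) (γ w.2))) (ξ, ξ) := by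
      apply ContinuousAt.div
      · exact Continuous.continuousAt (by fun_prop)
      · exact continuousAt_const.sub cC
      · have := hmem.2
        simp only
        linarith
    exact this.eventually_lt continuousAt_const (by simpa using hδ)
  have y1 := continuousAt_const.eventually_lt cD hdisc0
  have y2 := continuousAt_const.eventually_lt cC hmem.1
  have y3 := cC.eventually_lt continuousAt_const hmem.2
  have y4 : ∀ᶠ w : ℝ × ℝ in 𝓝 (ξ, ξ), 0 < outC' ρ (γ w.1) (γ w.2) :=
    continuousAt_const.eventually_lt cC' (by simp only [outC'_self hρ0 hρ]; norm_num)
  have cDen : ContinuousAt (fun w : ℝ × ℝ =>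
      ρ * (1 + outC' ρ (γ w.1) (γ w.2)) - 2 * ⟪γ w.1, γ w.2⟫_ℝ) (ξ, ξ) :=
    (continuousAt_const.mul (continuousAt_const.add cC')).sub
      (Continuous.continuousAt (by fun_prop))
  have y5 : ∀ᶠ w : ℝ × ℝ in 𝓝 (ξ, ξ),
      0 < ρ * (1 + outC' ρ (γ w.1) (γ w.2)) - 2 * ⟪γ w.1, γ w.2⟫_ℝ :=
    continuousAt_const.eventually_lt cDen (by
    simp only [outC'_self hρ0 hρ, real_inner_self_eq_norm_sq]; exact hden)
  have y6 : ∀ᶠ w : ℝ × ℝ in 𝓝 (ξ, ξ), ‖γ w.2 - γ w.1‖ * ‖γ w.1‖ <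
      κ / 4 * (ρ * (1 + outC' ρ (γ w.1) (γ w.2)) - 2 * ⟪γ w.1, γ w.2⟫_ℝ) := by
    apply ContinuousAt.eventually_lt (Continuous.continuousAt (by fun_prop))
      (continuousAt_const.mul cDen)
    change ‖γ ξ - γ ξ‖ * ‖γ ξ‖ < κ / 4 * (ρ * (1 + outC' ρ (γ ξ) (γ ξ)) - 2 * ⟪γ ξ, γ ξ⟫_ℝ)
    rw [sub_self, norm_zero, zero_mul, outC'_self hρ0 hρ, real_inner_self_eq_norm_sq]
    have := hκ.1
    positivity
  have y7 := hD.eventually_chord_le ξ hκ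
  have y8 : ∀ᶠ w : ℝ × ℝ in 𝓝 (ξ, ξ),
      ‖-Complex.I * deriv γ w.1 - -Complex.I * deriv γ w.2‖ < 2 * κ := by
    apply ContinuousAt.eventually_lt (Continuous.continuousAt (by fun_prop)) continuousAt_const
    simp only [sub_self, norm_zero]; linarith [hκ.1]
  have y9 : ∀ᶠ w : ℝ × ℝ in 𝓝 (ξ, ξ), κ * ‖outV ρ ω (γ w.1) (γ w.2)‖ <
      ⟪outV ρ ω (γ w.1) (γ w.2), -Complex.I * deriv γ w.1⟫_ℝ :=
    (continuousAt_const.mul cV.norm).eventually_lt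
      (cV.inner (Continuous.continuousAt (by fun_prop))) htr
  have y10 : ∀ᶠ w : ℝ × ℝ in 𝓝 (ξ, ξ), κ * ‖outV ρ ω (γ w.2) (γ w.1)‖ <
      ⟪outV ρ ω (γ w.2) (γ w.1), -Complex.I * deriv γ w.2⟫_ℝ :=
    (continuousAt_const.mul cV'.norm).eventually_lt
      (cV'.inner (Continuous.continuousAt (by fun_prop))) htr
  filter_upwards [x1, x2, x3, y1, y2, y3, y4, y5, y6, y7, y8, y9, y10] with
    w x1 x2 x3 y1 y2 y3 y4 y5 y6 y7 y8 y9 y10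
  exact ⟨hD.norm_normal _, y1, y2, y3, y4, y5, y6.le, y7, y8.le, y9, y10,
    fun e he => hout (y := (w.1, e)) (by
      rw [Prod.dist_eq]; simp only [dist_zero_right]; exact max_lt x1 (he.trans_lt x3)),
    fun e he => hout (y := (w.2, e)) (by
      rw [Prod.dist_eq]; simp only [dist_zero_right]; exact max_lt x2 (he.trans_lt x3))⟩

end Domain

end RefractionBilliard

/-! ### Levi-Civita regularization: from hyperbolic curves to Kepler arcs. -/

namespace RefractionBilliard
open scoped InnerProductSpace ComplexConjugate

/-- The solution of `w'' = λ² w` with `w 0 = w₀` and `w' 0 = λ d`. -/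
noncomputable def hypCurve (l : ℝ) (w₀ d : ℂ) (τ : ℝ) : ℂ :=
  Real.cosh (l * τ) • w₀ + Real.sinh (l * τ) • d

/-- The derivative of `hypCurve`, divided by `λ`. -/
noncomputable def hypCurve' (l : ℝ) (w₀ d : ℂ) (τ : ℝ) : ℂ :=
  Real.sinh (l * τ) • w₀ + Real.cosh (l * τ) • d

section HypCurve

variable {l : ℝ} {w₀ d : ℂ}

theorem hasDerivAt_hypCurve (l : ℝ) (w₀ d : ℂ) (τ : ℝ) :
    HasDerivAt (hypCurve l w₀ d) (l • hypCurve' l w₀ d τ) τ := by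
  have h := (hasDerivAt_id τ).const_mul l
  simp only [id, mul_one] at h
  refine ((h.cosh.smul_const w₀).add (h.sinh.smul_const d)).congr_deriv ?_
  simp only [hypCurve', Complex.real_smul]; push_cast; ring

theorem hasDerivAt_hypCurve' (l : ℝ) (w₀ d : ℂ) (τ : ℝ) :
    HasDerivAt (hypCurve' l w₀ d) (l • hypCurve l w₀ d τ) τ := by
  have h := (hasDerivAt_id τ).const_mul l
  simp only [id, mul_one] at h
  refine ((h.sinh.smul_const w₀).add (h.cosh.smul_const d)).congr_deriv ?_
  simp only [hypCurve, Complex.real_smul]; push_cast; ring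

theorem continuous_hypCurve (l : ℝ) (w₀ d : ℂ) : Continuous (hypCurve l w₀ d) :=
  continuous_iff_continuousAt.mpr fun τ => (hasDerivAt_hypCurve l w₀ d τ).continuousAt

theorem norm_hypCurve'_sq (τ : ℝ) :
    ‖hypCurve' l w₀ d τ‖ ^ 2 = ‖hypCurve l w₀ d τ‖ ^ 2 + (‖d‖ ^ 2 - ‖w₀‖ ^ 2) := by
  rw [hypCurve, hypCurve', norm_add_sq_real, norm_add_sq_real]
  simp only [norm_smul, real_inner_smul_left, real_inner_smul_right, mul_pow, Real.norm_eq_abs,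
    sq_abs]
  linear_combination (‖d‖ ^ 2 - ‖w₀‖ ^ 2) * Real.cosh_sq (l * τ)

theorem hypCurve_add (a b : ℝ) : hypCurve l w₀ d (a + b) =
    Real.cosh (l * b) • hypCurve l w₀ d a + Real.sinh (l * b) • hypCurve' l w₀ d a := by
  simp only [hypCurve, hypCurve', mul_add, Real.cosh_add, Real.sinh_add, Complex.real_smul]
  push_cast; ring

/-- By the addition formula a second zero would force `hypCurve'` to vanish at the first, but there
its squared norm is `‖d‖² - ‖w₀‖² > 0`. -/
theorem hypCurve_eq_zero_unique (hl : 0 < l) (hd : ‖w₀‖ < ‖d‖) {a b : ℝ}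
    (ha : hypCurve l w₀ d a = 0) (hb : hypCurve l w₀ d b = 0) : a = b := by
  by_contra hne
  have h1 := hypCurve_add (l := l) (w₀ := w₀) (d := d) a (b - a)
  rw [add_sub_cancel, ha, hb, smul_zero, zero_add] at h1
  have h2 : Real.sinh (l * (b - a)) ≠ 0 := by
    rw [Ne, Real.sinh_eq_zero]
    exact mul_ne_zero hl.ne' (sub_ne_zero.mpr (Ne.symm hne))
  have h3 := (smul_eq_zero.mp h1.symm).resolve_left h2
  have h4 := norm_hypCurve'_sq (l := l) (w₀ := w₀) (d := d) a
  rw [h3, ha, norm_zero] at h4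
  nlinarith [norm_nonneg w₀]

theorem hypCurve_reflect {c : ℝ} (hc : hypCurve l w₀ d c = 0) (x : ℝ) :
    hypCurve l w₀ d (c + x) = -hypCurve l w₀ d (c - x) := by
  rw [sub_eq_add_neg, hypCurve_add, hypCurve_add, hc, mul_neg, Real.sinh_neg]
  simp

/-- Physical time along a regularized Kepler arc. -/
noncomputable def hypTime (l : ℝ) (w₀ d : ℂ) (τ : ℝ) : ℝ :=
  ∫ x in (0 : ℝ)..τ, ‖hypCurve l w₀ d x‖ ^ 2

theorem hasDerivAt_hypTime (l : ℝ) (w₀ d : ℂ) (τ : ℝ) :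
    HasDerivAt (hypTime l w₀ d) (‖hypCurve l w₀ d τ‖ ^ 2) τ :=
  (((continuous_hypCurve l w₀ d).norm.pow 2).integral_hasStrictDerivAt 0 τ).hasDerivAt

/-- The derivative `‖w‖²` vanishes at most once, so the physical time is constant on no interval
even when the curve passes through the collision. -/
theorem hypTime_strictMono (hl : 0 < l) (hd : ‖w₀‖ < ‖d‖) : StrictMono (hypTime l w₀ d) := by
  have hmono : Monotone (hypTime l w₀ d) :=
    monotone_of_deriv_nonneg (fun τ => (hasDerivAt_hypTime l w₀ d τ).differentiableAt)
      (fun τ => by rw [(hasDerivAt_hypTime l w₀ d τ).deriv]; positivity)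
  intro a b hab
  refine lt_of_le_of_ne (hmono hab.le) fun heq => ?_
  have hzero : ∀ x ∈ Ioo a b, hypCurve l w₀ d x = 0 := by
    intro x hx
    have hconst : hypTime l w₀ d =ᶠ[𝓝 x] fun _ => hypTime l w₀ d a := by
      filter_upwards [isOpen_Ioo.mem_nhds hx] with y hy
      exact le_antisymm ((hmono hy.2.le).trans heq.ge) (hmono hy.1.le)
    have h1 := (hasDerivAt_hypTime l w₀ d x).congr_of_eventuallyEq hconst.symm
    have h2 := h1.unique (hasDerivAt_const x _)
    simpa using h2
  obtain ⟨x, hx⟩ := exists_between hab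
  obtain ⟨y, hy⟩ := exists_between hx.2
  have := hypCurve_eq_zero_unique hl hd (hzero x hx) (hzero y ⟨hx.1.trans hy.1, hy.2⟩)
  exact hy.1.ne this

theorem hypTime_reflect {c : ℝ} (hc : hypCurve l w₀ d c = 0) (x : ℝ) :
    hypTime l w₀ d (c + x) + hypTime l w₀ d (c - x) = 2 * hypTime l w₀ d c := by
  have hder : ∀ x : ℝ, HasDerivAt
      (fun x => hypTime l w₀ d (c + x) + hypTime l w₀ d (c - x)) 0 x := by
    intro x
    refine (((hasDerivAt_hypTime l w₀ d (c + x)).comp x ((hasDerivAt_id x).const_add c)).add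
      ((hasDerivAt_hypTime l w₀ d (c - x)).comp x ((hasDerivAt_id x).const_sub c))).congr_deriv ?_
    rw [hypCurve_reflect hc, norm_neg]; ring
  have := is_const_of_deriv_eq_zero (fun x => (hder x).differentiableAt)
    (fun x => (hder x).deriv) x 0
  simp only [add_zero, sub_zero] at this
  linarith

end HypCurve

/-- Inverse of a continuous strictly monotone function on a compact interval. -/
theorem exists_continuousOn_inverse {f : ℝ → ℝ} (hf : Continuous f) (hmono : StrictMono f)
    {a b : ℝ} (hab : a ≤ b) : ∃ g : ℝ → ℝ, ContinuousOn g (Icc (f a) (f b)) ∧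
      (∀ s ∈ Icc (f a) (f b), g s ∈ Icc a b ∧ f (g s) = s) ∧ ∀ τ ∈ Icc a b, g (f τ) = τ := by
  have hsurj : ∀ s ∈ Icc (f a) (f b), ∃ τ ∈ Icc a b, f τ = s := fun s hs =>
    intermediate_value_Icc hab hf.continuousOn hs
  choose! g hg using hsurj
  refine ⟨g, ?_, fun s hs => hg s hs, fun τ hτ =>
    hmono.injective (hg (f τ) ⟨hmono.monotone hτ.1, hmono.monotone hτ.2⟩).2⟩
  have hemb : IsClosedEmbedding (fun τ : Icc a b => f τ) :=
    (hf.comp continuous_subtype_val).isClosedEmbedding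
      (hmono.injective.comp Subtype.val_injective)
  rw [continuousOn_iff_continuous_domRestrict]
  have h1 : Continuous (fun s : Icc (f a) (f b) => (⟨g s, (hg s s.2).1⟩ : Icc a b)) := by
    rw [hemb.isInducing.continuous_iff]
    have : (fun τ : Icc a b => f τ) ∘ (fun s : Icc (f a) (f b) =>
        (⟨g s, (hg s s.2).1⟩ : Icc a b)) = Subtype.val := by
      funext s; exact (hg s s.2).2
    rw [this]; exact continuous_subtype_val
  exact continuous_subtype_val.comp h1

variable {B : Billiard}

/-- The Levi-Civita transformation maps hyperbolic curves to regularized Kepler arcs. -/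
theorem exists_isInnerArc {l : ℝ} {w₀ d : ℂ} {Θ : ℝ} (hl : 0 < l) (hμ : 0 < B.μ)
    (hd : ‖d‖ ^ 2 = ‖w₀‖ ^ 2 + B.μ / (2 * l ^ 2)) (hΘ : 0 < Θ)
    (hD : ∀ τ ∈ Ioo 0 Θ, hypCurve l w₀ d τ ^ 2 ∈ B.D) :
    ∃ (z v : ℝ → ℂ) (T : ℝ), B.IsInnerArc z v T ∧ z 0 = w₀ ^ 2 ∧ v 0 = 2 * l * d / conj w₀ ∧
      z T = hypCurve l w₀ d Θ ^ 2 ∧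
      v T = 2 * l * hypCurve' l w₀ d Θ / conj (hypCurve l w₀ d Θ) := by
  have hd' : ‖w₀‖ < ‖d‖ := by
    have : 0 < B.μ / (2 * l ^ 2) := by positivity
    exact lt_of_pow_lt_pow_left₀ 2 (norm_nonneg _) (by linarith)
  set w := hypCurve l w₀ d with hw
  set w' := hypCurve' l w₀ d with hw'
  set t := hypTime l w₀ d with ht
  have hmono : StrictMono t := hypTime_strictMono hl hd'
  have hcont : Continuous t :=
    continuous_iff_continuousAt.mpr fun τ => (hasDerivAt_hypTime l w₀ d τ).continuousAt
  have ht0 : t 0 = 0 := by simp [ht, hypTime]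
  obtain ⟨g, hgc, hg, hgt⟩ := exists_continuousOn_inverse hcont hmono hΘ.le
  rw [ht0] at hgc hg
  set T := t Θ with hT
  have hg0 : g 0 = 0 := by
    have := hgt 0 ⟨le_rfl, hΘ.le⟩
    rwa [ht0] at this
  have hgT : g T = Θ := hgt Θ ⟨hΘ.le, le_rfl⟩
  have hT0 : 0 < T := by rw [← ht0]; exact hmono hΘ
  have hw0 : w 0 = w₀ := by simp [hw, hypCurve]
  have hw'0 : w' 0 = d := by simp [hw', hypCurve']
  have hwc : Continuous w := continuous_hypCurve l w₀ d
  -- Physical time is inverted as a function of regularized time; the inverse `g` is continuous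
  -- throughout but differentiable only away from the collision.
  have hgd : ∀ s ∈ Icc 0 T, w (g s) ≠ 0 →
      HasDerivWithinAt g (‖w (g s)‖ ^ 2)⁻¹ (Icc 0 T) s := by
    intro s hs hne
    have h1 := hasDerivAt_hypTime l w₀ d (g s)
    have hn : ‖hypCurve l w₀ d (g s)‖ ^ 2 ≠ 0 := by
      have := norm_ne_zero_iff.mpr hne; positivity
    have h2 := (h1.hasFDerivAt_equiv hn).hasFDerivWithinAt (s := univ)
    have h3 := HasFDerivWithinAt.of_local_left_inverse (g := g) (a := s) (s := Icc 0 T)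
      (by rw [nhdsWithin_univ]; exact hgc s hs) h2 hs
      (by filter_upwards [self_mem_nhdsWithin] with x hx using (hg x hx).2)
    refine h3.hasDerivWithinAt.congr_deriv ?_
    simp [ContinuousLinearEquiv.unitsEquivAut, hw]
  have hz : ∀ s ∈ Icc 0 T, w (g s) ≠ 0 →
      HasDerivWithinAt (fun s => w (g s)) ((‖w (g s)‖ ^ 2)⁻¹ • (l • w' (g s))) (Icc 0 T) s :=
    fun s hs hne => (hasDerivAt_hypCurve l w₀ d (g s)).scomp_hasDerivWithinAt s (hgd s hs hne)
  have hz' : ∀ s ∈ Icc 0 T, w (g s) ≠ 0 →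
      HasDerivWithinAt (fun s => w' (g s)) ((‖w (g s)‖ ^ 2)⁻¹ • (l • w (g s))) (Icc 0 T) s :=
    fun s hs hne => (hasDerivAt_hypCurve' l w₀ d (g s)).scomp_hasDerivWithinAt s (hgd s hs hne)
  have hconj : ∀ x : ℂ, ((‖x‖ : ℝ) : ℂ) ^ 2 = x * conj x := by
    intro x; rw [Complex.mul_conj, Complex.normSq_eq_norm_sq]; push_cast; rfl
  refine ⟨fun s => w (g s) ^ 2, fun s => 2 * l * w' (g s) / conj (w (g s)), T,
    ⟨hT0, ?_, ?_, ?_, ?_, ?_⟩, by simp only [hg0, hw0], by simp only [hg0, hw0, hw'0],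
    by simp only [hgT], by simp only [hgT]⟩
  · exact (hwc.comp_continuousOn hgc).pow 2
  · intro s hs hne
    have hne' : w (g s) ≠ 0 := fun h => hne (by simp [h])
    refine ((hz s hs hne').pow 2).congr_deriv ?_
    have hcne : conj (w (g s)) ≠ 0 := by simpa using hne'
    simp only [Complex.real_smul, Complex.ofReal_inv, Complex.ofReal_pow, hconj]
    field_simp
    simp only [pow_one, Nat.add_one_sub_one, Nat.cast_ofNat]
    ring
  · intro s hs hne
    have hne' : w (g s) ≠ 0 := fun h => hne (by simp [h])
    have hcne : conj (w (g s)) ≠ 0 := by simpa using hne'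
    have hcd : HasDerivWithinAt (fun s => conj (w (g s)))
        (conj ((‖w (g s)‖ ^ 2)⁻¹ • (l • w' (g s)))) (Icc 0 T) s :=
      Complex.conjCLE.toContinuousLinearMap.hasFDerivAt.comp_hasDerivWithinAt s (hz s hs hne')
    refine (((hz' s hs hne').const_mul (2 * l : ℂ)).div hcd hcne).congr_deriv ?_
    have hen := norm_hypCurve'_sq (l := l) (w₀ := w₀) (d := d) (g s)
    rw [hd, add_sub_cancel_left] at hen
    -- The regularized energy identity, with `ν = μ/(2l²)`; it turns the derivative of the velocity
    -- into the Kepler force.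
    have hen' : w' (g s) * conj (w' (g s)) =
        w (g s) * conj (w (g s)) + B.μ / (2 * l ^ 2) := by
      rw [← hconj, ← hconj]
      exact_mod_cast hen
    have hlC : (l : ℂ) ≠ 0 := by exact_mod_cast hl.ne'
    have hn3 : ((‖w (g s) ^ 2‖ : ℝ) : ℂ) ^ 3 = (w (g s) * conj (w (g s))) ^ 3 := by
      rw [norm_pow, ← hconj]; push_cast; ring
    simp only [Complex.real_smul, Complex.ofReal_inv, Complex.ofReal_pow, hconj, map_mul,
      Complex.conj_ofReal, Complex.ofReal_neg, Complex.ofReal_div, map_inv₀, Complex.conj_conj,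
      hn3]
    field_simp
    field_simp at hen'
    linear_combination (-1 : ℂ) * hen'
  · intro c hc hzc τ hm hp
    have hwc0 : w (g c) = 0 := by simpa using hzc
    -- About a collision `w` and the centered physical time are both odd, so times `c ± τ`
    -- correspond to opposite values of `w`, which have the same square.
    set x := g (c + τ) - g c with hx
    have h1 := hypTime_reflect hwc0 x
    have h2 : g c + x = g (c + τ) := by rw [hx]; ring
    rw [h2] at h1
    have h3 : t (g (c + τ)) = c + τ := (hg _ hp).2
    have h4 : t (g c) = c := (hg _ hc).2
    rw [← ht, h3, h4] at h1
    have h5 : t (g c - x) = t (g (c - τ)) := by rw [(hg _ hm).2]; linarith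
    have h6 := hmono.injective h5
    have h7 := hypCurve_reflect hwc0 x
    rw [h2, h6] at h7
    change w (g (c + τ)) ^ 2 = w (g (c - τ)) ^ 2
    rw [hw, h7]; ring
  · intro s hs
    have hs' : s ∈ Icc 0 T := ⟨hs.1.le, hs.2.le⟩
    have h1 := hg s hs'
    apply hD
    constructor
    · rcases eq_or_lt_of_le h1.1.1 with h | h
      · exfalso; rw [← h, ht0] at h1; exact hs.1.ne h1.2
      · exact h
    · rcases eq_or_lt_of_le h1.1.2 with h | h
      · exfalso; rw [h] at h1; exact hs.2.ne' h1.2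
      · exact h

end RefractionBilliard

/-! ### From Kepler arcs back to hyperbolic curves, and arcs with collision. -/

namespace RefractionBilliard
open scoped InnerProductSpace ComplexConjugate

/-- A continuous function on a compact interval has a primitive. -/
theorem exists_primitive {F : Type*} [NormedAddCommGroup F] [NormedSpace ℝ F] [CompleteSpace F]
    {f : ℝ → F} {T : ℝ} (hT : 0 ≤ T) (hf : ContinuousOn f (Icc 0 T)) :
    ∃ G : ℝ → F, G 0 = 0 ∧ ∀ s ∈ Icc 0 T, HasDerivWithinAt G (f s) (Icc 0 T) s := by
  have hc : Continuous (IccExtend hT ((Icc 0 T).domRestrict f)) :=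
    (continuousOn_iff_continuous_domRestrict.mp hf).Icc_extend'
  refine ⟨fun s => ∫ x in (0 : ℝ)..s, IccExtend hT ((Icc 0 T).domRestrict f) x, by simp, ?_⟩
  intro s hs
  have := (hc.integral_hasStrictDerivAt 0 s).hasDerivAt.hasDerivWithinAt (s := Icc 0 T)
  rwa [IccExtend_of_mem hT _ hs] at this

section Kepler

variable {μ T : ℝ} {z v : ℝ → ℂ}

theorem kepler_energy (hz : ∀ s ∈ Icc 0 T, HasDerivWithinAt z (v s) (Icc 0 T) s)
    (hv : ∀ s ∈ Icc 0 T, HasDerivWithinAt v (-(μ / ‖z s‖ ^ 3) • z s) (Icc 0 T) s)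
    (hne : ∀ s ∈ Icc 0 T, z s ≠ 0) {s : ℝ} (hs : s ∈ Icc 0 T) :
    ‖v s‖ ^ 2 / 2 - μ / ‖z s‖ = ‖v 0‖ ^ 2 / 2 - μ / ‖z 0‖ := by
  have h : ∀ s ∈ Icc 0 T, HasDerivWithinAt (fun s => ‖v s‖ ^ 2 / 2 - μ / √(‖z s‖ ^ 2)) 0
      (Icc 0 T) s := by
    intro s hs
    have hn : 0 < ‖z s‖ := norm_pos_iff.mpr (hne s hs)
    have h1 := (hz s hs).norm_sq.sqrt (by positivity)
    have h2 : √(‖z s‖ ^ 2) ≠ 0 := by rw [Real.sqrt_sq hn.le]; exact hn.ne'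
    refine (((hv s hs).norm_sq.div_const 2).sub
      ((hasDerivWithinAt_const s (Icc 0 T) μ).div h1 h2)).congr_deriv ?_
    rw [Real.sqrt_sq hn.le, real_inner_smul_right, real_inner_comm (z s) (v s)]
    field_simp
    ring
  have := eq_of_hasDerivWithinAt_zero h hs
  simpa only [Real.sqrt_sq (norm_nonneg _)] using this

theorem kepler_angular_momentum (hz : ∀ s ∈ Icc 0 T, HasDerivWithinAt z (v s) (Icc 0 T) s)
    (hv : ∀ s ∈ Icc 0 T, HasDerivWithinAt v (-(μ / ‖z s‖ ^ 3) • z s) (Icc 0 T) s)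
    {s : ℝ} (hs : s ∈ Icc 0 T) :
    ⟪Complex.I * z s, v s⟫_ℝ = ⟪Complex.I * z 0, v 0⟫_ℝ := by
  have h : ∀ s ∈ Icc 0 T, HasDerivWithinAt (fun s => ⟪Complex.I * z s, v s⟫_ℝ) 0
      (Icc 0 T) s := by
    intro s hs
    refine ((((hz s hs).const_mul Complex.I).inner ℝ (hv s hs))).congr_deriv ?_
    rw [real_inner_smul_right]
    simp only [Complex.inner]
    simp
    ring_nf
  exact eq_of_hasDerivWithinAt_zero h hs

/-- The Levi-Civita transformation of a Kepler arc without collision. -/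
theorem kepler_eq_hypCurve {l : ℝ} (hl : 0 < l) (hT : 0 < T)
    (hz : ∀ s ∈ Icc 0 T, HasDerivWithinAt z (v s) (Icc 0 T) s)
    (hv : ∀ s ∈ Icc 0 T, HasDerivWithinAt v (-(μ / ‖z s‖ ^ 3) • z s) (Icc 0 T) s)
    (hne : ∀ s ∈ Icc 0 T, z s ≠ 0) (hen : ‖v 0‖ ^ 2 / 2 - μ / ‖z 0‖ = 2 * l ^ 2)
    {w₀ : ℂ} (hw₀ : w₀ ^ 2 = z 0) :
    ∃ Θ : ℝ, 0 < Θ ∧ hypCurve l w₀ (conj w₀ * v 0 / (2 * l)) Θ ^ 2 = z T ∧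
      v T = 2 * l * hypCurve' l w₀ (conj w₀ * v 0 / (2 * l)) Θ /
        conj (hypCurve l w₀ (conj w₀ * v 0 / (2 * l)) Θ) := by
  have hzc : ContinuousOn z (Icc 0 T) := fun s hs => (hz s hs).continuousWithinAt
  have hvc : ContinuousOn v (Icc 0 T) := fun s hs => (hv s hs).continuousWithinAt
  -- `J` is half a logarithm of `z / z 0`, so `w₀ exp J` is a continuous square root of `z`; the
  -- function `θ` below is the regularized time, `dθ = ds/‖z‖`.
  obtain ⟨J, hJ0, hJ⟩ := exists_primitive hT.le
    (f := fun s => v s / (2 * z s)) (hvc.div (continuousOn_const.mul hzc)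
      (fun s hs => mul_ne_zero two_ne_zero (hne s hs)))
  obtain ⟨θ, hθ0, hθ⟩ := exists_primitive hT.le
    (f := fun s => ‖z s‖⁻¹) (hzc.norm.inv₀ (fun s hs => norm_ne_zero_iff.mpr (hne s hs)))
  set w : ℝ → ℂ := fun s => w₀ * Complex.exp (J s) with hw
  have hw0 : w 0 = w₀ := by simp [hw, hJ0]
  have hz0 : z 0 ≠ 0 := hne 0 ⟨le_rfl, hT.le⟩
  have hw₀ne : w₀ ≠ 0 := by rintro rfl; exact hz0 (by rw [← hw₀]; ring)
  have hwne : ∀ s, w s ≠ 0 := fun s => mul_ne_zero hw₀ne (Complex.exp_ne_zero _)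
  have hwd : ∀ s ∈ Icc 0 T, HasDerivWithinAt w (w s * (v s / (2 * z s))) (Icc 0 T) s := by
    intro s hs
    refine ((hJ s hs).cexp.const_mul w₀).congr_deriv ?_
    rw [hw]; ring
  have hsq : ∀ s ∈ Icc 0 T, w s ^ 2 = z s := by
    intro s hs
    have h1 : ∀ s ∈ Icc 0 T, HasDerivWithinAt (fun s => w s ^ 2 / z s) 0 (Icc 0 T) s := by
      intro s hs
      refine (((hwd s hs).pow 2).div (hz s hs) (hne s hs)).congr_deriv ?_
      have := hne s hs
      field_simp
      simp only [pow_one, Nat.add_one_sub_one, Nat.cast_ofNat, Pi.pow_apply]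
      ring
    have h2 := eq_of_hasDerivWithinAt_zero h1 hs
    rw [hw0, hw₀, div_self hz0, div_eq_one_iff_eq (hne s hs)] at h2
    exact h2
  have hconj : ∀ x : ℂ, ((‖x‖ : ℝ) : ℂ) ^ 2 = x * conj x := by
    intro x; rw [Complex.mul_conj, Complex.normSq_eq_norm_sq]; push_cast; rfl
  have hnz : ∀ s ∈ Icc 0 T, ((‖z s‖ : ℝ) : ℂ) = w s * conj (w s) := by
    intro s hs; rw [← hconj, ← hsq s hs, norm_pow]; push_cast; ring
  have hlC : (l : ℂ) ≠ 0 := by exact_mod_cast hl.ne'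
  set u : ℝ → ℂ := fun s => conj (w s) * v s / (2 * l) with hu
  have hwd' : ∀ s ∈ Icc 0 T, HasDerivWithinAt w (‖z s‖⁻¹ • (l • u s)) (Icc 0 T) s := by
    intro s hs
    refine (hwd s hs).congr_deriv ?_
    have h1 := hwne s
    have h2 : conj (w s) ≠ 0 := by simpa using h1
    simp only [Complex.real_smul, Complex.ofReal_inv, hnz s hs, hu]
    rw [← hsq s hs]
    field_simp
  have hud : ∀ s ∈ Icc 0 T, HasDerivWithinAt u (‖z s‖⁻¹ • (l • w s)) (Icc 0 T) s := by
    intro s hs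
    have h1 := hwne s
    have h2 : conj (w s) ≠ 0 := by simpa using h1
    have hcd : HasDerivWithinAt (fun s => conj (w s))
        (conj (w s * (v s / (2 * z s)))) (Icc 0 T) s :=
      Complex.conjCLE.toContinuousLinearMap.hasFDerivAt.comp_hasDerivWithinAt s (hwd s hs)
    refine ((hcd.mul (hv s hs)).div_const (2 * l : ℂ)).congr_deriv ?_
    have he := kepler_energy hz hv hne hs
    rw [hen] at he
    have hzn : ‖z s‖ ≠ 0 := norm_ne_zero_iff.mpr (hne s hs)
    have he' : v s * conj (v s) / 2 - μ / (w s * conj (w s)) = 2 * l ^ 2 := by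
      rw [← hconj, ← hnz s hs]; exact_mod_cast he
    have hn3 : ((‖z s‖ ^ 3 : ℝ) : ℂ) = (w s * conj (w s)) ^ 3 := by
      rw [← hnz s hs]; push_cast; ring
    simp only [Complex.real_smul, Complex.ofReal_inv, Complex.ofReal_neg, Complex.ofReal_div,
      hnz s hs, hn3, map_mul, map_div₀, Complex.conj_ofNat]
    rw [← hsq s hs, map_pow]
    field_simp
    field_simp at he'
    linear_combination he'
  -- In regularized time `w' = l u` and `u' = l w`. The two characteristic combinations `w ± u`,
  -- with their exponential growth removed, are constant and determine `w` and `u`.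
  have hPd : ∀ s ∈ Icc 0 T, HasDerivWithinAt
      (fun s => Real.exp (-(l * θ s)) • (w s + u s)) 0 (Icc 0 T) s := by
    intro s hs
    refine ((((hθ s hs).const_mul l).neg.exp).smul ((hwd' s hs).add (hud s hs))).congr_deriv ?_
    simp only [Complex.real_smul, Pi.add_apply, Pi.neg_apply]
    push_cast
    ring
  have hMd : ∀ s ∈ Icc 0 T, HasDerivWithinAt
      (fun s => Real.exp (l * θ s) • (w s - u s)) 0 (Icc 0 T) s := by
    intro s hs
    refine ((((hθ s hs).const_mul l).exp).smul ((hwd' s hs).sub (hud s hs))).congr_deriv ?_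
    simp only [Complex.real_smul, Pi.sub_apply]
    push_cast
    ring
  have hTm : T ∈ Icc 0 T := ⟨hT.le, le_rfl⟩
  have hP := eq_of_hasDerivWithinAt_zero hPd hTm
  have hM := eq_of_hasDerivWithinAt_zero hMd hTm
  rw [hθ0, mul_zero, neg_zero, Real.exp_zero, one_smul] at hP
  rw [hθ0, mul_zero, Real.exp_zero, one_smul] at hM
  have hu0 : u 0 = conj w₀ * v 0 / (2 * l) := by rw [hu]; simp only [hw0]
  rw [← hu0]
  rw [hw0] at hP hM
  have hee : ((Real.exp (l * θ T) : ℝ) : ℂ) * ((Real.exp (-(l * θ T)) : ℝ) : ℂ) = 1 := by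
    rw [← Complex.ofReal_mul, ← Real.exp_add]; simp
  simp only [Complex.real_smul] at hP hM
  have hwT : hypCurve l w₀ (u 0) (θ T) = w T := by
    simp only [hypCurve, Complex.real_smul, Real.cosh_eq, Real.sinh_eq]
    push_cast
    push_cast at hP hM hee
    linear_combination (-(Complex.exp (l * θ T)) / 2) * hP
      - Complex.exp (-(l * θ T)) / 2 * hM + w T * hee
  have huT : hypCurve' l w₀ (u 0) (θ T) = u T := by
    simp only [hypCurve', Complex.real_smul, Real.cosh_eq, Real.sinh_eq]
    push_cast
    push_cast at hP hM hee
    linear_combination (-(Complex.exp (l * θ T)) / 2) * hP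
      + Complex.exp (-(l * θ T)) / 2 * hM + u T * hee
  refine ⟨θ T, ?_, by rw [hwT, hsq T hTm], ?_⟩
  · have hcont : ContinuousOn θ (Icc 0 T) := fun s hs => (hθ s hs).continuousWithinAt
    have hm : StrictMonoOn θ (Icc 0 T) := by
      apply strictMonoOn_of_deriv_pos (convex_Icc 0 T) hcont
      intro x hx
      rw [interior_Icc] at hx
      have := (hθ x ⟨hx.1.le, hx.2.le⟩).hasDerivAt (Icc_mem_nhds hx.1 hx.2)
      rw [this.deriv]
      exact inv_pos.mpr (norm_pos_iff.mpr (hne x ⟨hx.1.le, hx.2.le⟩))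
    rw [← hθ0]
    exact hm ⟨le_rfl, hT.le⟩ hTm hT
  · rw [hwT, huT, hu]
    have h2 : conj (w T) ≠ 0 := by simpa using hwne T
    field_simp

end Kepler

variable {B : Billiard}

/-- An inner arc with a collision runs back along the segment by which it came. -/
theorem Billiard.IsInnerArc.of_collision {z v : ℝ → ℂ} {T : ℝ} (h : B.IsInnerArc z v T)
    (h0 : z 0 ∉ B.D) (hT : z T ∉ B.D) (hz0 : z 0 ≠ 0) (hzT : z T ≠ 0) {c : ℝ} (hc : c ∈ Icc 0 T)
    (hzc : z c = 0) : z T = z 0 ∧ v T = -v 0 ∧ ⟪Complex.I * z 0, v 0⟫_ℝ = 0 := by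
  -- A collision must be at mid-time: otherwise reflection would carry one end of the arc to an
  -- interior time, where the arc is in `D`.
  have hkey : ∀ c ∈ Icc 0 T, z c = 0 → T = 2 * c := by
    intro c hc hzc
    have hc0 : 0 < c := lt_of_le_of_ne hc.1 (by rintro rfl; exact hz0 hzc)
    have hcT : c < T := lt_of_le_of_ne hc.2 (by rintro rfl; exact hzT hzc)
    rcases lt_trichotomy T (2 * c) with hlt | heq | hlt
    · exfalso
      have := h.reflect c hc hzc (T - c) ⟨by linarith, by linarith⟩ ⟨by linarith, by linarith⟩
      rw [add_sub_cancel] at this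
      apply hT
      rw [this]
      exact h.inside _ ⟨by linarith, by linarith⟩
    · exact heq
    · exfalso
      have := h.reflect c hc hzc c ⟨by linarith, by linarith⟩ ⟨by linarith, by linarith⟩
      rw [sub_self] at this
      apply h0
      rw [← this]
      exact h.inside _ ⟨by linarith, by linarith⟩
  have hTc := hkey c hc hzc
  have hc0 : 0 < c := lt_of_le_of_ne hc.1 (by rintro rfl; exact hz0 hzc)
  have hne : ∀ s ∈ Icc 0 T, s ≠ c → z s ≠ 0 := fun s hs hsc hzs => by
    have := hkey s hs hzs
    exact hsc (by linarith)
  have hsym : ∀ s ∈ Icc 0 T, z (T - s) = z s := by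
    intro s hs
    have := h.reflect c hc hzc (c - s) ⟨by linarith [hs.1], by linarith [hs.2]⟩
      ⟨by linarith [hs.2], by linarith [hs.1]⟩
    rw [sub_sub_cancel] at this
    rw [← this, hTc]; congr 1; ring
  have hzT0 : z T = z 0 := by simpa using hsym 0 ⟨le_rfl, h.pos.le⟩
  refine ⟨hzT0, ?_, ?_⟩
  · have h1 := h.deriv_pos 0 ⟨le_rfl, h.pos.le⟩ hz0
    have h2 := h.deriv_pos T ⟨h.pos.le, le_rfl⟩ hzT
    have h3 : HasDerivWithinAt (fun s => z (T - s)) (-v 0) (Icc 0 T) T := by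
      have hi : HasDerivWithinAt (fun s : ℝ => T - s) (-1) (Icc 0 T) T :=
        ((hasDerivAt_id T).const_sub T).hasDerivWithinAt
      have h4 : HasDerivWithinAt z (v 0) (Icc 0 T) (T - T) := by rwa [sub_self]
      have := h4.scomp T hi (fun s hs => ⟨by linarith [hs.2], by linarith [hs.1]⟩)
      rw [neg_one_smul] at this
      exact this
    have h4 := h3.congr (fun s hs => (hsym s hs).symm) (by simpa using hzT0)
    have hu := uniqueDiffOn_Icc h.pos T ⟨h.pos.le, le_rfl⟩
    exact hu.eq_deriv _ h2 h4
  · have hsub : ∀ s ∈ Ico 0 c, ∀ x ∈ Icc 0 s, x ∈ Icc 0 T ∧ z x ≠ 0 := by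
      intro s hs x hx
      have : x ∈ Icc 0 T := ⟨hx.1, by linarith [hx.2, hs.2]⟩
      exact ⟨this, hne x this (by linarith [hx.2, hs.2] : x < c).ne⟩
    have hIcc : ∀ s ∈ Ico 0 c, Icc 0 s ⊆ Icc 0 T := fun s hs x hx => (hsub s hs x hx).1
    have hd1 : ∀ s ∈ Ico 0 c, ∀ x ∈ Icc 0 s, HasDerivWithinAt z (v x) (Icc 0 s) x :=
      fun s hs x hx => (h.deriv_pos x (hsub s hs x hx).1 (hsub s hs x hx).2).mono (hIcc s hs)
    have hd2 : ∀ s ∈ Ico 0 c, ∀ x ∈ Icc 0 s,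
        HasDerivWithinAt v (-(B.μ / ‖z x‖ ^ 3) • z x) (Icc 0 s) x :=
      fun s hs x hx => (h.deriv_vel x (hsub s hs x hx).1 (hsub s hs x hx).2).mono (hIcc s hs)
    set M := ⟪Complex.I * z 0, v 0⟫_ℝ with hM
    set H := ‖v 0‖ ^ 2 / 2 - B.μ / ‖z 0‖ with hH
    -- Conservation of energy and angular momentum before the collision; the right-hand side tends
    -- to `0` at the collision, so the angular momentum is zero.
    have hbound : ∀ s ∈ Ico 0 c, M ^ 2 ≤ 2 * H * ‖z s‖ ^ 2 + 2 * B.μ * ‖z s‖ := by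
      intro s hs
      have hss : s ∈ Icc 0 s := ⟨hs.1, le_rfl⟩
      have h1 := kepler_angular_momentum (hd1 s hs) (hd2 s hs) hss
      have h2 := kepler_energy (hd1 s hs) (hd2 s hs) (fun x hx => (hsub s hs x hx).2) hss
      have h3 := abs_real_inner_le_norm (Complex.I * z s) (v s)
      rw [h1, norm_mul, Complex.norm_I, one_mul] at h3
      have h4 : M ^ 2 ≤ (‖z s‖ * ‖v s‖) ^ 2 := by
        rw [← sq_abs M]; gcongr
      have hzs : ‖z s‖ ≠ 0 := norm_ne_zero_iff.mpr (hsub s hs s hss).2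
      have h5 : ‖v s‖ ^ 2 = 2 * H + 2 * (B.μ / ‖z s‖) := by linarith
      rw [mul_pow, h5] at h4
      refine h4.trans (le_of_eq ?_)
      field_simp
    have hlim : Tendsto (fun s => 2 * H * ‖z s‖ ^ 2 + 2 * B.μ * ‖z s‖) (𝓝[Ico 0 c] c) (𝓝 0) := by
      have hzc' : ContinuousWithinAt z (Ico 0 c) c :=
        (h.continuousOn c hc).mono (fun x hx => ⟨hx.1, by linarith [hx.2]⟩)
      have h1 : ContinuousWithinAt (fun s => 2 * H * ‖z s‖ ^ 2 + 2 * B.μ * ‖z s‖) (Ico 0 c) c :=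
        (continuousWithinAt_const.mul (hzc'.norm.pow 2)).add
          (continuousWithinAt_const.mul hzc'.norm)
      have := h1.tendsto
      simpa [hzc] using this
    have hneb : (𝓝[Ico 0 c] c).NeBot := by
      rw [← mem_closure_iff_nhdsWithin_neBot, closure_Ico hc0.ne]
      exact ⟨hc0.le, le_rfl⟩
    have := ge_of_tendsto hlim (by filter_upwards [self_mem_nhdsWithin] with s hs using hbound s hs)
    exact pow_eq_zero_iff two_ne_zero |>.mp (le_antisymm this (sq_nonneg M))

end RefractionBilliard

/-! ### Algebra of the two-point problem for hyperbolic curves. -/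

namespace RefractionBilliard
open scoped InnerProductSpace ComplexConjugate

/-- `√((‖p‖ ‖q‖ + ⟪p, q⟫) / 2)`, the modulus of the inner product of square roots of `p`, `q`. -/
noncomputable def lcA (p q : ℂ) : ℝ := √((‖p‖ * ‖q‖ + ⟪p, q⟫_ℝ) / 2)

/-- `ν` times the hyperbolic cosine of the phase of the Kepler arc from `p` to `q` that passes
close to the center. -/
noncomputable def lcK (p q : ℂ) (ν : ℝ) : ℝ :=
  lcA p q + √(lcA p q ^ 2 + ν * (ν + ‖p‖ + ‖q‖))

/-- The product of square roots of `p` and `q` that have a negative inner product. -/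
noncomputable def lcQ (p q : ℂ) : ℂ := -((1 / (2 * lcA p q)) • (‖q‖ • p + ‖p‖ • q))

/-- The rescaled initial velocity of the Kepler arc from `p` to `q` that passes close to the
center. -/
noncomputable def inU (p q : ℂ) (ν : ℝ) : ℂ :=
  (2 / (‖p‖ * √(lcK p q ν ^ 2 - ν ^ 2))) • (ν • lcQ p q - lcK p q ν • p)

theorem lcA_sq_sq (w₀ w₁ : ℂ) : lcA (w₀ ^ 2) (w₁ ^ 2) = |⟪w₀, w₁⟫_ℝ| := by
  rw [lcA, ← Real.sqrt_sq_eq_abs]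
  congr 1
  rw [norm_pow, norm_pow, ← Complex.normSq_eq_norm_sq, ← Complex.normSq_eq_norm_sq,
    Complex.normSq_apply, Complex.normSq_apply, Complex.inner, Complex.inner]
  simp [pow_two]
  ring

section Algebra

variable {w₀ w₁ d : ℂ} {C S ν : ℝ}

/-- The hyperbolic counterpart of `outC_root`. The two signs of `⟪w₀, w₁⟫` give the central and the
direct arc. -/
theorem phase_root (hw : w₁ = C • w₀ + S • d) (hCS : C ^ 2 = 1 + S ^ 2)
    (hd : ‖d‖ ^ 2 = ‖w₀‖ ^ 2 + ν) :
    ν * C ^ 2 + 2 * ⟪w₀, w₁⟫_ℝ * C = ν + ‖w₀‖ ^ 2 + ‖w₁‖ ^ 2 := by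
  have h1 : ‖w₁ - C • w₀‖ ^ 2 = S ^ 2 * (‖w₀‖ ^ 2 + ν) := by
    rw [hw, add_sub_cancel_left, norm_smul, mul_pow, hd, Real.norm_eq_abs, sq_abs]
  rw [norm_sub_sq_real, norm_smul, mul_pow, Real.norm_eq_abs, sq_abs, real_inner_smul_right,
    real_inner_comm] at h1
  linear_combination (ν + ‖w₀‖ ^ 2) * hCS - h1

/-- `C > 0` selects the positive root of `phase_root`, so `ν C` is `lcK`. The result depends only on
the squares, so `inU` is a smooth function of the ends that needs no choice of square roots. -/
theorem inU_eq (ha : ⟪w₀, w₁⟫_ℝ < 0) (hw : w₁ = C • w₀ + S • d) (hCS : C ^ 2 = 1 + S ^ 2)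
    (hS : 0 < S) (hC : 0 < C) (hν : 0 < ν) (hd : ‖d‖ ^ 2 = ‖w₀‖ ^ 2 + ν) :
    lcK (w₀ ^ 2) (w₁ ^ 2) ν = ν * C ∧ inU (w₀ ^ 2) (w₁ ^ 2) ν = 2 * d / conj w₀ := by
  have hroot := phase_root hw hCS hd
  set a := ⟪w₀, w₁⟫_ℝ with ha'
  have hA : lcA (w₀ ^ 2) (w₁ ^ 2) = -a := by rw [lcA_sq_sq, abs_of_neg ha]
  have hw0 : w₀ ≠ 0 := by rintro rfl; simp [ha'] at ha
  have hw1 : w₁ ≠ 0 := by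
    intro h; rw [ha', h] at ha; simp at ha
  have hK : lcK (w₀ ^ 2) (w₁ ^ 2) ν = ν * C := by
    rw [lcK, hA, norm_pow, norm_pow]
    have h1 : (-a) ^ 2 + ν * (ν + ‖w₀‖ ^ 2 + ‖w₁‖ ^ 2) = (ν * C + a) ^ 2 := by
      rw [← hroot]; ring
    have hpos : 0 < (ν * C + a) := by
      have h2 : 0 < ν * C * (ν * C + a) + a * (ν * C) := by
        have h3 : ν * C * (ν * C + a) + a * (ν * C) = ν * (ν + ‖w₀‖ ^ 2 + ‖w₁‖ ^ 2) := by
          rw [← hroot]; ring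
        rw [h3]; positivity
      have h4 : a * (ν * C) < 0 := mul_neg_of_neg_of_pos ha (by positivity)
      have h5 : 0 < ν * C := by positivity
      by_contra hno
      push Not at hno
      nlinarith
    rw [h1, Real.sqrt_sq hpos.le]; ring
  refine ⟨hK, ?_⟩
  -- `‖w₁‖² w₀² + ‖w₀‖² w₁² = 2 ⟪w₀, w₁⟫ w₀ w₁`; the sign in `lcQ` is the one for a negative inner
  -- product.
  have hQ : lcQ (w₀ ^ 2) (w₁ ^ 2) = w₀ * w₁ := by
    have hn : ∀ x : ℂ, ((‖x‖ : ℝ) : ℂ) ^ 2 = x * conj x := by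
      intro x; rw [Complex.mul_conj, Complex.normSq_eq_norm_sq]; push_cast; rfl
    have haC : (a : ℂ) = (conj w₀ * w₁ + w₀ * conj w₁) / 2 := by
      rw [ha', Complex.inner]
      apply Complex.ext <;> simp <;> ring
    have ha0 : (a : ℂ) ≠ 0 := by exact_mod_cast ha.ne
    rw [lcQ, hA]
    simp only [Complex.real_smul, norm_pow]
    push_cast
    rw [hn, hn]
    field_simp
    rw [haC]
    ring
  have hsq : √((ν * C) ^ 2 - ν ^ 2) = ν * S := by
    have : (ν * C) ^ 2 - ν ^ 2 = (ν * S) ^ 2 := by rw [mul_pow, hCS]; ring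
    rw [this, Real.sqrt_sq (by positivity)]
  rw [inU, hK, hQ, hsq]
  have hSd : (S : ℂ) * d = w₁ - C * w₀ := by
    rw [hw]; simp
  have hSC : (S : ℂ) ≠ 0 := by exact_mod_cast hS.ne'
  have hνC : (ν : ℂ) ≠ 0 := by exact_mod_cast hν.ne'
  have hc0 : conj w₀ ≠ 0 := by simpa using hw0
  have hn : (((‖w₀ ^ 2‖ : ℝ)) : ℂ) = w₀ * conj w₀ := by
    rw [Complex.mul_conj, Complex.normSq_eq_norm_sq, norm_pow]
  simp only [Complex.real_smul]
  push_cast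
  rw [hn]
  field_simp
  linear_combination (-1 : ℂ) * hSd

theorem norm_end_sq (hw : w₁ = C • w₀ + S • d) (hCS : C ^ 2 = 1 + S ^ 2)
    (hd : ‖d‖ ^ 2 = ‖w₀‖ ^ 2 + ν) : ‖-(S • w₀ + C • d)‖ ^ 2 = ‖w₁‖ ^ 2 + ν := by
  rw [hw, norm_neg, norm_add_sq_real, norm_add_sq_real]
  simp only [norm_smul, real_inner_smul_left, real_inner_smul_right, mul_pow, Real.norm_eq_abs,
    sq_abs]
  rw [hCS, hd]; ring

/-- Time reversal: together with `norm_end_sq` it makes `inU_eq` applicable from the other end,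
where it gives minus the final velocity. -/
theorem start_eq (hw : w₁ = C • w₀ + S • d) (hCS : C ^ 2 = 1 + S ^ 2) :
    w₀ = C • w₁ + S • (-(S • w₀ + C • d)) := by
  have : (C : ℂ) ^ 2 = 1 + (S : ℂ) ^ 2 := by exact_mod_cast hCS
  rw [hw]
  simp only [Complex.real_smul]
  linear_combination (-w₀) * this

/-- The direct Kepler arc is not radial: quantitative version. -/
theorem direct_arc_bound (ha : 0 < ⟪w₀, w₁⟫_ℝ) (hw : w₁ = C • w₀ + S • d)
    (hCS : C ^ 2 = 1 + S ^ 2) (hS : 0 < S) (hC : 0 < C) (hν : 0 < ν)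
    (hd : ‖d‖ ^ 2 = ‖w₀‖ ^ 2 + ν) {M a₀ c : ℝ} (hM0 : ‖w₀‖ ^ 2 ≤ M) (hM1 : ‖w₁‖ ^ 2 ≤ M)
    (ha₀ : 0 < a₀) (haa : a₀ ≤ ⟪w₀, w₁⟫_ℝ) (hc : 0 ≤ c)
    (him : c * ‖w₁ ^ 2 - w₀ ^ 2‖ ≤ |⟪Complex.I * w₀ ^ 2, w₁ ^ 2⟫_ℝ|) :
    c * ‖d‖ ≤ |⟪Complex.I * w₀, d⟫_ℝ| * (√M * (1 + M / a₀)) := by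
  have hroot := phase_root hw hCS hd
  set a := ⟪w₀, w₁⟫_ℝ with ha'
  have hM : 0 ≤ M := (sq_nonneg _).trans hM0
  have him2 : ⟪Complex.I * w₀ ^ 2, w₁ ^ 2⟫_ℝ = 2 * a * ⟪Complex.I * w₀, w₁⟫_ℝ := by
    rw [ha']; simp only [Complex.inner]; simp [pow_two]; ring
  have hfac : ‖w₁ ^ 2 - w₀ ^ 2‖ = ‖w₁ - w₀‖ * ‖w₁ + w₀‖ := by rw [← norm_mul]; ring_nf
  have hplus : ‖w₁ + w₀‖ ^ 2 = ‖w₀‖ ^ 2 + ‖w₁‖ ^ 2 + 2 * a := by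
    rw [norm_add_sq_real, real_inner_comm]; ring
  have hminus : ‖w₁ - w₀‖ ^ 2 = ‖w₀‖ ^ 2 + ‖w₁‖ ^ 2 - 2 * a := by
    rw [norm_sub_sq_real, real_inner_comm]; ring
  have h4a : 4 * a ≤ ‖w₁ + w₀‖ ^ 2 := by nlinarith [sq_nonneg ‖w₁ - w₀‖]
  have hppos : 0 < ‖w₁ + w₀‖ := by
    have : 0 < ‖w₁ + w₀‖ ^ 2 := by linarith
    nlinarith [norm_nonneg (w₁ + w₀)]
  have hple : ‖w₁ + w₀‖ ≤ 2 * √M := by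
    have h0 : ‖w₀‖ ≤ √M := Real.le_sqrt_of_sq_le hM0
    have h1 : ‖w₁‖ ≤ √M := Real.le_sqrt_of_sq_le hM1
    linarith [norm_add_le w₁ w₀]
  -- the angular separation of the square roots
  have hIm : c * ‖w₁ - w₀‖ ≤ √M * |⟪Complex.I * w₀, w₁⟫_ℝ| := by
    rw [him2, hfac, abs_mul, abs_of_pos (by linarith : 0 < 2 * a)] at him
    have e1 : c * ‖w₁ - w₀‖ * ‖w₁ + w₀‖ ≤
        √M * |⟪Complex.I * w₀, w₁⟫_ℝ| * ‖w₁ + w₀‖ := by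
      calc c * ‖w₁ - w₀‖ * ‖w₁ + w₀‖ = c * (‖w₁ - w₀‖ * ‖w₁ + w₀‖) := by ring
        _ ≤ 2 * a * |⟪Complex.I * w₀, w₁⟫_ℝ| := him
        _ ≤ (‖w₁ + w₀‖ ^ 2 / 2) * |⟪Complex.I * w₀, w₁⟫_ℝ| := by gcongr; linarith
        _ = (‖w₁ + w₀‖ / 2) * |⟪Complex.I * w₀, w₁⟫_ℝ| * ‖w₁ + w₀‖ := by ring
        _ ≤ _ := by gcongr; linarith
    exact le_of_mul_le_mul_right e1 hppos
  have hC1 : 1 ≤ C := by nlinarith [sq_nonneg S]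
  -- With `a > 0` the root equation makes `C - 1` of second order in the chord, so `S d` is
  -- comparable to the chord. The factor `S` also occurs in `⟪I w₀, w₁⟫ = S ⟪I w₀, d⟫` and cancels
  -- at the end.
  have hCle : (C - 1) * (2 * a) ≤ ‖w₁ - w₀‖ ^ 2 := by
    have : (C - 1) * (ν * (C + 1) + 2 * a) = ‖w₁ - w₀‖ ^ 2 := by
      rw [hminus]; linear_combination hroot
    have h2 : 0 ≤ (C - 1) * (ν * (C + 1)) := mul_nonneg (by linarith) (by positivity)
    linarith
  have hmle : ‖w₁ - w₀‖ ≤ 2 * √M := by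
    have h0 : ‖w₀‖ ≤ √M := Real.le_sqrt_of_sq_le hM0
    have h1 : ‖w₁‖ ≤ √M := Real.le_sqrt_of_sq_le hM1
    linarith [norm_sub_le w₁ w₀]
  have hw0le : ‖w₀‖ ≤ √M := Real.le_sqrt_of_sq_le hM0
  have hCw : (C - 1) * ‖w₀‖ ≤ ‖w₁ - w₀‖ * (M / a₀) := by
    have e1 : (C - 1) * ‖w₀‖ * (2 * a) ≤ ‖w₁ - w₀‖ * (M / a₀) * (2 * a) := by
      calc (C - 1) * ‖w₀‖ * (2 * a) = (C - 1) * (2 * a) * ‖w₀‖ := by ring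
        _ ≤ ‖w₁ - w₀‖ ^ 2 * √M := by gcongr
        _ = ‖w₁ - w₀‖ * (‖w₁ - w₀‖ * √M) := by ring
        _ ≤ ‖w₁ - w₀‖ * (2 * √M * √M) := by gcongr
        _ = ‖w₁ - w₀‖ * (2 * M) := by rw [mul_assoc 2, Real.mul_self_sqrt hM]
        _ = ‖w₁ - w₀‖ * (M / a₀) * (2 * a₀) := by field_simp
        _ ≤ _ := by gcongr
    exact le_of_mul_le_mul_right e1 (by linarith)
  have hSd : S * ‖d‖ ≤ ‖w₁ - w₀‖ * (1 + M / a₀) := by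
    have e1 : S • d = (w₁ - w₀) - (C - 1) • w₀ := by
      rw [hw]; simp only [Complex.real_smul]; push_cast; ring
    have e2 : S * ‖d‖ = ‖S • d‖ := by rw [norm_smul, Real.norm_eq_abs, abs_of_pos hS]
    rw [e2, e1]
    refine (norm_sub_le _ _).trans ?_
    rw [norm_smul, Real.norm_eq_abs, abs_of_nonneg (by linarith : 0 ≤ C - 1)]
    linarith
  have hSIm : |⟪Complex.I * w₀, w₁⟫_ℝ| = S * |⟪Complex.I * w₀, d⟫_ℝ| := by
    have : ⟪Complex.I * w₀, w₁⟫_ℝ = S * ⟪Complex.I * w₀, d⟫_ℝ := by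
      rw [hw, inner_add_right, real_inner_smul_right, real_inner_smul_right]
      have : ⟪Complex.I * w₀, w₀⟫_ℝ = 0 := by rw [Complex.inner]; simp; ring
      rw [this]; ring
    rw [this, abs_mul, abs_of_pos hS]
  have hfin : S * (c * ‖d‖) ≤ S * (|⟪Complex.I * w₀, d⟫_ℝ| * (√M * (1 + M / a₀))) := by
    have hMa : 0 ≤ 1 + M / a₀ := by positivity
    calc S * (c * ‖d‖) = c * (S * ‖d‖) := by ring
      _ ≤ c * (‖w₁ - w₀‖ * (1 + M / a₀)) := by gcongr
      _ = c * ‖w₁ - w₀‖ * (1 + M / a₀) := by ring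
      _ ≤ √M * |⟪Complex.I * w₀, w₁⟫_ℝ| * (1 + M / a₀) := by gcongr
      _ = _ := by rw [hSIm]; ring
  exact le_of_mul_le_mul_left hfin hS

end Algebra

/-- The error with which the Kepler arc from `p` to `q` follows the segment from `p` to the
center. -/
noncomputable def inErr (p q : ℂ) (ν : ℝ) : ℝ :=
  (‖p‖ + 2 * ‖q‖) * √(2 * ν / (ν + lcK p q ν))

/-- On the first half `w = σ w₀ + r w₁` with `r` small relative to `1 - σ²`. Squaring gives a point
of a ray through `w₀²` with `k = -(1 - σ²)`, and the error is controlled by `1 / cosh (lΘ/2)`, which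
is the square root in `inErr`. -/
theorem hypCurve_sq_eq {l Θ τ ν : ℝ} {w₀ d : ℂ} (hl : 0 < l) (hν : 0 < ν) (hΘ : 0 < Θ)
    (hK : lcK (w₀ ^ 2) (hypCurve l w₀ d Θ ^ 2) ν = ν * Real.cosh (l * Θ))
    (hτ0 : 0 < τ) (hτ : τ ≤ Θ / 2) :
    ∃ k ∈ Ico (-1 : ℝ) 0, ∃ e : ℂ, ‖e‖ ≤ inErr (w₀ ^ 2) (hypCurve l w₀ d Θ ^ 2) ν ∧
      hypCurve l w₀ d τ ^ 2 = w₀ ^ 2 + k • (w₀ ^ 2 + e) := by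
  set w₁ := hypCurve l w₀ d Θ with hw₁
  set X := l * (Θ - τ) with hX
  set Y := l * τ with hY
  have hXY : l * Θ = X + Y := by rw [hX, hY]; ring
  have hXpos : 0 < X := mul_pos hl (by linarith)
  have hYpos : 0 < Y := mul_pos hl hτ0
  set N := Real.sinh (X + Y) with hN
  have hsX : 0 < Real.sinh X := Real.sinh_pos_iff.mpr hXpos
  have hsY : 0 < Real.sinh Y := Real.sinh_pos_iff.mpr hYpos
  have hN0 : 0 < N := Real.sinh_pos_iff.mpr (by linarith)
  have hcX : 1 ≤ Real.cosh X := Real.one_le_cosh X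
  have hcY : 1 ≤ Real.cosh Y := Real.one_le_cosh Y
  have hNeq : N = Real.sinh X * Real.cosh Y + Real.cosh X * Real.sinh Y := Real.sinh_add X Y
  set σ := Real.sinh X / N with hσ
  set r := Real.sinh Y / N with hr
  have hσ0 : 0 < σ := by positivity
  have hr0 : 0 < r := by positivity
  -- From `N = sinh X cosh Y + cosh X sinh Y` and `cosh Y ≥ 1`; on the first half `X ≥ lΘ/2`, so `r`
  -- is at most `(1 - σ) / cosh (lΘ/2)`.
  have hrσ : r * Real.cosh X ≤ 1 - σ := by
    have : 1 - σ = (N - Real.sinh X) / N := by rw [hσ]; field_simp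
    rw [this, hr, div_mul_eq_mul_div]
    gcongr
    nlinarith
  have hσ1 : σ < 1 := by
    have : 0 < r * Real.cosh X := by positivity
    linarith
  have hr1 : r ≤ 1 := by nlinarith
  have hcurve : hypCurve l w₀ d τ = σ • w₀ + r • w₁ := by
    rw [hw₁, hypCurve, hypCurve, hXY, ← hY, ← hN, hσ, hr, Real.cosh_add]
    have hNC : (N : ℂ) ≠ 0 := by exact_mod_cast hN0.ne'
    have hNeqC : (N : ℂ) = Real.sinh X * Real.cosh Y + Real.cosh X * Real.sinh Y := by
      exact_mod_cast hNeq
    have h1 : (Real.cosh Y : ℂ) ^ 2 = (Real.sinh Y : ℂ) ^ 2 + 1 := by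
      exact_mod_cast Real.cosh_sq Y
    simp only [Complex.real_smul, Complex.ofReal_div, Complex.ofReal_add, Complex.ofReal_mul]
    field_simp
    linear_combination (w₀ * Real.cosh Y) * hNeqC + (w₀ * Real.sinh X) * h1
  have hs0 : 0 < 1 - σ ^ 2 := by nlinarith
  refine ⟨-(1 - σ ^ 2), ⟨by nlinarith, by linarith⟩,
    -((1 / (1 - σ ^ 2)) • (r ^ 2 • w₁ ^ 2 + (2 * σ * r) • (w₀ * w₁))), ?_, ?_⟩
  · rw [norm_neg, norm_smul, Real.norm_eq_abs, abs_of_pos (by positivity)]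
    have e1 : ‖r ^ 2 • w₁ ^ 2 + (2 * σ * r) • (w₀ * w₁)‖ ≤ r * (‖w₀ ^ 2‖ + 2 * ‖w₁ ^ 2‖) := by
      refine (norm_add_le _ _).trans ?_
      rw [norm_smul, norm_smul, Real.norm_eq_abs, Real.norm_eq_abs,
        abs_of_pos (by positivity), abs_of_pos (by positivity), norm_mul, norm_pow, norm_pow]
      have h2 : σ * (2 * (‖w₀‖ * ‖w₁‖)) ≤ 1 * (‖w₀‖ ^ 2 + ‖w₁‖ ^ 2) := by
        gcongr
        nlinarith [sq_nonneg (‖w₀‖ - ‖w₁‖)]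
      have h3 : r * ‖w₁‖ ^ 2 ≤ 1 * ‖w₁‖ ^ 2 := by gcongr
      calc r ^ 2 * ‖w₁‖ ^ 2 + 2 * σ * r * (‖w₀‖ * ‖w₁‖)
          = r * (r * ‖w₁‖ ^ 2 + σ * (2 * (‖w₀‖ * ‖w₁‖))) := by ring
        _ ≤ r * (‖w₀‖ ^ 2 + 2 * ‖w₁‖ ^ 2) :=
            mul_le_mul_of_nonneg_left (by linarith) hr0.le
    have e2 : r / (1 - σ ^ 2) ≤ √(2 * ν / (ν + ν * Real.cosh (l * Θ))) := by
      apply Real.le_sqrt_of_sq_le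
      have h1 : 2 * ν / (ν + ν * Real.cosh (l * Θ)) = 1 / Real.cosh (l * Θ / 2) ^ 2 := by
        have : Real.cosh (l * Θ) = 2 * Real.cosh (l * Θ / 2) ^ 2 - 1 := by
          have := Real.cosh_two_mul (l * Θ / 2)
          rw [mul_div_cancel₀ _ two_ne_zero, Real.sinh_sq] at this
          rw [this]; ring
        rw [this]
        have := Real.cosh_pos (l * Θ / 2)
        field_simp
        ring
      rw [h1, div_pow, div_le_div_iff₀ (by positivity) (by positivity), one_mul, ← mul_pow]
      have h2 : Real.cosh (l * Θ / 2) ≤ Real.cosh X := by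
        rw [Real.cosh_le_cosh, abs_of_pos (by positivity), abs_of_pos hXpos, hX]
        nlinarith
      have h3 : r * Real.cosh (l * Θ / 2) ≤ 1 - σ ^ 2 := by
        have : r * Real.cosh (l * Θ / 2) ≤ r * Real.cosh X := by gcongr
        nlinarith
      have := Real.cosh_pos (l * Θ / 2)
      gcongr
    rw [inErr, hK]
    calc 1 / (1 - σ ^ 2) * ‖r ^ 2 • w₁ ^ 2 + (2 * σ * r) • (w₀ * w₁)‖
        ≤ 1 / (1 - σ ^ 2) * (r * (‖w₀ ^ 2‖ + 2 * ‖w₁ ^ 2‖)) := by gcongr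
      _ = (‖w₀ ^ 2‖ + 2 * ‖w₁ ^ 2‖) * (r / (1 - σ ^ 2)) := by ring
      _ ≤ _ := by gcongr
  · rw [hcurve]
    simp only [Complex.real_smul]
    have : (1 - (σ : ℂ) ^ 2) ≠ 0 := by exact_mod_cast hs0.ne'
    push_cast
    field_simp
    ring

end RefractionBilliard

/-! ### Existence and uniqueness of the inner arc that passes near the center. -/

namespace RefractionBilliard
open scoped InnerProductSpace ComplexConjugate

theorem inner_sqrt_ne_zero {w₀ w₁ : ℂ} (h : 0 < ‖w₀ ^ 2‖ * ‖w₁ ^ 2‖ + ⟪w₀ ^ 2, w₁ ^ 2⟫_ℝ) :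
    ⟪w₀, w₁⟫_ℝ ≠ 0 := by
  intro h0
  have := lcA_sq_sq w₀ w₁
  rw [h0, abs_zero, lcA, Real.sqrt_eq_zero'] at this
  linarith

/-- Two non-antipodal points are joined by a Levi-Civita arc that passes close to the center. -/
theorem exists_hypCurve_end {l ν : ℝ} {w₀ q : ℂ} (hl : 0 < l) (hν : 0 < ν)
    (h : 0 < ‖w₀ ^ 2‖ * ‖q‖ + ⟪w₀ ^ 2, q⟫_ℝ) :
    ∃ (d : ℂ) (Θ : ℝ), 0 < Θ ∧ ‖d‖ ^ 2 = ‖w₀‖ ^ 2 + ν ∧ hypCurve l w₀ d Θ ^ 2 = q ∧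
      ⟪w₀, hypCurve l w₀ d Θ⟫_ℝ < 0 := by
  -- Choosing the square root of `q` is choosing the arc: the negative inner product belongs to the
  -- one near the center.
  obtain ⟨w₁, rfl, ha⟩ : ∃ w₁ : ℂ, w₁ ^ 2 = q ∧ ⟪w₀, w₁⟫_ℝ < 0 := by
    obtain ⟨w, rfl⟩ := IsAlgClosed.exists_pow_nat_eq q (n := 2) (by norm_num)
    rcases lt_or_gt_of_ne (inner_sqrt_ne_zero h) with h1 | h1
    · exact ⟨w, rfl, h1⟩
    · exact ⟨-w, by ring, by rw [inner_neg_right]; linarith⟩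
  set a := ⟪w₀, w₁⟫_ℝ with ha'
  set b := ‖w₀‖ ^ 2 + ‖w₁‖ ^ 2 with hb
  have hb0 : 0 ≤ b := by positivity
  have hrad : 0 ≤ a ^ 2 + ν * (ν + b) := by positivity
  set C := (-a + √(a ^ 2 + ν * (ν + b))) / ν with hC
  have hroot : ν * C ^ 2 + 2 * a * C = ν + b := by
    have h1 : ν * C = -a + √(a ^ 2 + ν * (ν + b)) := by rw [hC]; field_simp
    have h2 : ν * (ν * C ^ 2 + 2 * a * C) = ν * (ν + b) := by
      have : ν * (ν * C ^ 2 + 2 * a * C) = (ν * C + a) ^ 2 - a ^ 2 := by ring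
      rw [this, h1, neg_add_cancel_comm, Real.sq_sqrt hrad]; ring
    exact mul_left_cancel₀ hν.ne' h2
  have hC1 : 1 < C := by
    rw [hC, lt_div_iff₀ hν, one_mul]
    have : ν ≤ √(a ^ 2 + ν * (ν + b)) := by
      apply Real.le_sqrt_of_sq_le
      nlinarith [sq_nonneg a, mul_nonneg hν.le hb0]
    linarith
  set S := √(C ^ 2 - 1) with hS
  have hSpos : 0 < S := Real.sqrt_pos.mpr (by nlinarith)
  have hS2 : S ^ 2 = C ^ 2 - 1 := Real.sq_sqrt (by nlinarith)
  have hsinh : Real.sinh (l * (Real.arsinh S / l)) = S := by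
    rw [mul_div_cancel₀ _ hl.ne', Real.sinh_arsinh]
  have hcosh : Real.cosh (l * (Real.arsinh S / l)) = C := by
    rw [mul_div_cancel₀ _ hl.ne', Real.cosh_arsinh, hS2, add_sub_cancel,
      Real.sqrt_sq (by linarith)]
  have hcurve : hypCurve l w₀ ((1 / S) • (w₁ - C • w₀)) (Real.arsinh S / l) = w₁ := by
    rw [hypCurve, hsinh, hcosh, smul_smul, mul_one_div_cancel hSpos.ne', one_smul]; abel
  refine ⟨(1 / S) • (w₁ - C • w₀), Real.arsinh S / l, ?_, ?_, by rw [hcurve], by rwa [hcurve]⟩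
  · exact div_pos (Real.arsinh_pos_iff.mpr hSpos) hl
  · rw [norm_smul, mul_pow, Real.norm_eq_abs, sq_abs, norm_sub_sq_real, norm_smul, mul_pow,
      real_inner_smul_right, real_inner_comm, ← ha', Real.norm_eq_abs, sq_abs, div_pow, hS2]
    have : C ^ 2 - 1 ≠ 0 := by nlinarith
    field_simp
    linear_combination (-1 : ℝ) * hroot

/-- Points on the boundary, with unit normals, between which the Kepler arc that passes close to
the center is the only inner arc of energy `2 l²` that starts nearly in the normal direction, with
a tangential velocity of at most `b`. -/
structure InnerGood (D : Set ℂ) (μ l b : ℝ) (p n q n' : ℂ) : Prop where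
  norm_eq : ‖n‖ = 1
  nonantipodal : 0 < ‖p‖ * ‖q‖ + ⟪p, q⟫_ℝ
  inside : ∀ e : ℂ, ‖e‖ ≤ inErr p q (μ / (2 * l ^ 2)) → ∀ k ∈ Ico (-1 : ℝ) 0, p + k • (p + e) ∈ D
  inside' : ∀ e : ℂ, ‖e‖ ≤ inErr q p (μ / (2 * l ^ 2)) → ∀ k ∈ Ico (-1 : ℝ) 0, q + k • (q + e) ∈ D
  inner_neg : ⟪inU p q (μ / (2 * l ^ 2)), n⟫_ℝ < 0
  inner_neg' : ⟪inU q p (μ / (2 * l ^ 2)), n'⟫_ℝ < 0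
  radial : 0 < ⟪p, n⟫_ℝ
  direct : ∃ c a₀ M : ℝ, 0 ≤ c ∧ 0 < a₀ ∧ ‖p‖ ≤ M ∧ ‖q‖ ≤ M ∧ a₀ ≤ lcA p q ∧
    c * ‖q - p‖ ≤ |⟪Complex.I * p, q⟫_ℝ| ∧
    (b * M / (2 * l) + |⟪Complex.I * p, n⟫_ℝ|) * (√M * (1 + M / a₀)) < c * √‖p‖

variable {D : Set ℂ} {μ l b : ℝ} {p n q n' : ℂ}

theorem InnerGood.left_ne_zero (h : InnerGood D μ l b p n q n') : p ≠ 0 := by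
  rintro rfl
  have := h.nonantipodal
  simp at this

/-- The Levi-Civita arc of `InnerGood` points. -/
theorem InnerGood.exists_hypCurve (h : InnerGood D μ l b p n q n') (hl : 0 < l) (hμ : 0 < μ)
    {w₀ : ℂ} (hw₀ : w₀ ^ 2 = p) :
    ∃ Θ : ℝ, 0 < Θ ∧
      ‖conj w₀ * inU p q (μ / (2 * l ^ 2)) / 2‖ ^ 2 = ‖w₀‖ ^ 2 + μ / (2 * l ^ 2) ∧
      hypCurve l w₀ (conj w₀ * inU p q (μ / (2 * l ^ 2)) / 2) Θ ^ 2 = q ∧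
      2 * hypCurve' l w₀ (conj w₀ * inU p q (μ / (2 * l ^ 2)) / 2) Θ /
        conj (hypCurve l w₀ (conj w₀ * inU p q (μ / (2 * l ^ 2)) / 2) Θ) =
          -inU q p (μ / (2 * l ^ 2)) ∧
      ∀ τ ∈ Ioo 0 Θ, hypCurve l w₀ (conj w₀ * inU p q (μ / (2 * l ^ 2)) / 2) τ ^ 2 ∈ D := by
  subst hw₀
  set ν := μ / (2 * l ^ 2) with hνdef
  have hν : 0 < ν := by positivity
  obtain ⟨d, Θ, hΘ, hd, hq, ha⟩ := exists_hypCurve_end hl hν h.nonantipodal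
  set w₁ := hypCurve l w₀ d Θ with hw₁
  have hCS : Real.cosh (l * Θ) ^ 2 = 1 + Real.sinh (l * Θ) ^ 2 := by
    rw [Real.cosh_sq]; ring
  have hS : 0 < Real.sinh (l * Θ) := Real.sinh_pos_iff.mpr (by positivity)
  have hC := Real.cosh_pos (l * Θ)
  have hw : w₁ = Real.cosh (l * Θ) • w₀ + Real.sinh (l * Θ) • d := rfl
  obtain ⟨hK, hU⟩ := inU_eq ha hw hCS hS hC hν hd
  have hw₀0 : w₀ ≠ 0 := by
    rintro rfl; exact h.left_ne_zero (by simp)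
  have hc0 : conj w₀ ≠ 0 := by simpa using hw₀0
  rw [hq] at hK hU
  have hdU : conj w₀ * inU (w₀ ^ 2) q ν / 2 = d := by rw [hU]; field_simp
  rw [hdU]
  have hw' := start_eq hw hCS
  have hd' := norm_end_sq hw hCS hd
  have ha' : ⟪w₁, w₀⟫_ℝ < 0 := by rwa [real_inner_comm]
  obtain ⟨hK', hU'⟩ := inU_eq ha' hw' hCS hS hC hν hd'
  rw [hq] at hK' hU'
  refine ⟨Θ, hΘ, hd, hq, ?_, ?_⟩
  · rw [hU', hypCurve']; ring
  · intro τ hτ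
    rcases le_total τ (Θ / 2) with hle | hle
    · obtain ⟨k, hk, e, he, heq⟩ := hypCurve_sq_eq (w₀ := w₀) (d := d) hl hν hΘ
        (by rw [← hw₁, hq]; exact hK) hτ.1 hle
      rw [heq]
      rw [← hw₁, hq] at he
      exact h.inside e he k hk
    -- The second half is the first half of the reversed curve, which starts at `w₁`.
    · have hrev : ∀ τ, hypCurve l w₁ (-(Real.sinh (l * Θ) • w₀ + Real.cosh (l * Θ) • d)) (Θ - τ) =
          hypCurve l w₀ d τ := by
        intro τ
        have h1 := hypCurve_add (l := l) (w₀ := w₀) (d := d) Θ (τ - Θ)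
        rw [add_sub_cancel, ← neg_sub Θ τ, mul_neg, Real.cosh_neg, Real.sinh_neg] at h1
        rw [h1, hypCurve, ← hw₁, smul_neg, neg_smul]; rfl
      have hend : hypCurve l w₁ (-(Real.sinh (l * Θ) • w₀ + Real.cosh (l * Θ) • d)) Θ = w₀ := by
        have := hrev 0
        rw [sub_zero] at this
        rw [this]; simp [hypCurve]
      obtain ⟨k, hk, e, he, heq⟩ := hypCurve_sq_eq (w₀ := w₁)
        (d := -(Real.sinh (l * Θ) • w₀ + Real.cosh (l * Θ) • d)) (τ := Θ - τ) hl hν hΘ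
        (by rw [hend, hq]; exact hK') (by linarith [hτ.2]) (by linarith)
      rw [hrev] at heq
      rw [heq, hq]
      rw [hend, hq] at he
      exact h.inside' e he k hk

theorem InnerGood.norm_inU_sq (h : InnerGood D μ l b p n q n') (hl : 0 < l) (hμ : 0 < μ) :
    ‖inU p q (μ / (2 * l ^ 2))‖ ^ 2 = 4 * (1 + μ / (2 * l ^ 2) / ‖p‖) := by
  obtain ⟨w₀, hw₀⟩ := IsAlgClosed.exists_pow_nat_eq p (n := 2) (by norm_num)
  obtain ⟨Θ, -, h1, -⟩ := h.exists_hypCurve hl hμ hw₀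
  have hp := norm_pos_iff.mpr h.left_ne_zero
  have hpw : ‖p‖ = ‖w₀‖ ^ 2 := by rw [← hw₀, norm_pow]
  rw [norm_div, norm_mul, RCLike.norm_conj, div_pow, mul_pow, ← hpw] at h1
  simp only [Complex.norm_ofNat] at h1
  generalize ‖inU p q (μ / (2 * l ^ 2))‖ = u at h1 ⊢
  field_simp
  field_simp at h1
  linear_combination 2 * h1

variable {B : Billiard}

theorem InnerGood.exists_arc (h : InnerGood B.D B.μ l b p n q n') (hl : 0 < l) (hμ : 0 < B.μ) :
    ∃ (z v : ℝ → ℂ) (T : ℝ), B.IsInnerArc z v T ∧ z 0 = p ∧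
      v 0 = l • inU p q (B.μ / (2 * l ^ 2)) ∧ z T = q ∧
      v T = -(l • inU q p (B.μ / (2 * l ^ 2))) := by
  obtain ⟨w₀, hw₀⟩ := IsAlgClosed.exists_pow_nat_eq p (n := 2) (by norm_num)
  obtain ⟨Θ, hΘ, hd, hq, hU', hin⟩ := h.exists_hypCurve hl hμ hw₀
  obtain ⟨z, v, T, harc, hz0, hv0, hzT, hvT⟩ := exists_isInnerArc hl hμ hd hΘ hin
  have hc0 : conj w₀ ≠ 0 := by
    have : w₀ ≠ 0 := by
      rintro rfl; exact h.left_ne_zero (by rw [← hw₀]; simp)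
    simpa using this
  refine ⟨z, v, T, harc, by rw [hz0, hw₀], ?_, by rw [hzT, hq], ?_⟩
  · rw [hv0, Complex.real_smul]; field_simp
  · rw [hvT, ← smul_neg, ← hU', Complex.real_smul]; ring

/-- Equal initial velocities mean the same Levi-Civita curve; if one end came earlier, it would be
an interior point of the other arc and so lie in `D`. -/
theorem InnerGood.end_eq {q₂ n₂ : ℂ} (h : InnerGood D μ l b p n q n')
    (h₂ : InnerGood D μ l b p n q₂ n₂) (hl : 0 < l) (hμ : 0 < μ)
    (hU : inU p q (μ / (2 * l ^ 2)) = inU p q₂ (μ / (2 * l ^ 2))) (hq : q ∉ D) (hq₂ : q₂ ∉ D) :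
    q = q₂ := by
  obtain ⟨w₀, hw₀⟩ := IsAlgClosed.exists_pow_nat_eq p (n := 2) (by norm_num)
  obtain ⟨Θ, hΘ, -, e1, -, hin⟩ := h.exists_hypCurve hl hμ hw₀
  obtain ⟨Θ₂, hΘ₂, -, e2, -, hin₂⟩ := h₂.exists_hypCurve hl hμ hw₀
  rw [← hU] at e2 hin₂
  rcases lt_trichotomy Θ Θ₂ with hlt | heq | hlt
  · exact absurd (e1 ▸ hin₂ Θ ⟨hΘ, hlt⟩) hq
  · rw [← e1, ← e2, heq]
  · exact absurd (e2 ▸ hin Θ₂ ⟨hΘ₂, hlt⟩) hq₂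

theorem inner_I_mul_eq (n u : ℂ) (hn : ‖n‖ = 1) :
    u = ⟪u, Complex.I * n⟫_ℝ • (Complex.I * n) + ⟪u, n⟫_ℝ • n := by
  have h1 : n.re ^ 2 + n.im ^ 2 = 1 := by
    have : ‖n‖ ^ 2 = 1 := by rw [hn]; norm_num
    rw [← Complex.normSq_eq_norm_sq, Complex.normSq_apply] at this
    linarith
  apply Complex.ext
  · simp [Complex.inner]
    linear_combination (-u.re) * h1
  · simp [Complex.inner]
    linear_combination (-u.im) * h1

theorem eq_smul_of_inner_eq_zero {q u : ℂ} (hq : q ≠ 0) (h : ⟪Complex.I * q, u⟫_ℝ = 0) :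
    u = (⟪q, u⟫_ℝ / ‖q‖ ^ 2) • q := by
  have hq2 : ‖q‖ ^ 2 = q.re * q.re + q.im * q.im := by
    rw [← Complex.normSq_eq_norm_sq, Complex.normSq_apply]
  have hq0 : q.re * q.re + q.im * q.im ≠ 0 := by
    rw [← hq2]
    have := norm_ne_zero_iff.mpr hq
    positivity
  have hin : ⟪q, u⟫_ℝ = q.re * u.re + q.im * u.im := by
    rw [Complex.inner]; simp; ring
  simp only [Complex.inner] at h
  simp at h
  rw [hin, hq2]
  apply Complex.ext
  · rw [Complex.smul_re, smul_eq_mul, div_mul_eq_mul_div, eq_div_iff hq0]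
    linear_combination (-q.im) * h
  · rw [Complex.smul_im, smul_eq_mul, div_mul_eq_mul_div, eq_div_iff hq0]
    linear_combination q.re * h

/-- The initial velocity of an ejection-collision arc. -/
theorem InnerGood.radial_velocity_eq (h : InnerGood D μ l b q n q n') (hl : 0 < l) (hμ : 0 < μ)
    {u : ℂ} (hu : ⟪Complex.I * q, u⟫_ℝ = 0) (hen : ‖u‖ ^ 2 / 2 - μ / ‖q‖ = 2 * l ^ 2)
    (hneg : ⟪u, n⟫_ℝ < 0) : u = l • inU q q (μ / (2 * l ^ 2)) := by
  have hP : 0 < ‖q‖ := norm_pos_iff.mpr h.left_ne_zero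
  have hn2 := h.norm_inU_sq hl hμ
  set ν := μ / (2 * l ^ 2) with hνdef
  have hν : 0 < ν := by positivity
  have hv := eq_smul_of_inner_eq_zero h.left_ne_zero hu
  set s := ⟪q, u⟫_ℝ / ‖q‖ ^ 2 with hs
  have hsneg : s < 0 := by
    rw [hv, real_inner_smul_left] at hneg
    by_contra hno
    push Not at hno
    linarith [mul_nonneg hno h.radial.le]
  -- For coincident ends `lcQ = -q`, so `inU q q ν` is a non-positive multiple of `q`; the energy
  -- fixes its length, hence it is the velocity of the ejection-collision arc.
  have hA : lcA q q = ‖q‖ := by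
    rw [lcA, real_inner_self_eq_norm_sq, ← Real.sqrt_sq hP.le]
    congr 1
    rw [Real.sqrt_sq hP.le]; ring
  have hQ : lcQ q q = -q := by
    have : (‖q‖ : ℂ) ≠ 0 := by exact_mod_cast hP.ne'
    rw [lcQ, hA]; simp only [Complex.real_smul]; push_cast; field_simp; ring
  have hKpos : 0 < lcK q q ν := by
    rw [lcK, hA]
    have := Real.sqrt_nonneg (‖q‖ ^ 2 + ν * (ν + ‖q‖ + ‖q‖))
    linarith
  obtain ⟨r, hr, hr2⟩ : ∃ r : ℝ, r ≤ 0 ∧ inU q q ν = r • q := by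
    refine ⟨-(2 / (‖q‖ * √(lcK q q ν ^ 2 - ν ^ 2)) * (ν + lcK q q ν)), ?_, ?_⟩
    · rw [neg_nonpos]; positivity
    · rw [inU, hQ]; simp only [Complex.real_smul]; push_cast; ring
  rw [hr2, norm_smul, mul_pow, Real.norm_eq_abs, sq_abs] at hn2
  have hn1 : s ^ 2 * ‖q‖ ^ 2 = 4 * l ^ 2 * (1 + ν / ‖q‖) := by
    rw [hv, norm_smul, mul_pow, Real.norm_eq_abs, sq_abs] at hen
    have : 4 * l ^ 2 * (1 + ν / ‖q‖) = 4 * l ^ 2 + 2 * (μ / ‖q‖) := by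
      rw [hνdef]; field_simp; ring
    rw [this]; linarith
  have hsr : s ^ 2 = (l * r) ^ 2 := by
    have h2 : (s ^ 2 - (l * r) ^ 2) * ‖q‖ ^ 2 = 0 := by
      linear_combination hn1 - l ^ 2 * hn2
    have h3 := (mul_eq_zero.mp h2).resolve_right (by positivity)
    linarith
  have hlr : l * r ≤ 0 := mul_nonpos_of_nonneg_of_nonpos hl.le hr
  have : s = l * r := by
    rcases sq_eq_sq_iff_eq_or_eq_neg.mp hsr with h4 | h4
    · exact h4
    · linarith
  rw [hv, hr2, smul_smul, this]

-- An arc with collision is radial and returns to its start. Without collision it is a hyperbolic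
-- curve: if the square roots at its ends have negative inner product, `inU_eq` identifies it; the
-- positive sign is excluded by angular momentum.
set_option maxHeartbeats 1000000 in
theorem InnerGood.velocity_eq (h : InnerGood B.D B.μ l b p n q n') (hl : 0 < l) (hμ : 0 < B.μ)
    {z v : ℝ → ℂ} {T : ℝ} (harc : B.IsInnerArc z v T) (hz0 : z 0 = p) (hzT : z T = q)
    (hp : p ∉ B.D) (hq : q ∉ B.D) (hq0 : q ≠ 0)
    (hen : ‖v 0‖ ^ 2 / 2 - B.μ / ‖p‖ = 2 * l ^ 2)
    (hneg : ⟪v 0, n⟫_ℝ < 0) (htan : |⟪v 0, Complex.I * n⟫_ℝ| ≤ b) :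
    v 0 = l • inU p q (B.μ / (2 * l ^ 2)) ∧ v T = -(l • inU q p (B.μ / (2 * l ^ 2))) := by
  have hp0 := h.left_ne_zero
  have hP : 0 < ‖p‖ := norm_pos_iff.mpr hp0
  set ν := B.μ / (2 * l ^ 2) with hνdef
  have hν : 0 < ν := by positivity
  have hmem0 : (0 : ℝ) ∈ Icc 0 T := ⟨le_rfl, harc.pos.le⟩
  by_cases hcol : ∃ c ∈ Icc 0 T, z c = 0
  · obtain ⟨c, hc, hzc⟩ := hcol
    obtain ⟨e1, e2, e3⟩ := harc.of_collision (by rwa [hz0]) (by rwa [hzT]) (by rwa [hz0])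
      (by rwa [hzT]) hc hzc
    have hqp : q = p := by rw [← hzT, e1, hz0]
    subst hqp
    rw [hz0] at e3
    have key := h.radial_velocity_eq hl hμ e3 hen hneg
    exact ⟨key, by rw [e2, key]⟩
  · push Not at hcol
    obtain ⟨w₀, hw₀⟩ := IsAlgClosed.exists_pow_nat_eq p (n := 2) (by norm_num)
    obtain ⟨Θ, hΘ, hqΘ, hvT⟩ := kepler_eq_hypCurve hl harc.pos
      (fun s hs => harc.deriv_pos s hs (hcol s hs)) (fun s hs => harc.deriv_vel s hs (hcol s hs))
      hcol (by rw [hz0]; exact hen) (w₀ := w₀) (by rw [hz0, hw₀])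
    set d := conj w₀ * v 0 / (2 * l) with hd
    set w₁ := hypCurve l w₀ d Θ with hw₁
    rw [hzT] at hqΘ
    have hpw : ‖p‖ = ‖w₀‖ ^ 2 := by rw [← hw₀, norm_pow]
    have hqw : ‖q‖ = ‖w₁‖ ^ 2 := by rw [← hqΘ, norm_pow]
    have hw₀0 : w₀ ≠ 0 := by
      rintro rfl; exact hp0 (by rw [← hw₀]; simp)
    have hc0 : conj w₀ ≠ 0 := by simpa using hw₀0
    have hlC : (l : ℂ) ≠ 0 := by exact_mod_cast hl.ne'
    have hdn : ‖d‖ = ‖w₀‖ * ‖v 0‖ / (2 * l) := by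
      rw [hd, norm_div, norm_mul, norm_mul, RCLike.norm_conj, Complex.norm_real,
        Real.norm_eq_abs, abs_of_pos hl, Complex.norm_ofNat]
    have hd2 : ‖d‖ ^ 2 = ‖w₀‖ ^ 2 + ν := by
      have hv2 : ‖v 0‖ ^ 2 = 4 * l ^ 2 + 2 * (B.μ / ‖p‖) := by linarith
      rw [hdn, div_pow, mul_pow, hv2, hpw, hνdef]
      have := norm_ne_zero_iff.mpr hw₀0
      field_simp
      ring
    have hCS : Real.cosh (l * Θ) ^ 2 = 1 + Real.sinh (l * Θ) ^ 2 := by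
      rw [Real.cosh_sq]; ring
    have hS : 0 < Real.sinh (l * Θ) := Real.sinh_pos_iff.mpr (by positivity)
    have hC := Real.cosh_pos (l * Θ)
    have hw : w₁ = Real.cosh (l * Θ) • w₀ + Real.sinh (l * Θ) • d := rfl
    have hna := h.nonantipodal
    rw [← hw₀, ← hqΘ] at hna
    rcases lt_or_gt_of_ne (inner_sqrt_ne_zero hna) with ha | ha
    · obtain ⟨-, hU⟩ := inU_eq ha hw hCS hS hC hν hd2
      have hw' := start_eq hw hCS
      have hd' := norm_end_sq hw hCS hd2
      have ha' : ⟪w₁, w₀⟫_ℝ < 0 := by rwa [real_inner_comm]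
      obtain ⟨-, hU'⟩ := inU_eq ha' hw' hCS hS hC hν hd'
      rw [hqΘ, hw₀] at hU hU'
      constructor
      · rw [hU, hd, Complex.real_smul]; field_simp
      · rw [hU', hvT, hypCurve']; simp only [Complex.real_smul]; ring
    -- A direct arc has angular momentum bounded below relative to its speed, by `direct_arc_bound`.
    -- Here the tangential velocity is at most `b` and the speed at least `2 * l`, so the ratio is
    -- at most `b M / (2l) + |⟪I p, n⟫|`, which the field `direct` makes too small.
    · exfalso
      obtain ⟨c, a₀, M, hc, ha₀, hpM, hqM, haA, him, hlt⟩ := h.direct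
      have hA : lcA p q = ⟪w₀, w₁⟫_ℝ := by rw [← hw₀, ← hqΘ, lcA_sq_sq, abs_of_pos ha]
      have hbd := direct_arc_bound ha hw hCS hS hC hν hd2 (hpw ▸ hpM) (hqw ▸ hqM) ha₀
        (hA ▸ haA) hc (by rw [hw₀, hqΘ]; exact him)
      have hM : 0 ≤ M := hP.le.trans hpM
      have hIm : ⟪Complex.I * p, v 0⟫_ℝ = 2 * l * ⟪Complex.I * w₀, d⟫_ℝ := by
        have hv0 : v 0 = 2 * l * d / conj w₀ := by rw [hd]; field_simp
        have h1 : conj w₀ * v 0 = 2 * l * d := by rw [hv0]; field_simp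
        have h2 : ⟪Complex.I * p, v 0⟫_ℝ = ⟪Complex.I * w₀, conj w₀ * v 0⟫_ℝ := by
          rw [← hw₀]; simp only [Complex.inner]; simp [pow_two]; ring
        rw [h2, h1]
        simp only [Complex.inner]; simp; ring
      have hvpos : 2 * l ≤ ‖v 0‖ := by
        have hv2 : ‖v 0‖ ^ 2 = 4 * l ^ 2 + 2 * (B.μ / ‖p‖) := by linarith
        have : 0 < B.μ / ‖p‖ := by positivity
        nlinarith [norm_nonneg (v 0)]
      have hb0 : 0 ≤ b := (abs_nonneg _).trans htan
      have hup : |⟪Complex.I * p, v 0⟫_ℝ| ≤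
          ‖v 0‖ * (b * M / (2 * l) + |⟪Complex.I * p, n⟫_ℝ|) := by
        rw [inner_I_mul_eq n (v 0) h.norm_eq, inner_add_right, real_inner_smul_right,
          real_inner_smul_right]
        refine (abs_add_le _ _).trans ?_
        rw [← inner_I_mul_eq n (v 0) h.norm_eq, mul_add, abs_mul, abs_mul]
        have t1 : |⟪Complex.I * p, Complex.I * n⟫_ℝ| ≤ M := by
          refine (abs_real_inner_le_norm _ _).trans ?_
          rw [norm_mul, norm_mul, Complex.norm_I, h.norm_eq]; linarith
        have t2 : |⟪v 0, n⟫_ℝ| ≤ ‖v 0‖ := by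
          refine (abs_real_inner_le_norm _ _).trans ?_
          rw [h.norm_eq, mul_one]
        have t3 : b * M ≤ ‖v 0‖ * (b * M / (2 * l)) := by
          rw [mul_div_assoc', le_div_iff₀ (by positivity)]
          nlinarith [mul_nonneg hb0 hM]
        have t4 : |⟪v 0, Complex.I * n⟫_ℝ| * |⟪Complex.I * p, Complex.I * n⟫_ℝ| ≤ b * M := by
          gcongr
        have t5 : |⟪v 0, n⟫_ℝ| * |⟪Complex.I * p, n⟫_ℝ| ≤ ‖v 0‖ * |⟪Complex.I * p, n⟫_ℝ| := by
          gcongr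
        linarith
      rw [hIm, abs_mul, abs_of_pos (by positivity : 0 < 2 * l)] at hup
      have hsqrt : √‖p‖ = ‖w₀‖ := by rw [hpw, Real.sqrt_sq (norm_nonneg _)]
      rw [hsqrt] at hlt
      have hF : 0 ≤ √M * (1 + M / a₀) := by positivity
      have hv0 : 0 < ‖v 0‖ := by linarith
      have f1 : c * (‖w₀‖ * ‖v 0‖) ≤
          2 * l * |⟪Complex.I * w₀, d⟫_ℝ| * (√M * (1 + M / a₀)) := by
        rw [hdn] at hbd
        have : c * (‖w₀‖ * ‖v 0‖) = 2 * l * (c * (‖w₀‖ * ‖v 0‖ / (2 * l))) := by field_simp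
        rw [this, mul_assoc (2 * l)]
        gcongr
      have f2 := mul_le_mul_of_nonneg_right hup hF
      have f3 := mul_lt_mul_of_pos_left hlt hv0
      linarith

end RefractionBilliard

/-! ### The inner arcs in the limit of infinite energy. -/

namespace RefractionBilliard
open scoped InnerProductSpace ComplexConjugate

section Smooth

variable {w : ℂ × ℂ × ℝ}

theorem ne_zero_of_nonantipodal {p q : ℂ} (h : 0 < ‖p‖ * ‖q‖ + ⟪p, q⟫_ℝ) : p ≠ 0 ∧ q ≠ 0 := by
  constructor <;> rintro rfl <;> simp at h

theorem contDiffAt_lcA (h : 0 < ‖w.1‖ * ‖w.2.1‖ + ⟪w.1, w.2.1⟫_ℝ) :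
    ContDiffAt ℝ 1 (fun z : ℂ × ℂ × ℝ => lcA z.1 z.2.1) w := by
  obtain ⟨hp, hq⟩ := ne_zero_of_nonantipodal h
  have h1 : ContDiffAt ℝ 1 (fun z : ℂ × ℂ × ℝ => z.2.1) w := contDiffAt_snd.fst
  exact ((((contDiffAt_fst.norm ℝ hp).mul (h1.norm ℝ hq)).add
    (contDiffAt_fst.inner ℝ h1)).div_const 2).sqrt (by positivity)

theorem lcA_pos {p q : ℂ} (h : 0 < ‖p‖ * ‖q‖ + ⟪p, q⟫_ℝ) : 0 < lcA p q :=
  Real.sqrt_pos.mpr (by positivity)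

theorem contDiffAt_lcK (h : 0 < ‖w.1‖ * ‖w.2.1‖ + ⟪w.1, w.2.1⟫_ℝ) (hw : w.2.2 = 0) :
    ContDiffAt ℝ 1 (fun z : ℂ × ℂ × ℝ => lcK z.1 z.2.1 z.2.2) w := by
  obtain ⟨hp, hq⟩ := ne_zero_of_nonantipodal h
  have h1 : ContDiffAt ℝ 1 (fun z : ℂ × ℂ × ℝ => z.2.1) w := contDiffAt_snd.fst
  have h2 : ContDiffAt ℝ 1 (fun z : ℂ × ℂ × ℝ => z.2.2) w := contDiffAt_snd.snd
  have hA := contDiffAt_lcA h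
  refine hA.add (((hA.pow 2).add (h2.mul ((h2.add (contDiffAt_fst.norm ℝ hp)).add
    (h1.norm ℝ hq)))).sqrt ?_)
  have := lcA_pos h
  simp only [hw, zero_mul, add_zero]
  positivity

theorem lcK_zero (p q : ℂ) : lcK p q 0 = 2 * lcA p q := by
  rw [lcK, zero_mul, add_zero, Real.sqrt_sq (by exact Real.sqrt_nonneg _), two_mul]

/-- The denominator stays away from zero at `ν = 0`, where `lcK² - ν²` equals `4 lcA² > 0`. Infinite
energy is therefore a regular point of the parameter. -/
theorem contDiffAt_inU (h : 0 < ‖w.1‖ * ‖w.2.1‖ + ⟪w.1, w.2.1⟫_ℝ) (hw : w.2.2 = 0) :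
    ContDiffAt ℝ 1 (fun z : ℂ × ℂ × ℝ => inU z.1 z.2.1 z.2.2) w := by
  obtain ⟨hp, hq⟩ := ne_zero_of_nonantipodal h
  have h1 : ContDiffAt ℝ 1 (fun z : ℂ × ℂ × ℝ => z.2.1) w := contDiffAt_snd.fst
  have h2 : ContDiffAt ℝ 1 (fun z : ℂ × ℂ × ℝ => z.2.2) w := contDiffAt_snd.snd
  have hA := contDiffAt_lcA h
  have hK := contDiffAt_lcK h hw
  have hpos := lcA_pos h
  have hQ : ContDiffAt ℝ 1 (fun z : ℂ × ℂ × ℝ => lcQ z.1 z.2.1) w := by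
    unfold lcQ
    exact ((contDiffAt_const.div (contDiffAt_const.mul hA) (by positivity)).smul
      (((h1.norm ℝ hq).smul contDiffAt_fst).add ((contDiffAt_fst.norm ℝ hp).smul h1))).neg
  have hrad : 0 < lcK w.1 w.2.1 w.2.2 ^ 2 - w.2.2 ^ 2 := by
    rw [hw, lcK_zero]; ring_nf; positivity
  have hn : 0 < ‖w.1‖ := norm_pos_iff.mpr hp
  unfold inU
  exact (contDiffAt_const.div ((contDiffAt_fst.norm ℝ hp).mul
    (((hK.pow 2).sub (h2.pow 2)).sqrt hrad.ne')) (mul_pos hn (Real.sqrt_pos.mpr hrad)).ne').smul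
    ((h2.smul hQ).sub (hK.smul contDiffAt_fst))

/-- At infinite energy the arc heads straight for the center, whatever its other end. -/
theorem inU_zero {p q : ℂ} (h : 0 < ‖p‖ * ‖q‖ + ⟪p, q⟫_ℝ) : inU p q 0 = -((2 / ‖p‖) • p) := by
  have hA := lcA_pos h
  have hp : 0 < ‖p‖ := norm_pos_iff.mpr (ne_zero_of_nonantipodal h).1
  have : √((2 * lcA p q) ^ 2 - 0 ^ 2) = 2 * lcA p q := by
    rw [zero_pow two_ne_zero, sub_zero, Real.sqrt_sq (by positivity)]
  rw [inU, lcK_zero, zero_smul, zero_sub, smul_neg, smul_smul, this]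
  congr 2
  field_simp

theorem continuousAt_inErr (h : 0 < ‖w.1‖ * ‖w.2.1‖ + ⟪w.1, w.2.1⟫_ℝ) (hw : w.2.2 = 0) :
    ContinuousAt (fun z : ℂ × ℂ × ℝ => inErr z.1 z.2.1 z.2.2) w := by
  unfold inErr
  have hK := (contDiffAt_lcK h hw).continuousAt
  have hpos := lcA_pos h
  refine ContinuousAt.mul (by fun_prop) (ContinuousAt.sqrt (ContinuousAt.div (by fun_prop)
    (ContinuousAt.add (by fun_prop) hK) ?_))
  simp only [hw, lcK_zero]
  positivity

theorem inErr_zero (p q : ℂ) : inErr p q 0 = 0 := by simp [inErr]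

end Smooth

section Domain

variable {D : Set ℂ} {γ : ℝ → ℂ} {L : ℝ}

theorem nonantipodal_iff {ξ ξ' : ℝ} :
    0 < ‖γ ξ‖ * ‖γ ξ'‖ + ⟪γ ξ, γ ξ'⟫_ℝ ↔ ¬ Antipodal γ ξ ξ' := by
  have h1 : -(‖γ ξ‖ * ‖γ ξ'‖) ≤ ⟪γ ξ, γ ξ'⟫_ℝ :=
    (abs_le.mp (abs_real_inner_le_norm (γ ξ) (γ ξ'))).1
  have h2 := inner_eq_norm_mul_iff_real (x := -γ ξ) (y := γ ξ')
  rw [inner_neg_left, norm_neg] at h2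
  rw [← not_iff_not, not_not, Antipodal, mem_segment_iff_sameRay, zero_sub, sub_zero,
    sameRay_iff_norm_smul_eq, norm_neg, eq_comm, ← h2]
  constructor
  · intro h; linarith
  · intro h; linarith

theorem Antipodal.symm {ξ ξ' : ℝ} (h : Antipodal γ ξ ξ') : Antipodal γ ξ' ξ := by
  rwa [Antipodal, segment_symm]

/-- Two central configurations on the same half-line coincide. -/
theorem IsCentralConfiguration.inner_I_mul_ne_zero (hD : IsDomainWithBoundary D γ L) {ξ ξ' : ℝ}
    (h : IsCentralConfiguration γ ξ) (hna : 0 < ‖γ ξ‖ * ‖γ ξ'‖ + ⟪γ ξ, γ ξ'⟫_ℝ)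
    (hne : γ ξ ≠ γ ξ') : ⟪Complex.I * γ ξ, γ ξ'⟫_ℝ ≠ 0 := by
  intro h0
  have hq := eq_smul_of_inner_eq_zero (hD.ne_zero ξ) h0
  set s := ⟪γ ξ, γ ξ'⟫_ℝ / ‖γ ξ‖ ^ 2
  rcases le_or_gt 0 s with hs | hs
  · exact hne ((h.2 s hs ⟨ξ', hq⟩).symm.trans hq.symm)
  · rw [hq, norm_smul, real_inner_smul_right, real_inner_self_eq_norm_sq, Real.norm_eq_abs,
      abs_of_neg hs] at hna
    exact hna.ne (by ring)

/-- For a single center the curve is orthogonal to the radius, so chords are almost angular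
displacements. For different centers star-convexity and non-antipodality make the two positions
linearly independent. -/
theorem IsCentralConfiguration.eventually_separated (hD : IsDomainWithBoundary D γ L) {ξ ξ' : ℝ}
    (h : IsCentralConfiguration γ ξ) (hna : 0 < ‖γ ξ‖ * ‖γ ξ'‖ + ⟪γ ξ, γ ξ'⟫_ℝ)
    (hsep : ξ = ξ' ∨ γ ξ ≠ γ ξ') :
    ∃ c > 0, ∀ᶠ w : ℝ × ℝ in 𝓝 (ξ, ξ'),
      c * ‖γ w.2 - γ w.1‖ ≤ |⟪Complex.I * γ w.1, γ w.2⟫_ℝ| := by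
  have hcγ : Continuous γ := hD.contDiff.continuous
  have hP : 0 < ‖γ ξ‖ := norm_pos_iff.mpr (hD.ne_zero ξ)
  rcases hsep with rfl | hne
  · refine ⟨‖γ ξ‖ / 8, by positivity, ?_⟩
    have h1 := hD.eventually_chord ξ (show (0 : ℝ) < 1 / 8 by norm_num)
    have h2 : ∀ᶠ w : ℝ × ℝ in 𝓝 (ξ, ξ), ‖γ w.1‖ < 2 * ‖γ ξ‖ :=
      ContinuousAt.eventually_lt (Continuous.continuousAt (by fun_prop)) continuousAt_const
        (by change ‖γ ξ‖ < 2 * ‖γ ξ‖; linarith)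
    have h3 : ∀ᶠ w : ℝ × ℝ in 𝓝 (ξ, ξ), ‖γ ξ‖ / 2 < ⟪Complex.I * γ w.1, deriv γ ξ⟫_ℝ := by
      apply continuousAt_const.eventually_lt (Continuous.continuousAt (by fun_prop))
      change ‖γ ξ‖ / 2 < ⟪Complex.I * γ ξ, deriv γ ξ⟫_ℝ
      have e : Complex.I * γ ξ = ‖γ ξ‖ • deriv γ ξ := by
        conv_lhs => rw [h.normal_eq hD]
        rw [Complex.real_smul]
        linear_combination (-(‖γ ξ‖ : ℂ) * deriv γ ξ) * Complex.I_sq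
      rw [e, real_inner_smul_left, real_inner_self_eq_norm_sq, hD.unit_speed]
      linarith
    filter_upwards [h1, h2, h3] with w h1 h2 h3
    set g := γ w.2 - γ w.1 with hg
    set d := w.2 - w.1
    have e1 : ⟪Complex.I * γ w.1, γ w.2⟫_ℝ =
        d * ⟪Complex.I * γ w.1, deriv γ ξ⟫_ℝ + ⟪Complex.I * γ w.1, g - d • deriv γ ξ⟫_ℝ := by
      have e0 : ⟪Complex.I * γ w.1, γ w.1⟫_ℝ = 0 := by
        simp only [Complex.inner]; simp; ring
      rw [hg, inner_sub_right, inner_sub_right, e0, real_inner_smul_right]; ring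
    have e2 : |⟪Complex.I * γ w.1, g - d • deriv γ ξ⟫_ℝ| ≤ 2 * ‖γ ξ‖ * (1 / 8 * |d|) := by
      refine (abs_real_inner_le_norm _ _).trans ?_
      rw [norm_mul, Complex.norm_I, one_mul]
      gcongr
    have e3 : ‖g‖ ≤ |d| + 1 / 8 * |d| := by
      have := norm_sub_norm_le g (d • deriv γ ξ)
      rw [norm_smul, hD.unit_speed, mul_one, Real.norm_eq_abs] at this
      linarith
    have e4 : |d| * (‖γ ξ‖ / 2) ≤ |d * ⟪Complex.I * γ w.1, deriv γ ξ⟫_ℝ| := by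
      rw [abs_mul, abs_of_pos (a := ⟪Complex.I * γ w.1, deriv γ ξ⟫_ℝ) (by linarith)]
      gcongr
    have e5 := abs_sub_abs_le_abs_add (d * ⟪Complex.I * γ w.1, deriv γ ξ⟫_ℝ)
      ⟪Complex.I * γ w.1, g - d • deriv γ ξ⟫_ℝ
    rw [e1]
    have e6 : ‖γ ξ‖ / 8 * ‖g‖ ≤ ‖γ ξ‖ / 8 * (|d| + 1 / 8 * |d|) := by gcongr
    have e7 : 0 ≤ ‖γ ξ‖ * |d| := by positivity
    linarith
  · have h0 := abs_pos.mpr (h.inner_I_mul_ne_zero hD hna hne)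
    have hn : 0 < ‖γ ξ' - γ ξ‖ := norm_pos_iff.mpr (sub_ne_zero.mpr hne.symm)
    refine ⟨|⟪Complex.I * γ ξ, γ ξ'⟫_ℝ| / (2 * ‖γ ξ' - γ ξ‖), by positivity, ?_⟩
    have : ∀ᶠ w : ℝ × ℝ in 𝓝 (ξ, ξ'), |⟪Complex.I * γ ξ, γ ξ'⟫_ℝ| / (2 * ‖γ ξ' - γ ξ‖) *
        ‖γ w.2 - γ w.1‖ < |⟪Complex.I * γ w.1, γ w.2⟫_ℝ| := by
      apply ContinuousAt.eventually_lt (Continuous.continuousAt (by fun_prop))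
        (Continuous.continuousAt (by fun_prop))
      change |⟪Complex.I * γ ξ, γ ξ'⟫_ℝ| / (2 * ‖γ ξ' - γ ξ‖) * ‖γ ξ' - γ ξ‖ <
        |⟪Complex.I * γ ξ, γ ξ'⟫_ℝ|
      field_simp
      linarith
    exact this.mono fun w hw => hw.le

/-- With `l = 1/δ` and `ν = μ δ²/2` all quantities extend continuously to `δ = 0`. There the errors
vanish, `inU` points to the center, and the left side of the last inequality of `direct` is zero
because the normal is radial. -/
theorem IsCentralConfiguration.eventually_innerGood (hD : IsDomainWithBoundary D γ L) {ξ ξ' : ℝ}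
    (h : IsCentralConfiguration γ ξ) (h' : IsCentralConfiguration γ ξ')
    (hna : 0 < ‖γ ξ‖ * ‖γ ξ'‖ + ⟪γ ξ, γ ξ'⟫_ℝ) (hsep : ξ = ξ' ∨ γ ξ ≠ γ ξ') (μ b : ℝ) :
    ∀ᶠ w : ℝ × ℝ × ℝ in 𝓝 (ξ, ξ', 0), InnerGood D μ w.2.2⁻¹ b
      (γ w.1) (-Complex.I * deriv γ w.1) (γ w.2.1) (-Complex.I * deriv γ w.2.1) := by
  have hcγ : Continuous γ := hD.contDiff.continuous
  have hct := hD.continuous_deriv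
  have hP : 0 < ‖γ ξ‖ := norm_pos_iff.mpr (hD.ne_zero ξ)
  have hP' : 0 < ‖γ ξ'‖ := norm_pos_iff.mpr (hD.ne_zero ξ')
  have hna' : 0 < ‖γ ξ'‖ * ‖γ ξ‖ + ⟪γ ξ', γ ξ⟫_ℝ := by rwa [mul_comm, real_inner_comm]
  -- Also true at `δ = 0`, with `0⁻¹ = 0` and division by zero giving zero.
  have hν : ∀ δ : ℝ, μ / (2 * δ⁻¹ ^ 2) = μ * δ ^ 2 / 2 := by
    intro δ; rw [inv_pow, ← div_eq_mul_inv, div_div_eq_mul_div]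
  have hg : Continuous (fun w : ℝ × ℝ × ℝ => (γ w.1, γ w.2.1, μ * w.2.2 ^ 2 / 2)) := by fun_prop
  have hg' : Continuous (fun w : ℝ × ℝ × ℝ => (γ w.2.1, γ w.1, μ * w.2.2 ^ 2 / 2)) := by fun_prop
  have hz : μ * (0 : ℝ) ^ 2 / 2 = 0 := by ring
  have cU : ContinuousAt (fun w : ℝ × ℝ × ℝ => inU (γ w.1) (γ w.2.1) (μ * w.2.2 ^ 2 / 2))
      (ξ, ξ', 0) :=
    ContinuousAt.comp (g := fun z : ℂ × ℂ × ℝ => inU z.1 z.2.1 z.2.2)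
      (f := fun w : ℝ × ℝ × ℝ => (γ w.1, γ w.2.1, μ * w.2.2 ^ 2 / 2)) (x := (ξ, ξ', 0))
      (contDiffAt_inU hna hz).continuousAt hg.continuousAt
  have cU' : ContinuousAt (fun w : ℝ × ℝ × ℝ => inU (γ w.2.1) (γ w.1) (μ * w.2.2 ^ 2 / 2))
      (ξ, ξ', 0) :=
    ContinuousAt.comp (g := fun z : ℂ × ℂ × ℝ => inU z.1 z.2.1 z.2.2)
      (f := fun w : ℝ × ℝ × ℝ => (γ w.2.1, γ w.1, μ * w.2.2 ^ 2 / 2)) (x := (ξ, ξ', 0))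
      (contDiffAt_inU hna' hz).continuousAt hg'.continuousAt
  have cE : ContinuousAt (fun w : ℝ × ℝ × ℝ => inErr (γ w.1) (γ w.2.1) (μ * w.2.2 ^ 2 / 2))
      (ξ, ξ', 0) :=
    ContinuousAt.comp (g := fun z : ℂ × ℂ × ℝ => inErr z.1 z.2.1 z.2.2)
      (f := fun w : ℝ × ℝ × ℝ => (γ w.1, γ w.2.1, μ * w.2.2 ^ 2 / 2)) (x := (ξ, ξ', 0))
      (continuousAt_inErr hna hz) hg.continuousAt
  have cE' : ContinuousAt (fun w : ℝ × ℝ × ℝ => inErr (γ w.2.1) (γ w.1) (μ * w.2.2 ^ 2 / 2))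
      (ξ, ξ', 0) :=
    ContinuousAt.comp (g := fun z : ℂ × ℂ × ℝ => inErr z.1 z.2.1 z.2.2)
      (f := fun w : ℝ × ℝ × ℝ => (γ w.2.1, γ w.1, μ * w.2.2 ^ 2 / 2)) (x := (ξ, ξ', 0))
      (continuousAt_inErr hna' hz) hg'.continuousAt
  have cA : ContinuousAt (fun w : ℝ × ℝ × ℝ => lcA (γ w.1) (γ w.2.1)) (ξ, ξ', 0) :=
    ContinuousAt.comp (g := fun z : ℂ × ℂ × ℝ => lcA z.1 z.2.1)
      (f := fun w : ℝ × ℝ × ℝ => (γ w.1, γ w.2.1, μ * w.2.2 ^ 2 / 2)) (x := (ξ, ξ', 0))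
      (contDiffAt_lcA hna).continuousAt hg.continuousAt
  have hpn : ∀ {η : ℝ}, IsCentralConfiguration γ η →
      ⟪γ η, -Complex.I * deriv γ η⟫_ℝ = ‖γ η‖ := by
    intro η hη
    have e : γ η = ‖γ η‖ • (-Complex.I * deriv γ η) := by
      rw [Complex.real_smul]; exact hη.normal_eq hD
    conv_lhs => rw [e]
    rw [real_inner_smul_left, real_inner_self_eq_norm_sq, hD.norm_normal]; ring
  have hneg : ∀ {η η' : ℝ}, IsCentralConfiguration γ η →
      0 < ‖γ η‖ * ‖γ η'‖ + ⟪γ η, γ η'⟫_ℝ →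
      ⟪inU (γ η) (γ η') (μ * 0 ^ 2 / 2), -Complex.I * deriv γ η⟫_ℝ < 0 := by
    intro η η' hη hn
    have := norm_pos_iff.mpr (hD.ne_zero η)
    rw [hz, inU_zero hn, inner_neg_left, real_inner_smul_left, hpn hη, neg_lt_zero]
    positivity
  obtain ⟨r, hr, hin⟩ := Metric.eventually_nhds_iff.mp (h.eventually_inside hD)
  obtain ⟨r', hr', hin'⟩ := Metric.eventually_nhds_iff.mp (h'.eventually_inside hD)
  have x1 : ∀ᶠ w : ℝ × ℝ × ℝ in 𝓝 (ξ, ξ', 0), dist w.1 ξ < r :=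
    ContinuousAt.eventually_lt (Continuous.continuousAt (by fun_prop)) continuousAt_const
      (by simpa using hr)
  have x2 : ∀ᶠ w : ℝ × ℝ × ℝ in 𝓝 (ξ, ξ', 0), dist w.2.1 ξ' < r' :=
    ContinuousAt.eventually_lt (Continuous.continuousAt (by fun_prop)) continuousAt_const
      (by simpa using hr')
  have x3 := cE.eventually_lt (continuousAt_const (y := r)) (by
    simp only [hz, inErr_zero]; exact hr)
  have x4 := cE'.eventually_lt (continuousAt_const (y := r')) (by
    simp only [hz, inErr_zero]; exact hr')
  have x5 : ∀ᶠ w : ℝ × ℝ × ℝ in 𝓝 (ξ, ξ', 0),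
      0 < ‖γ w.1‖ * ‖γ w.2.1‖ + ⟪γ w.1, γ w.2.1⟫_ℝ :=
    continuousAt_const.eventually_lt (Continuous.continuousAt (by fun_prop)) hna
  have x6 : ∀ᶠ w : ℝ × ℝ × ℝ in 𝓝 (ξ, ξ', 0),
      ⟪inU (γ w.1) (γ w.2.1) (μ * w.2.2 ^ 2 / 2), -Complex.I * deriv γ w.1⟫_ℝ < 0 :=
    (cU.inner (Continuous.continuousAt (by fun_prop))).eventually_lt continuousAt_const
      (hneg h hna)
  have x7 : ∀ᶠ w : ℝ × ℝ × ℝ in 𝓝 (ξ, ξ', 0),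
      ⟪inU (γ w.2.1) (γ w.1) (μ * w.2.2 ^ 2 / 2), -Complex.I * deriv γ w.2.1⟫_ℝ < 0 :=
    (cU'.inner (Continuous.continuousAt (by fun_prop))).eventually_lt continuousAt_const
      (hneg h' hna')
  have x8 : ∀ᶠ w : ℝ × ℝ × ℝ in 𝓝 (ξ, ξ', 0), 0 < ⟪γ w.1, -Complex.I * deriv γ w.1⟫_ℝ :=
    continuousAt_const.eventually_lt (Continuous.continuousAt (by fun_prop))
      (by change 0 < ⟪γ ξ, -Complex.I * deriv γ ξ⟫_ℝ; rw [hpn h]; exact hP)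
  obtain ⟨c, hc, hsepc⟩ := h.eventually_separated hD hna hsep
  have x9 : ∀ᶠ w : ℝ × ℝ × ℝ in 𝓝 (ξ, ξ', 0),
      c * ‖γ w.2.1 - γ w.1‖ ≤ |⟪Complex.I * γ w.1, γ w.2.1⟫_ℝ| := by
    have : Tendsto (fun w : ℝ × ℝ × ℝ => (w.1, w.2.1)) (𝓝 (ξ, ξ', 0)) (𝓝 (ξ, ξ')) :=
      Continuous.tendsto' (by fun_prop) _ _ rfl
    exact this.eventually hsepc
  set M := ‖γ ξ‖ + ‖γ ξ'‖ with hM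
  have x10 : ∀ᶠ w : ℝ × ℝ × ℝ in 𝓝 (ξ, ξ', 0), ‖γ w.1‖ < M :=
    ContinuousAt.eventually_lt (Continuous.continuousAt (by fun_prop)) continuousAt_const
      (by change ‖γ ξ‖ < M; linarith)
  have x11 : ∀ᶠ w : ℝ × ℝ × ℝ in 𝓝 (ξ, ξ', 0), ‖γ w.2.1‖ < M :=
    ContinuousAt.eventually_lt (Continuous.continuousAt (by fun_prop)) continuousAt_const
      (by change ‖γ ξ'‖ < M; linarith)
  have hA := lcA_pos hna
  have x12 : ∀ᶠ w : ℝ × ℝ × ℝ in 𝓝 (ξ, ξ', 0), lcA (γ ξ) (γ ξ') / 2 < lcA (γ w.1) (γ w.2.1) :=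
    continuousAt_const.eventually_lt cA (by simp only; linarith)
  have x13 : ∀ᶠ w : ℝ × ℝ × ℝ in 𝓝 (ξ, ξ', 0),
      (b * M * w.2.2 / 2 + |⟪Complex.I * γ w.1, -Complex.I * deriv γ w.1⟫_ℝ|) *
        (√M * (1 + M / (lcA (γ ξ) (γ ξ') / 2))) < c * √‖γ w.1‖ := by
    apply ContinuousAt.eventually_lt (Continuous.continuousAt (by fun_prop))
      (Continuous.continuousAt (by fun_prop))
    change (b * M * 0 / 2 + |⟪Complex.I * γ ξ, -Complex.I * deriv γ ξ⟫_ℝ|) *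
        (√M * (1 + M / (lcA (γ ξ) (γ ξ') / 2))) < c * √‖γ ξ‖
    have e : Complex.I * γ ξ = ‖γ ξ‖ • deriv γ ξ := by
      conv_lhs => rw [h.normal_eq hD]
      rw [Complex.real_smul]
      linear_combination (-(‖γ ξ‖ : ℂ) * deriv γ ξ) * Complex.I_sq
    rw [e, real_inner_smul_left, real_inner_comm, inner_normal_tangent, mul_zero, mul_zero,
      zero_div, abs_zero, add_zero, zero_mul]
    exact mul_pos hc (Real.sqrt_pos.mpr hP)
  filter_upwards [x1, x2, x3, x4, x5, x6, x7, x8, x9, x10, x11, x12, x13] with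
    w x1 x2 x3 x4 x5 x6 x7 x8 x9 x10 x11 x12 x13
  refine ⟨hD.norm_normal _, x5, ?_, ?_, by rwa [hν], by rwa [hν], x8,
    c, lcA (γ ξ) (γ ξ') / 2, M, hc.le, by positivity, x10.le, x11.le, x12.le, x9, ?_⟩
  · intro e he
    rw [hν] at he
    exact hin (y := (w.1, e)) (by
      rw [Prod.dist_eq]; simp only [dist_zero_right]; exact max_lt x1 (he.trans_lt x3))
  · intro e he
    rw [hν] at he
    exact hin' (y := (w.2.1, e)) (by
      rw [Prod.dist_eq]; simp only [dist_zero_right]; exact max_lt x2 (he.trans_lt x4))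
  · have : b * M / (2 * w.2.2⁻¹) = b * M * w.2.2 / 2 := by
      rw [mul_comm 2, ← div_div, div_inv_eq_mul]
    rwa [this]

end Domain
end RefractionBilliard

/-! ### The balance equation and its Newton step. -/

namespace RefractionBilliard
open scoped InnerProductSpace ComplexConjugate

/-- The rescaled defect in Snell's law at `γ x` between the harmonic arc to `γ y` and the Kepler arc
to `γ z`, for the scale parameter `δ`. -/
noncomputable def balance (γ : ℝ → ℂ) (ρ ω μ : ℝ) (x y z δ : ℝ) : ℝ :=
  ⟪δ • outV ρ ω (γ x) (γ y) + inU (γ x) (γ z) (μ * δ ^ 2 / 2), deriv γ x⟫_ℝ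

theorem contDiffAt_one_deriv {F : Type*} [NormedAddCommGroup F] [NormedSpace ℝ F] {f : ℝ → F}
    {x : ℝ} (h : ContDiffAt ℝ 2 f x) : ContDiffAt ℝ 1 (deriv f) x := by
  have h1 : ContDiffAt ℝ 1 (fderiv ℝ f) x := h.fderiv_right (by norm_num)
  exact h1.clm_apply contDiffAt_const

section Domain

variable {D : Set ℂ} {γ : ℝ → ℂ} {L : ℝ}

theorem IsDomainWithBoundary.deriv_norm (hD : IsDomainWithBoundary D γ L) (x : ℝ) :
    deriv (fun s => ‖γ s‖) x = ⟪γ x, deriv γ x⟫_ℝ / ‖γ x‖ := by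
  have hx := hD.ne_zero x
  have hn : ‖γ x‖ ≠ 0 := norm_ne_zero_iff.mpr hx
  have h1 : HasDerivAt (fun s => ‖γ s‖ ^ 2) (2 * ⟪γ x, deriv γ x⟫_ℝ) x :=
    (hD.hasStrictDerivAt x).hasDerivAt.norm_sq
  have h2 := h1.sqrt (by positivity)
  have h3 : (fun s => √(‖γ s‖ ^ 2)) = fun s => ‖γ s‖ := by
    funext s; exact Real.sqrt_sq (norm_nonneg _)
  rw [h3] at h2
  rw [h2.deriv, Real.sqrt_sq (norm_nonneg _)]
  field_simp

theorem contDiffAt_balance (hD : IsDomainWithBoundary D γ L) {ρ ω μ ξ ξ' : ℝ}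
    (hρ : ‖γ ξ‖ ^ 2 < ρ) (h2 : ContDiffAt ℝ 2 γ ξ)
    (hna : 0 < ‖γ ξ‖ * ‖γ ξ'‖ + ⟪γ ξ, γ ξ'⟫_ℝ) :
    ContDiffAt ℝ 1 (fun w : ℝ × ℝ × ℝ × ℝ => balance γ ρ ω μ w.1 w.2.1 w.2.2.1 w.2.2.2)
      (ξ, ξ, ξ', 0) := by
  have hp := hD.ne_zero ξ
  have hmem := outC_self_mem hp hρ
  have hdisc0 : 0 < outDisc ρ (γ ξ) (γ ξ) := by
    rw [outDisc_self]; have : 0 < ρ - ‖γ ξ‖ ^ 2 := by linarith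
    positivity
  have g1 : ContDiffAt ℝ 1 (fun w : ℝ × ℝ × ℝ × ℝ => γ w.1) (ξ, ξ, ξ', 0) :=
    hD.contDiff.contDiffAt.comp _ contDiffAt_fst
  have g2 : ContDiffAt ℝ 1 (fun w : ℝ × ℝ × ℝ × ℝ => γ w.2.1) (ξ, ξ, ξ', 0) :=
    hD.contDiff.contDiffAt.comp _ contDiffAt_snd.fst
  have g3 : ContDiffAt ℝ 1 (fun w : ℝ × ℝ × ℝ × ℝ => γ w.2.2.1) (ξ, ξ, ξ', 0) :=
    hD.contDiff.contDiffAt.comp _ contDiffAt_snd.snd.fst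
  have g4 : ContDiffAt ℝ 1 (fun w : ℝ × ℝ × ℝ × ℝ => w.2.2.2) (ξ, ξ, ξ', 0) :=
    contDiffAt_snd.snd.snd
  have g5 : ContDiffAt ℝ 1 (fun w : ℝ × ℝ × ℝ × ℝ => deriv γ w.1) (ξ, ξ, ξ', 0) :=
    ContDiffAt.comp (g := deriv γ) (f := fun w : ℝ × ℝ × ℝ × ℝ => w.1) (ξ, ξ, ξ', 0)
      (contDiffAt_one_deriv h2) contDiffAt_fst
  have cV : ContDiffAt ℝ 1 (fun w : ℝ × ℝ × ℝ × ℝ => outV ρ ω (γ w.1) (γ w.2.1))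
      (ξ, ξ, ξ', 0) :=
    ContDiffAt.comp (g := fun z : ℂ × ℂ => outV ρ ω z.1 z.2)
      (f := fun w : ℝ × ℝ × ℝ × ℝ => (γ w.1, γ w.2.1)) (ξ, ξ, ξ', 0)
      (contDiffAt_outV hdisc0 hmem.1 hmem.2) (g1.prodMk g2)
  have cU : ContDiffAt ℝ 1 (fun w : ℝ × ℝ × ℝ × ℝ =>
      inU (γ w.1) (γ w.2.2.1) (μ * w.2.2.2 ^ 2 / 2)) (ξ, ξ, ξ', 0) :=
    ContDiffAt.comp (g := fun z : ℂ × ℂ × ℝ => inU z.1 z.2.1 z.2.2)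
      (f := fun w : ℝ × ℝ × ℝ × ℝ => (γ w.1, γ w.2.2.1, μ * w.2.2.2 ^ 2 / 2)) (ξ, ξ, ξ', 0)
      (contDiffAt_inU hna (by simp))
      (g1.prodMk (g3.prodMk ((contDiffAt_const.mul (g4.pow 2)).div_const 2)))
  exact ((g4.smul cV).add cU).inner ℝ g5

/-- At `δ = 0` the outer term disappears and `inU` is radial, so neither partner of `x` occurs any
more: the system of balance equations decouples. -/
theorem balance_zero (hD : IsDomainWithBoundary D γ L) {ρ ω μ x y z : ℝ}
    (hna : 0 < ‖γ x‖ * ‖γ z‖ + ⟪γ x, γ z⟫_ℝ) :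
    balance γ ρ ω μ x y z 0 = -2 * deriv (fun s => ‖γ s‖) x := by
  have : μ * (0 : ℝ) ^ 2 / 2 = 0 := by ring
  rw [balance, this, inU_zero hna, zero_smul, zero_add, inner_neg_left, real_inner_smul_left,
    hD.deriv_norm]
  ring

/-- Near a non-degenerate central configuration, the Newton step for the balance equation is a
contraction. -/
theorem IsNondegenerateCC.exists_contraction (hD : IsDomainWithBoundary D γ L) {ρ ω μ ξ ξ' : ℝ}
    (h : IsNondegenerateCC γ ξ) (hρ : ‖γ ξ‖ ^ 2 < ρ)
    (hna : 0 < ‖γ ξ‖ * ‖γ ξ'‖ + ⟪γ ξ, γ ξ'⟫_ℝ) :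
    ∃ A : ℝ, A ≠ 0 ∧ ∃ r > 0, ∀ x y z x' y' z' δ : ℝ, |x - ξ| < r → |y - ξ| < r → |z - ξ'| < r →
      |x' - ξ| < r → |y' - ξ| < r → |z' - ξ'| < r → |δ| < r →
      |(x - balance γ ρ ω μ x y z δ / A) - (x' - balance γ ρ ω μ x' y' z' δ / A)| ≤
        max |x - x'| (max |y - y'| |z - z'|) / 2 := by
  obtain ⟨hcc, h2, hnd⟩ := h
  set f2 := deriv (deriv fun s => ‖γ s‖) ξ with hf2
  set G : ℝ × ℝ × ℝ × ℝ → ℝ := fun w => balance γ ρ ω μ w.1 w.2.1 w.2.2.1 w.2.2.2 with hG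
  have hcd : ContDiffAt ℝ 1 G (ξ, ξ, ξ', 0) := contDiffAt_balance hD hρ h2 hna
  have hstr := hcd.hasStrictFDerivAt one_ne_zero
  set G' := fderiv ℝ G (ξ, ξ, ξ', 0) with hG'
  -- Derivative along a line in the slice `δ = 0`, where `balance_zero` gives the function
  -- explicitly; non-antipodality persists near the base point.
  have hG'eq : ∀ x y z : ℝ, G' (x, y, z, 0) = -2 * f2 * x := by
    intro x y z
    have d1 : HasDerivAt (fun t : ℝ => ((ξ, ξ, ξ', (0 : ℝ)) : ℝ × ℝ × ℝ × ℝ) + t • (x, y, z, 0))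
        (x, y, z, 0) 0 := by
      simpa using ((hasDerivAt_id (0 : ℝ)).smul_const (x, y, z, (0 : ℝ))).const_add
        ((ξ, ξ, ξ', (0 : ℝ)) : ℝ × ℝ × ℝ × ℝ)
    have d2 := HasFDerivAt.comp_hasDerivAt_of_eq (x := (0 : ℝ)) hstr.hasFDerivAt d1 (by simp)
    have hna' : ∀ᶠ t : ℝ in 𝓝 0, 0 < ‖γ (ξ + t * x)‖ * ‖γ (ξ' + t * z)‖ +
        ⟪γ (ξ + t * x), γ (ξ' + t * z)⟫_ℝ := by
      have hcγ : Continuous γ := hD.contDiff.continuous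
      apply continuousAt_const.eventually_lt (Continuous.continuousAt (by fun_prop))
      simpa using hna
    have heq : (G ∘ fun t : ℝ => ((ξ, ξ, ξ', (0 : ℝ)) : ℝ × ℝ × ℝ × ℝ) + t • (x, y, z, 0))
        =ᶠ[𝓝 0] fun t => -2 * deriv (fun s => ‖γ s‖) (ξ + t * x) := by
      filter_upwards [hna'] with t ht
      have := balance_zero hD (ρ := ρ) (ω := ω) (μ := μ) (y := ξ + t * y) ht
      simpa [hG] using this
    have d3 : HasDerivAt (fun t : ℝ => ξ + t * x) x 0 := by
      simpa using ((hasDerivAt_id (0 : ℝ)).mul_const x).const_add ξ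
    have d4 : HasDerivAt (deriv fun s => ‖γ s‖) f2 ξ :=
      (differentiableAt_of_deriv_ne_zero hnd).hasDerivAt
    have d5 := (HasDerivAt.comp_of_eq (0 : ℝ) d4 d3 (by simp)).const_mul (-2)
    have := (d2.congr_of_eventuallyEq heq.symm).unique d5
    rw [this]; ring
  have hA : -2 * f2 ≠ 0 := mul_ne_zero (by norm_num) hnd
  refine ⟨-2 * f2, hA, ?_⟩
  have hA' := abs_pos.mpr hA
  -- The slope is `A = -2 f2`; linear approximation up to `|A|/2` yields the contraction factor
  -- `1/2`. Both compared points have the same `δ`, so the `δ`-derivative plays no role.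
  obtain ⟨r, hr, hball⟩ := Metric.eventually_nhds_iff.mp
    (hstr.isLittleO.def (show 0 < |-2 * f2| / 2 by positivity))
  refine ⟨r, hr, ?_⟩
  intro x y z x' y' z' δ hx hy hz hx' hy' hz' hδ
  have key := hball (y := ((x, y, z, δ), (x', y', z', δ))) (by
    simp only [Prod.dist_eq, Real.dist_eq, sub_zero]
    simp only [max_lt_iff]
    exact ⟨⟨hx, hy, hz, hδ⟩, hx', hy', hz', hδ⟩)
  simp only [Prod.mk_sub_mk, sub_self, hG'eq, Prod.norm_mk, norm_zero, Real.norm_eq_abs] at key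
  rw [max_eq_left (abs_nonneg (z - z'))] at key
  have e : (x - balance γ ρ ω μ x y z δ / (-2 * f2)) - (x' - balance γ ρ ω μ x' y' z' δ / (-2 * f2))
      = -((balance γ ρ ω μ x y z δ - balance γ ρ ω μ x' y' z' δ - -2 * f2 * (x - x')) /
        (-2 * f2)) := by
    field_simp; ring
  rw [e, abs_neg, abs_div, div_le_iff₀ hA']
  refine key.trans (le_of_eq ?_)
  ring

theorem IsNondegenerateCC.tendsto_balance (hD : IsDomainWithBoundary D γ L) {ρ ω μ ξ ξ' : ℝ}
    (h : IsNondegenerateCC γ ξ) (hρ : ‖γ ξ‖ ^ 2 < ρ)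
    (hna : 0 < ‖γ ξ‖ * ‖γ ξ'‖ + ⟪γ ξ, γ ξ'⟫_ℝ) :
    Tendsto (balance γ ρ ω μ ξ ξ ξ') (𝓝 0) (𝓝 0) := by
  have h0 : balance γ ρ ω μ ξ ξ ξ' 0 = 0 := by
    rw [balance_zero hD hna, h.1.1.deriv, mul_zero]
  have hc := (contDiffAt_balance hD (ω := ω) (μ := μ) hρ h.2.1 hna).continuousAt
  have : ContinuousAt (balance γ ρ ω μ ξ ξ ξ') 0 :=
    ContinuousAt.comp (g := fun w : ℝ × ℝ × ℝ × ℝ => balance γ ρ ω μ w.1 w.2.1 w.2.2.1 w.2.2.2)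
      (f := fun δ => (ξ, ξ, ξ', δ)) hc (by fun_prop)
  rw [ContinuousAt, h0] at this
  exact this

end Domain
end RefractionBilliard

/-! ### Relaxation of an infinite chain of equations along a word. -/

namespace RefractionBilliard

section Relaxation

variable {ι : Type*}

/-- The neighbouring return time that matters for an outgoing or ingoing boundary point. -/
def side : Bool → ℤ
  | true => 1
  | false => -1

theorem abs_side (b : Bool) : |side b| = 1 := by cases b <;> rfl

/-- `s` is fixed by the relaxation `T` along the word `ℓ`. There are two unknowns for each letter,
and each is updated from itself, its partner, and the opposite unknown of a neighbouring letter. -/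
def IsSolution (T : ι → ι → ℝ → ℝ → ℝ → ℝ) (ℓ : ℤ → ι) (s : ℤ → Bool → ℝ) : Prop :=
  ∀ k b, T (ℓ k) (ℓ (k + side b)) (s k b) (s k !b) (s (k + side b) !b) = s k b

/-- `T` contracts distances in the `r`-neighbourhoods of the centers. -/
def IsContraction (T : ι → ι → ℝ → ℝ → ℝ → ℝ) (P : ι → ι → Prop) (c : ι → ℝ) (r : ℝ) : Prop :=
  ∀ i j, P i j → ∀ x y z x' y' z' : ℝ, |x - c i| < r → |y - c i| < r → |z - c j| < r →
    |x' - c i| < r → |y' - c i| < r → |z' - c j| < r →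
    |T i j x y z - T i j x' y' z'| ≤ max |x - x'| (max |y - y'| |z - z'|) / 2

variable {T : ι → ι → ℝ → ℝ → ℝ → ℝ} {P : ι → ι → Prop} {c : ι → ℝ} {r : ℝ}

/-- Iteration of all updates simultaneously, in the supremum norm. The closed `ρ₀`-neighbourhood of
the centers is invariant: a center moves by at most `ρ₀/2` and the contraction contributes at most
another `ρ₀/2`. -/
theorem IsContraction.exists_isSolution (hT : IsContraction T P c r) {ρ₀ : ℝ} (h0 : 0 ≤ ρ₀)
    (hr : ρ₀ < r) (hc : ∀ i j, P i j → |T i j (c i) (c i) (c j) - c i| ≤ ρ₀ / 2) {ℓ : ℤ → ι}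
    (hℓ : ∀ k b, P (ℓ k) (ℓ (k + side b))) :
    ∃ s, IsSolution T ℓ s ∧ ∀ k b, |s k b - c (ℓ k)| ≤ ρ₀ := by
  set step : (ℤ → Bool → ℝ) → ℤ → Bool → ℝ := fun s k b =>
    T (ℓ k) (ℓ (k + side b)) (s k b) (s k !b) (s (k + side b) !b) with hstep
  have hr0 : 0 < r := h0.trans_lt hr
  have hinv : ∀ s : ℤ → Bool → ℝ, (∀ k b, |s k b - c (ℓ k)| ≤ ρ₀) →
      ∀ k b, |step s k b - c (ℓ k)| ≤ ρ₀ := by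
    intro s hs k b
    have h1 := hT _ _ (hℓ k b) (s k b) (s k !b) (s (k + side b) !b) (c (ℓ k)) (c (ℓ k))
      (c (ℓ (k + side b))) ((hs _ _).trans_lt hr) ((hs _ _).trans_lt hr) ((hs _ _).trans_lt hr)
      (by simpa using hr0) (by simpa using hr0) (by simpa using hr0)
    have h2 := hc _ _ (hℓ k b)
    have h3 : max |s k b - c (ℓ k)| (max |(s k !b) - c (ℓ k)|
        |(s (k + side b) !b) - c (ℓ (k + side b))|) ≤ ρ₀ :=
      max_le (hs _ _) (max_le (hs _ _) (hs _ _))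
    have h4 := abs_sub_le (step s k b) (T (ℓ k) (ℓ (k + side b)) (c (ℓ k)) (c (ℓ k))
      (c (ℓ (k + side b)))) (c (ℓ k))
    simp only [hstep] at h4 ⊢
    linarith
  have hlip : ∀ s s' : ℤ → Bool → ℝ, (∀ k b, |s k b - c (ℓ k)| ≤ ρ₀) →
      (∀ k b, |s' k b - c (ℓ k)| ≤ ρ₀) → ∀ k b, |step s k b - step s' k b| ≤
        max |s k b - s' k b| (max |(s k !b) - s' k !b|
          |(s (k + side b) !b) - s' (k + side b) !b|) / 2 := fun s s' hs hs' k b =>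
    hT _ _ (hℓ k b) _ _ _ _ _ _ ((hs _ _).trans_lt hr) ((hs _ _).trans_lt hr)
      ((hs _ _).trans_lt hr) ((hs' _ _).trans_lt hr) ((hs' _ _).trans_lt hr)
      ((hs' _ _).trans_lt hr)
  set S : ℕ → ℤ → Bool → ℝ := fun n => step^[n] fun k _ => c (ℓ k) with hS
  have hSsucc : ∀ n, S (n + 1) = step (S n) := fun n => Function.iterate_succ_apply' _ _ _
  have hSinv : ∀ n k b, |S n k b - c (ℓ k)| ≤ ρ₀ := by
    intro n
    induction n with
    | zero => intro k b; simpa [hS] using h0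
    | succ n ih => rw [hSsucc]; exact hinv _ ih
  have hgeo : ∀ n k b, |S n k b - S (n + 1) k b| ≤ ρ₀ / 2 ^ n := by
    intro n
    induction n with
    | zero =>
      intro k b
      have := hSinv 1 k b
      rw [abs_sub_comm] at this
      simpa [hS] using this
    | succ n ih =>
      intro k b
      have e : S (n + 1) k b - S (n + 1 + 1) k b = step (S n) k b - step (S (n + 1)) k b := by
        rw [hSsucc (n + 1), hSsucc n]
      rw [e]
      refine (hlip _ _ (hSinv n) (hSinv (n + 1)) k b).trans ?_
      have := max_le (ih k b) (max_le (ih k !b) (ih (k + side b) !b))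
      rw [pow_succ, ← div_div]
      linarith
  -- The constant is `2 * ρ₀` because the criterion bounds consecutive distances by `C / 2 / 2 ^ n`.
  have hlim : ∀ k b, ∃ x, Tendsto (fun n => S n k b) atTop (𝓝 x) := fun k b =>
    cauchySeq_tendsto_of_complete (cauchySeq_of_le_geometric_two (C := 2 * ρ₀) fun n => by
      rw [Real.dist_eq]; simpa using hgeo n k b)
  choose s hs using hlim
  have hsinv : ∀ k b, |s k b - c (ℓ k)| ≤ ρ₀ := fun k b =>
    le_of_tendsto ((hs k b).sub_const _).abs (Eventually.of_forall fun n => hSinv n k b)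
  refine ⟨s, fun k b => ?_, hsinv⟩
  have h1 : Tendsto (fun n => S (n + 1) k b - step s k b) atTop (𝓝 (s k b - step s k b)) :=
    ((tendsto_add_atTop_iff_nat 1).mpr (hs k b)).sub_const _
  have h2 : Tendsto (fun n => max |S n k b - s k b| (max |(S n k !b) - s k !b|
      |(S n (k + side b) !b) - s (k + side b) !b|) / 2) atTop (𝓝 0) := by
    have e : ∀ k b, Tendsto (fun n => |S n k b - s k b|) atTop (𝓝 0) := fun k b => by
      simpa using ((hs k b).sub_const (s k b)).abs
    simpa using ((e k b).max ((e k !b).max (e (k + side b) !b))).div_const 2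
  have h3 : Tendsto (fun n => S (n + 1) k b - step s k b) atTop (𝓝 0) :=
    squeeze_zero_norm (fun n => by
      rw [hSsucc, Real.norm_eq_abs]; exact hlip _ _ (hSinv n) hsinv k b) h2
  have := tendsto_nhds_unique h1 h3
  simp only [hstep] at this
  linarith

/-- Solutions along words that agree on a long block are close to each other in its middle. -/
theorem IsContraction.abs_solution_sub_le (hT : IsContraction T P c r) {ℓ ℓ' : ℤ → ι}
    (hℓ : ∀ k b, P (ℓ k) (ℓ (k + side b))) {s s' : ℤ → Bool → ℝ} (hs : IsSolution T ℓ s)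
    (hs' : IsSolution T ℓ' s') (hr : ∀ k b, |s k b - c (ℓ k)| < r)
    (hr' : ∀ k b, |s' k b - c (ℓ' k)| < r) {N : ℤ} (hN : ∀ k, |k| ≤ N → ℓ k = ℓ' k) (n : ℕ) :
    ∀ k b, |k| + n ≤ N → |s k b - s' k b| ≤ 2 * r / 2 ^ n := by
  induction n with
  | zero =>
    intro k b hk
    have h1 := hr k b
    have h2 := hr' k b
    rw [← hN k (by simpa using hk)] at h2
    have := abs_sub_le (s k b) (c (ℓ k)) (s' k b)
    rw [abs_sub_comm (c (ℓ k))] at this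
    simp only [pow_zero, div_one]
    linarith
  | succ n ih =>
    intro k b hk
    push_cast at hk
    have hk' : |k + side b| + n ≤ N := by
      have := abs_add_le k (side b)
      rw [abs_side] at this
      omega
    have e1 : ℓ k = ℓ' k := hN k (by omega)
    have e2 : ℓ (k + side b) = ℓ' (k + side b) := hN _ (by omega)
    rw [← hs k b, ← hs' k b, ← e1, ← e2]
    have r1 := hr' k b
    have r2 := hr' k !b
    have r3 := hr' (k + side b) !b
    rw [← e1] at r1 r2
    rw [← e2] at r3
    refine (hT _ _ (hℓ k b) _ _ _ _ _ _ (hr _ _) (hr _ _) (hr _ _) r1 r2 r3).trans ?_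
    have := max_le (ih k b (by omega)) (max_le (ih k (!b) (by omega)) (ih (k + side b) (!b) hk'))
    rw [pow_succ, ← div_div]
    linarith

/-- The two words agree on blocks of every length, so the bound of `abs_solution_sub_le` is
available for all `n`. -/
theorem IsContraction.isSolution_unique (hT : IsContraction T P c r) {ℓ : ℤ → ι}
    (hℓ : ∀ k b, P (ℓ k) (ℓ (k + side b))) {s s' : ℤ → Bool → ℝ} (hs : IsSolution T ℓ s)
    (hs' : IsSolution T ℓ s') (hr : ∀ k b, |s k b - c (ℓ k)| < r)
    (hr' : ∀ k b, |s' k b - c (ℓ k)| < r) : s = s' := by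
  funext k b
  have h1 : ∀ n : ℕ, |s k b - s' k b| ≤ 2 * r / 2 ^ n := fun n =>
    hT.abs_solution_sub_le hℓ hs hs' hr hr' (N := |k| + n) (fun _ _ => rfl) n k b le_rfl
  have h2 : Tendsto (fun n : ℕ => 2 * r / 2 ^ n) atTop (𝓝 0) :=
    tendsto_const_nhds.div_atTop (tendsto_pow_atTop_atTop_of_one_lt one_lt_two)
  have h3 := ge_of_tendsto' h2 h1
  exact sub_eq_zero.mp (abs_eq_zero.mp (le_antisymm h3 (abs_nonneg _)))

/-- A neighbourhood in the product topology fixes the letters from `-n` to `n`, which determines the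
unknowns at `0` up to `2r/2ⁿ`. -/
theorem IsContraction.continuous_solution [TopologicalSpace ι] [DiscreteTopology ι]
    (hT : IsContraction T P c r) {X : Set (ℤ → ι)} (hX : ∀ ℓ ∈ X, ∀ k b, P (ℓ k) (ℓ (k + side b)))
    {s : X → ℤ → Bool → ℝ} (hs : ∀ ℓ : X, IsSolution T ℓ (s ℓ))
    (hr : ∀ (ℓ : X) k b, |s ℓ k b - c ((ℓ : ℤ → ι) k)| < r) (b : Bool) :
    Continuous fun ℓ => s ℓ 0 b := by
  rw [continuous_iff_continuousAt]
  intro ℓ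
  rw [ContinuousAt, Metric.tendsto_nhds]
  intro η hη
  have h2 : Tendsto (fun n : ℕ => 2 * r / 2 ^ n) atTop (𝓝 0) :=
    tendsto_const_nhds.div_atTop (tendsto_pow_atTop_atTop_of_one_lt one_lt_two)
  obtain ⟨n, hn⟩ := (h2.eventually_lt_const hη).exists
  have hev : ∀ᶠ ℓ' : X in 𝓝 ℓ, ∀ k ∈ Finset.Icc (-(n : ℤ)) n,
      (ℓ' : ℤ → ι) k = (ℓ : ℤ → ι) k := by
    rw [Filter.eventually_all_finset]
    intro k _
    have : Continuous fun ℓ' : X => (ℓ' : ℤ → ι) k :=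
      (continuous_apply k).comp continuous_subtype_val
    exact this.continuousAt.eventually_mem ((isOpen_discrete {(ℓ : ℤ → ι) k}).mem_nhds rfl)
  filter_upwards [hev] with ℓ' h'
  rw [Real.dist_eq]
  refine lt_of_le_of_lt ?_ hn
  exact hT.abs_solution_sub_le (hX _ ℓ'.2) (hs ℓ') (hs ℓ) (hr ℓ') (hr ℓ) (N := n)
    (fun k hk => h' k (Finset.mem_Icc.mpr (abs_le.mp hk))) n 0 b (by simp)

end Relaxation

end RefractionBilliard

/-! ### From a coding of complete orbits to a conjugacy. -/

namespace RefractionBilliard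

section Conjugacy

variable {Z : Type*} {R : Z → Z → Prop}

theorem orbit_unique (hf : ∀ x y y', R x y → R x y' → y = y')
    (hb : ∀ x x' y, R x y → R x' y → x = x') {o o' : ℤ → Z} (ho : ∀ j, R (o j) (o (j + 1)))
    (ho' : ∀ j, R (o' j) (o' (j + 1))) (h : o 0 = o' 0) : o = o' := by
  funext j
  induction j using Int.induction_on with
  | zero => exact h
  | succ j ih => exact hf _ _ _ (ho j) (ih ▸ ho' j)
  | pred j ih =>
    have h1 := ho (-(j : ℤ) - 1)
    have h2 := ho' (-(j : ℤ) - 1)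
    rw [sub_add_cancel] at h1 h2
    exact hb _ _ _ h1 (ih ▸ h2)

/-- A relation that is the graph of a bijection along its complete orbits is conjugate to a
subshift when the itineraries of the orbits code them bijectively and continuously. -/
theorem exists_conjugacy [TopologicalSpace Z] [T2Space Z] {m : ℕ} (S : Fin m → Set Z)
    {X : Set Z} (hX : ∀ x, x ∈ X ↔ ∃ o : ℤ → Z, o 0 = x ∧ ∀ j, R (o j) (o (j + 1)))
    {Y : Set (ℤ → Fin m)} (hY : IsClosed Y)
    (hf : ∀ x y y', R x y → R x y' → y = y') (hb : ∀ x x' y, R x y → R x' y → x = x')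
    (hS : ∀ z i j, z ∈ S i → z ∈ S j → i = j) {Φ : Y → Z} (hΦ : Continuous Φ)
    (hex : ∀ ℓ : Y, ∃ o : ℤ → Z, o 0 = Φ ℓ ∧ (∀ j, R (o j) (o (j + 1))) ∧
      ∀ j, o j ∈ S ((ℓ : ℤ → Fin m) j))
    (hword : ∀ o : ℤ → Z, (∀ j, R (o j) (o (j + 1))) → ∃ ℓ ∈ Y, ∀ j, o j ∈ S (ℓ j))
    (huniq : ∀ o : ℤ → Z, (∀ j, R (o j) (o (j + 1))) → ∀ ℓ : Y,
      (∀ j, o j ∈ S ((ℓ : ℤ → Fin m) j)) → o 0 = Φ ℓ) :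
    ∃ (F : Equiv.Perm X) (π : X → Y),
      (∀ (x : X) (y : Z), R x y ↔ (F x : Z) = y) ∧
      (∀ x (j : ℤ) (r : Fin m), (π x : ℤ → Fin m) j = r ↔ ((F ^ j) x : Z) ∈ S r) ∧
      (∀ x, (π (F x) : ℤ → Fin m) = shift (π x : ℤ → Fin m)) ∧
      Continuous π ∧ Function.Surjective π ∧ Function.Injective π ∧ IsHomeomorph π := by
  choose orb horb0 horb using fun x : X => (hX x).mp x.2
  have hu : ∀ (x : X) (o : ℤ → Z), o 0 = x → (∀ j, R (o j) (o (j + 1))) → orb x = o :=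
    fun x o h0 h => orbit_unique hf hb (horb x) h ((horb0 x).trans h0.symm)
  have hmem : ∀ (x : X) k, orb x k ∈ X := fun x k => (hX _).mpr
    ⟨fun j => orb x (k + j), by simp, fun j => by simpa [add_assoc] using horb x (k + j)⟩
  have horbk : ∀ (x : X) k, orb ⟨orb x k, hmem x k⟩ = fun j => orb x (k + j) := fun x k =>
    hu _ _ (by simp) fun j => by simpa [add_assoc] using horb x (k + j)
  let F : Equiv.Perm X :=
    { toFun := fun x => ⟨orb x 1, hmem x 1⟩
      invFun := fun x => ⟨orb x (-1), hmem x (-1)⟩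
      left_inv := fun x => Subtype.ext (by simp [horbk, horb0])
      right_inv := fun x => Subtype.ext (by simp [horbk, horb0]) }
  have hF1 : ∀ x, F x = ⟨orb x 1, hmem x 1⟩ := fun _ => rfl
  have hFs : ∀ x, F.symm x = ⟨orb x (-1), hmem x (-1)⟩ := fun _ => rfl
  have hF : ∀ (j : ℤ) (x : X), (F ^ j) x = ⟨orb x j, hmem x j⟩ := by
    intro j
    induction j using Int.induction_on with
    | zero => intro x; exact Subtype.ext (horb0 x).symm
    | succ j ih =>
      intro x
      rw [zpow_add_one, Equiv.Perm.mul_apply, ih]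
      apply Subtype.ext
      simp only [hF1, horbk, add_comm]
    | pred j ih =>
      intro x
      rw [zpow_sub_one, Equiv.Perm.mul_apply, ih]
      apply Subtype.ext
      change orb (F.symm x) (-(j : ℤ)) = _
      rw [hFs, horbk]
      simp only [sub_eq_add_neg, add_comm]
  have hΦX : ∀ ℓ, Φ ℓ ∈ X := fun ℓ => by
    obtain ⟨o, h0, ho, -⟩ := hex ℓ
    exact (hX _).mpr ⟨o, h0, ho⟩
  have hit : ∀ (ℓ : Y) j, orb ⟨Φ ℓ, hΦX ℓ⟩ j ∈ S ((ℓ : ℤ → Fin m) j) := fun ℓ => by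
    obtain ⟨o, h0, ho, h1⟩ := hex ℓ
    rwa [hu ⟨Φ ℓ, hΦX ℓ⟩ o h0 ho]
  let Ψ : Y → X := fun ℓ => ⟨Φ ℓ, hΦX ℓ⟩
  -- Injective because an orbit determines its itinerary, surjective because an itinerary determines
  -- the initial point. Compactness of the word space then makes the inverse continuous.
  have hΨ : Function.Bijective Ψ := by
    constructor
    · intro ℓ ℓ' h
      apply Subtype.ext
      funext j
      have h1 := hit ℓ j
      have h2 := hit ℓ' j
      change orb (Ψ ℓ) j ∈ _ at h1
      rw [h] at h1
      exact hS _ _ _ h1 h2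
    · intro x
      obtain ⟨ℓ, hℓ, h⟩ := hword _ (horb x)
      exact ⟨⟨ℓ, hℓ⟩, Subtype.ext ((huniq _ (horb x) ⟨ℓ, hℓ⟩ h).symm.trans (horb0 x))⟩
  have : CompactSpace Y := isCompact_iff_compactSpace.mp hY.isCompact
  have hΨc : Continuous (Equiv.ofBijective Ψ hΨ) := hΦ.subtype_mk hΦX
  let e := hΨc.homeoOfEquivCompactToT2
  have hπ : ∀ x j r, (e.symm x : ℤ → Fin m) j = r ↔ orb x j ∈ S r := by
    intro x j r
    have h1 := hit (e.symm x) j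
    have h2 : (⟨Φ (e.symm x), hΦX _⟩ : X) = x := e.apply_symm_apply x
    rw [h2] at h1
    exact ⟨fun h => h ▸ h1, fun h => hS _ _ _ h1 h⟩
  refine ⟨F, e.symm, fun x y => ⟨fun h => ?_, ?_⟩, fun x j r => ?_, fun x => ?_,
    e.symm.continuous, e.symm.surjective, e.symm.injective, e.symm.isHomeomorph⟩
  · have := horb x 0
    rw [horb0, zero_add] at this
    exact hf _ _ _ this h
  · rintro rfl
    have := horb x 0
    rwa [horb0, zero_add] at this
  · rw [hπ, hF]
  · funext j
    rw [hπ, hF1, horbk]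
    have := (hπ x (j + 1) _).mp rfl
    change orb x (1 + j) ∈ S ((e.symm x : ℤ → Fin m) (j + 1))
    rwa [add_comm 1 j]

end Conjugacy

end RefractionBilliard

/-! ### Snell's law and the first return map in terms of the balance equation. -/

namespace RefractionBilliard
open scoped InnerProductSpace ComplexConjugate

section Refraction

variable {n u u' : ℂ}

theorem norm_sq_eq_inner_sq (hn : ‖n‖ = 1) (u : ℂ) :
    ‖u‖ ^ 2 = ⟪u, Complex.I * n⟫_ℝ ^ 2 + ⟪u, n⟫_ℝ ^ 2 := by
  have h0 : ⟪Complex.I * n, n⟫_ℝ = 0 := by simp only [Complex.inner]; simp; ring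
  conv_lhs => rw [inner_I_mul_eq n u hn]
  rw [norm_add_sq_real, real_inner_smul_left, real_inner_smul_right, h0, norm_smul, norm_smul,
    norm_mul, Complex.norm_I, hn, Real.norm_eq_abs, Real.norm_eq_abs]
  simp

/-- A vector is determined by its norm, its tangential component, and its normal direction. -/
theorem eq_of_tangential_eq (hn : ‖n‖ = 1) (h : ‖u‖ ^ 2 = ‖u'‖ ^ 2)
    (ht : ⟪u, Complex.I * n⟫_ℝ = ⟪u', Complex.I * n⟫_ℝ) (hpos : 0 < ⟪u, n⟫_ℝ * ⟪u', n⟫_ℝ) :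
    u = u' := by
  rw [norm_sq_eq_inner_sq hn u, norm_sq_eq_inner_sq hn u', ht] at h
  have : ⟪u, n⟫_ℝ = ⟪u', n⟫_ℝ := by
    rcases sq_eq_sq_iff_eq_or_eq_neg.mp (add_left_cancel h) with h1 | h1
    · exact h1
    · rw [h1] at hpos; nlinarith [sq_nonneg ⟪u', n⟫_ℝ]
  rw [inner_I_mul_eq n u hn, inner_I_mul_eq n u' hn, ht, this]

variable {B : Billiard} {ξ : ℝ} {v : ℂ}

theorem Billiard.I_mul_normal (B : Billiard) (ξ : ℝ) : Complex.I * B.normal ξ = B.tangent ξ := by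
  rw [Billiard.normal, Billiard.tangent]
  linear_combination (-deriv B.γ ξ) * Complex.I_sq

theorem Billiard.inner_refract (ht : ‖B.normal ξ‖ = 1) :
    ⟪B.refract ξ v, B.tangent ξ⟫_ℝ = ⟪v, B.tangent ξ⟫_ℝ ∧
    ⟪B.refract ξ v, B.normal ξ⟫_ℝ = Real.sign ⟪v, B.normal ξ⟫_ℝ *
      √(2 * B.innerPotential (B.γ ξ) - ⟪v, B.tangent ξ⟫_ℝ ^ 2) := by
  have h0 : ⟪B.tangent ξ, B.normal ξ⟫_ℝ = 0 := by
    rw [← B.I_mul_normal]; simp only [Complex.inner]; simp; ring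
  have h1 : ‖B.tangent ξ‖ = 1 := by rw [← B.I_mul_normal, norm_mul, Complex.norm_I, ht, one_mul]
  have h2 : ⟪B.normal ξ, B.tangent ξ⟫_ℝ = 0 := by rw [real_inner_comm, h0]
  constructor
  · rw [Billiard.refract, inner_add_left, real_inner_smul_left, real_inner_smul_left, h2,
      real_inner_self_eq_norm_sq, h1]; ring
  · rw [Billiard.refract, inner_add_left, real_inner_smul_left, real_inner_smul_left, h0,
      real_inner_self_eq_norm_sq, ht]; ring

theorem Billiard.norm_refract_sq (ht : ‖B.normal ξ‖ = 1)
    (hv : ⟪v, B.tangent ξ⟫_ℝ ^ 2 < 2 * B.innerPotential (B.γ ξ)) (h0 : ⟪v, B.normal ξ⟫_ℝ ≠ 0) :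
    ‖B.refract ξ v‖ ^ 2 = 2 * B.innerPotential (B.γ ξ) := by
  obtain ⟨h1, h2⟩ := B.inner_refract (v := v) ht
  rw [norm_sq_eq_inner_sq ht, B.I_mul_normal, h1, h2, mul_pow, Real.sq_sqrt (by linarith)]
  rcases Real.sign_apply_eq_of_ne_zero _ h0 with h | h <;> rw [h] <;> ring

/-- On the inner energy shell a velocity is determined by its tangential component and the side to
which it points, so only these remain to be compared. -/
theorem Billiard.refract_eq_iff (ht : ‖B.normal ξ‖ = 1)
    (hv : ⟪v, B.tangent ξ⟫_ℝ ^ 2 < 2 * B.innerPotential (B.γ ξ))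
    (hu : ‖u‖ ^ 2 = 2 * B.innerPotential (B.γ ξ)) :
    B.refract ξ v = u ↔ ⟪v, B.tangent ξ⟫_ℝ = ⟪u, B.tangent ξ⟫_ℝ ∧
      0 < ⟪v, B.normal ξ⟫_ℝ * ⟪u, B.normal ξ⟫_ℝ := by
  obtain ⟨h1, h2⟩ := B.inner_refract (v := v) ht
  have hs : 0 < √(2 * B.innerPotential (B.γ ξ) - ⟪v, B.tangent ξ⟫_ℝ ^ 2) :=
    Real.sqrt_pos.mpr (by linarith)
  have hsign : ∀ x : ℝ, x ≠ 0 → 0 < x * Real.sign x := by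
    intro x hx
    rcases lt_or_gt_of_ne hx with h | h
    · rw [Real.sign_of_neg h]; linarith
    · rw [Real.sign_of_pos h]; linarith
  constructor
  · rintro rfl
    refine ⟨h1.symm, ?_⟩
    -- With `Real.sign 0 = 0` a tangential `v` would be left unchanged, and its speed is too small
    -- for the inner shell.
    have h0 : ⟪v, B.normal ξ⟫_ℝ ≠ 0 := by
      intro h0
      rw [norm_sq_eq_inner_sq ht, B.I_mul_normal, h1, h2, h0, Real.sign_zero] at hu
      linarith
    rw [h2, ← mul_assoc]
    exact mul_pos (hsign _ h0) hs
  · rintro ⟨h3, h4⟩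
    have h0 : ⟪v, B.normal ξ⟫_ℝ ≠ 0 := left_ne_zero_of_mul h4.ne'
    refine eq_of_tangential_eq ht ((B.norm_refract_sq ht hv h0).trans hu.symm) ?_ ?_
    · rw [B.I_mul_normal, h1, h3]
    · rw [h2]
      have h5 := mul_pos (mul_pos (hsign _ h0) hs) h4
      have h6 : 0 < ⟪v, B.normal ξ⟫_ℝ ^ 2 := by positivity
      have h7 : (⟪v, B.normal ξ⟫_ℝ * Real.sign ⟪v, B.normal ξ⟫_ℝ *
          √(2 * B.innerPotential (B.γ ξ) - ⟪v, B.tangent ξ⟫_ℝ ^ 2)) *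
            (⟪v, B.normal ξ⟫_ℝ * ⟪u, B.normal ξ⟫_ℝ) = ⟪v, B.normal ξ⟫_ℝ ^ 2 *
          (Real.sign ⟪v, B.normal ξ⟫_ℝ *
            √(2 * B.innerPotential (B.γ ξ) - ⟪v, B.tangent ξ⟫_ℝ ^ 2) * ⟪u, B.normal ξ⟫_ℝ) := by
        ring
      rw [h7] at h5
      exact pos_of_mul_pos_right h5 h6.le

end Refraction

theorem Windows.NA.symm {m : ℕ} {W : Windows m} {γ : ℝ → ℂ} {i j : Fin m} (h : W.NA γ i j) :
    W.NA γ j i := fun x hx y hy hxy => h y hy x hx hxy.symm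

/-- Windows between which the outer and inner arcs are those given by `outV` and `inU`. -/
structure IsAdapted {m : ℕ} (B : Billiard) (W : Windows m) (L κ ρ l : ℝ) : Prop where
  domain : IsDomainWithBoundary B.D B.γ L
  omega_pos : 0 < B.ω
  mu_pos : 0 < B.μ
  kappa_mem : κ ∈ Ioo (0 : ℝ) 1
  rho_pos : 0 < ρ
  scale_pos : 0 < l
  outer_energy : 2 * B.E = B.ω ^ 2 * ρ
  inner_energy : B.E + B.h = 2 * l ^ 2
  energy_le : 2 * B.E ≤ 4 * l ^ 2
  outer : ∀ i, ∀ x ∈ W.I i, ∀ y ∈ W.I i,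
    OuterGood B.D ρ B.ω κ (B.γ x) (B.normal x) (B.γ y) (B.normal y)
  inner : ∀ i j, W.NA B.γ i j → ∀ x ∈ W.I i, ∀ y ∈ W.I j,
    InnerGood B.D B.μ l √(2 * B.E) (B.γ x) (B.normal x) (B.γ y) (B.normal y)
  eq_of_mem : ∀ x i j, x ∈ W.I i → x ∈ W.I j → i = j
  inj : ∀ i j, ∀ x ∈ W.I i, ∀ y ∈ W.I j, B.γ x = B.γ y → x = y

namespace IsAdapted

variable {m : ℕ} {B : Billiard} {W : Windows m} {L κ ρ l : ℝ}

theorem norm_normal (h : IsAdapted B W L κ ρ l) (ξ : ℝ) : ‖B.normal ξ‖ = 1 :=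
  h.domain.norm_normal ξ

theorem two_mul_outerPotential (h : IsAdapted B W L κ ρ l) (p : ℂ) :
    2 * B.outerPotential p = B.ω ^ 2 * (ρ - ‖p‖ ^ 2) := by
  rw [Billiard.outerPotential]; linear_combination h.outer_energy

theorem two_mul_innerPotential (h : IsAdapted B W L κ ρ l) (p : ℂ) :
    2 * B.innerPotential p = 4 * l ^ 2 + 2 * (B.μ / ‖p‖) := by
  rw [Billiard.innerPotential]; linear_combination 2 * h.inner_energy

theorem tangential_sq_le (h : IsAdapted B W L κ ρ l) {ξ : ℝ} {v : ℂ}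
    (hv : ‖v‖ ^ 2 = 2 * B.outerPotential (B.γ ξ)) : ⟪v, B.tangent ξ⟫_ℝ ^ 2 ≤ 2 * B.E := by
  have h1 := norm_sq_eq_inner_sq (h.norm_normal ξ) v
  rw [B.I_mul_normal, hv, Billiard.outerPotential] at h1
  nlinarith [sq_nonneg ⟪v, B.normal ξ⟫_ℝ, mul_nonneg (sq_nonneg B.ω) (sq_nonneg ‖B.γ ξ‖)]

theorem tangential_sq_lt (h : IsAdapted B W L κ ρ l) {ξ : ℝ} {v : ℂ}
    (hv : ‖v‖ ^ 2 = 2 * B.outerPotential (B.γ ξ)) :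
    ⟪v, B.tangent ξ⟫_ℝ ^ 2 < 2 * B.innerPotential (B.γ ξ) := by
  have h1 := h.tangential_sq_le hv
  have h2 := h.energy_le
  rw [h.two_mul_innerPotential]
  have := norm_pos_iff.mpr (h.domain.ne_zero ξ)
  have := h.mu_pos
  have : 0 < 2 * (B.μ / ‖B.γ ξ‖) := by positivity
  linarith

theorem norm_outV_sq (h : IsAdapted B W L κ ρ l) {i : Fin m} {x y : ℝ} (hx : x ∈ W.I i)
    (hy : y ∈ W.I i) : ‖outV ρ B.ω (B.γ x) (B.γ y)‖ ^ 2 = 2 * B.outerPotential (B.γ x) := by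
  have ho := h.outer i x hx y hy
  rw [RefractionBilliard.norm_outV_sq h.rho_pos ho.disc.le ho.neg_one_lt ho.lt_one,
    h.two_mul_outerPotential]

theorem norm_smul_inU_sq (h : IsAdapted B W L κ ρ l) {i j : Fin m} (hij : W.NA B.γ i j) {x y : ℝ}
    (hx : x ∈ W.I i) (hy : y ∈ W.I j) :
    ‖l • inU (B.γ x) (B.γ y) (B.μ / (2 * l ^ 2))‖ ^ 2 = 2 * B.innerPotential (B.γ x) := by
  have hl := h.scale_pos
  have := norm_pos_iff.mpr (h.domain.ne_zero x)
  rw [norm_smul, mul_pow, (h.inner i j hij x hx y hy).norm_inU_sq hl h.mu_pos,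
    h.two_mul_innerPotential, Real.norm_eq_abs, sq_abs]
  field_simp
  ring

/-- The minus sign is that of reversal. At entry the outer arc arrives with `-outV`, at exit the
inner arc arrives with `-(l • inU)`, so both refractions have this same form. -/
theorem balance_eq_zero_iff (h : IsAdapted B W L κ ρ l) (x y z : ℝ) :
    balance B.γ ρ B.ω B.μ x y z l⁻¹ = 0 ↔ ⟪outV ρ B.ω (B.γ x) (B.γ y), B.tangent x⟫_ℝ =
      -⟪l • inU (B.γ x) (B.γ z) (B.μ / (2 * l ^ 2)), B.tangent x⟫_ℝ := by
  have hl := h.scale_pos.ne'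
  have hν : B.μ * l⁻¹ ^ 2 / 2 = B.μ / (2 * l ^ 2) := by field_simp
  rw [balance, hν, inner_add_left, real_inner_smul_left, real_inner_smul_left, Billiard.tangent]
  generalize ⟪outV ρ B.ω (B.γ x) (B.γ y), deriv B.γ x⟫_ℝ = s
  generalize ⟪inU (B.γ x) (B.γ z) (B.μ / (2 * l ^ 2)), deriv B.γ x⟫_ℝ = t
  rw [inv_mul_eq_div, div_add' _ _ _ hl, div_eq_zero_iff, or_iff_left hl, mul_comm t,
    eq_neg_iff_add_eq_zero]

theorem firstReturn (h : IsAdapted B W L κ ρ l) {r r' : Fin m} (hr : W.NA B.γ r r')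
    {x η y ζ : ℝ} (hx : x ∈ W.I r) (hη : η ∈ W.I r) (hy : y ∈ W.I r') (hζ : ζ ∈ W.I r')
    (h1 : balance B.γ ρ B.ω B.μ η x y l⁻¹ = 0) (h2 : balance B.γ ρ B.ω B.μ y ζ η l⁻¹ = 0) :
    FirstReturn B W κ (x, outV ρ B.ω (B.γ x) (B.γ η)) (y, outV ρ B.ω (B.γ y) (B.γ ζ)) := by
  rw [h.balance_eq_zero_iff] at h1 h2
  have hl := h.scale_pos
  have ho := h.outer r x hx η hη
  have ho' := h.outer r' y hy ζ hζ
  have hi := h.inner r r' hr η hη y hy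
  have hsq := h.norm_outV_sq hη hx
  have hsq' := h.norm_outV_sq hy hζ
  obtain ⟨z, v, T, harc, hz0, hv0, hzT, hvT⟩ := ho.exists_arc h.omega_pos
  obtain ⟨z', v', T', harc', hz0', hv0', hzT', hvT'⟩ := hi.exists_arc hl h.mu_pos
  have hneg : ⟪l • inU (B.γ η) (B.γ y) (B.μ / (2 * l ^ 2)), B.normal η⟫_ℝ < 0 := by
    rw [real_inner_smul_left]; exact mul_neg_of_pos_of_neg hl hi.inner_neg
  have hneg' : ⟪l • inU (B.γ y) (B.γ η) (B.μ / (2 * l ^ 2)), B.normal y⟫_ℝ < 0 := by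
    rw [real_inner_smul_left]; exact mul_neg_of_pos_of_neg hl hi.inner_neg'
  have hk : ∀ w : ℂ, 0 ≤ κ * ‖w‖ := fun w => mul_nonneg h.kappa_mem.1.le (norm_nonneg w)
  refine ⟨r, r', (η, -outV ρ B.ω (B.γ η) (B.γ x)), ⟨hx, h.norm_outV_sq hx hη, ho.transversal⟩,
    ⟨hη, by rw [norm_neg]; exact hsq, ?_⟩, hr, hy, ⟨z, v, T, harc, hz0, hv0, hzT, hvT⟩,
    ⟨z', v', T', harc', hz0', ?_, hzT', ?_, ?_⟩, hsq'⟩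
  · simp only [inner_neg_left, norm_neg, neg_lt_neg_iff]
    exact ho.transversal'
  · rw [hv0', eq_comm]
    refine (B.refract_eq_iff (h.norm_normal η) (h.tangential_sq_lt (by rw [norm_neg]; exact hsq))
      (h.norm_smul_inU_sq hr hη hy)).mpr ⟨?_, ?_⟩
    · rw [inner_neg_left, h1, neg_neg]
    · refine mul_pos_of_neg_of_neg ?_ hneg
      rw [inner_neg_left, neg_lt_zero]
      exact (hk _).trans_lt ho.transversal'
  · rw [hvT', eq_comm]
    refine (B.refract_eq_iff (h.norm_normal y) (h.tangential_sq_lt hsq')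
      (by rw [norm_neg]; exact h.norm_smul_inU_sq hr.symm hy hη)).mpr ⟨?_, ?_⟩
    · rw [inner_neg_left]; exact h2
    · refine mul_pos ((hk _).trans_lt ho'.transversal) ?_
      rw [inner_neg_left, neg_pos]; exact hneg'
  · rw [hvT', inner_neg_left, neg_pos]; exact hneg'

/-- The converse of `firstReturn`, by uniqueness of the arcs. The balance equation at `q` is only
half available: its outer velocity is identified as an `outV` when the next return is known. -/
theorem exists_of_firstReturn (h : IsAdapted B W L κ ρ l) {p q : ℝ × ℂ}
    (hpq : FirstReturn B W κ p q) :
    ∃ (r r' : Fin m) (η : ℝ), W.NA B.γ r r' ∧ p.1 ∈ W.I r ∧ η ∈ W.I r ∧ q.1 ∈ W.I r' ∧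
      p.2 = outV ρ B.ω (B.γ p.1) (B.γ η) ∧ balance B.γ ρ B.ω B.μ η p.1 q.1 l⁻¹ = 0 ∧
      ⟪q.2, B.tangent q.1⟫_ℝ =
        -⟪l • inU (B.γ q.1) (B.γ η) (B.μ / (2 * l ^ 2)), B.tangent q.1⟫_ℝ ∧
      0 < ⟪q.2, B.normal q.1⟫_ℝ ∧ ‖q.2‖ ^ 2 = 2 * B.outerPotential (B.γ q.1) := by
  obtain ⟨r, r', x₁, hp, hx₁, hr, hq, ⟨z, v, T, harc, hz0, hv0, hzT, hvT⟩,
    ⟨z', v', T', harc', hz0', hv0', hzT', hvT', hpos⟩, hq2⟩ := hpq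
  have hl := h.scale_pos
  have ho := h.outer r p.1 hp.1 x₁.1 hx₁.1
  have hi := h.inner r r' hr x₁.1 hx₁.1 q.1 hq
  obtain ⟨e1, e2⟩ := ho.velocity_eq h.omega_pos h.rho_pos h.kappa_mem harc hz0 hzT
    (by rw [hv0, hp.2.1, h.two_mul_outerPotential]) (by rw [hv0]; exact hp.2.2)
    (by rw [hvT]; exact hx₁.2.2)
  rw [hv0] at e1
  rw [hvT] at e2
  have hlt := h.tangential_sq_lt hx₁.2.1
  have hn1 : ⟪x₁.2, B.normal x₁.1⟫_ℝ < 0 := hx₁.2.2.trans_le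
    (neg_nonpos.mpr (mul_nonneg h.kappa_mem.1.le (norm_nonneg _)))
  have hn := h.norm_normal x₁.1
  obtain ⟨f1, f2⟩ := hi.velocity_eq hl h.mu_pos harc' hz0' hzT' (h.domain.notMem _)
    (h.domain.notMem _) (h.domain.ne_zero _)
    (by rw [hv0', B.norm_refract_sq hn hlt hn1.ne, h.two_mul_innerPotential]; ring)
    (by
      rw [hv0', (B.inner_refract hn).2, Real.sign_of_neg hn1]
      have := Real.sqrt_pos.mpr (sub_pos.mpr hlt)
      linarith)
    (by
      rw [hv0', B.I_mul_normal, (B.inner_refract hn).1]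
      exact Real.abs_le_sqrt (h.tangential_sq_le hx₁.2.1))
  rw [hv0'] at f1
  rw [hvT'] at f2
  rw [B.refract_eq_iff hn hlt (h.norm_smul_inU_sq hr hx₁.1 hq)] at f1
  rw [B.refract_eq_iff (h.norm_normal _) (h.tangential_sq_lt hq2)
    (by rw [norm_neg]; exact h.norm_smul_inU_sq hr.symm hq hx₁.1)] at f2
  refine ⟨r, r', x₁.1, hr, hp.1, hx₁.1, hq, e1, ?_, ?_, ?_, hq2⟩
  · rw [h.balance_eq_zero_iff, ← f1.1, e2, inner_neg_left, neg_neg]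
  · rw [f2.1, inner_neg_left]
  · have : 0 < -⟪l • inU (B.γ q.1) (B.γ x₁.1) (B.μ / (2 * l ^ 2)), B.normal q.1⟫_ℝ := by
      rw [real_inner_smul_left, neg_pos]; exact mul_neg_of_pos_of_neg hl hi.inner_neg'
    rw [← inner_neg_left] at this
    exact pos_of_mul_pos_left f2.2 this.le

/-- Both arcs end when the same harmonic motion first comes back to the closure of `D`. -/
theorem eq_of_outV_eq (h : IsAdapted B W L κ ρ l) {i : Fin m} {x y y' : ℝ} (hx : x ∈ W.I i)
    (hy : y ∈ W.I i) (hy' : y' ∈ W.I i)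
    (heq : outV ρ B.ω (B.γ x) (B.γ y) = outV ρ B.ω (B.γ x) (B.γ y')) : y = y' := by
  obtain ⟨z, v, T, harc, hz0, hv0, hzT, -⟩ := (h.outer i x hx y hy).exists_arc h.omega_pos
  obtain ⟨z', v', T', harc', hz0', hv0', hzT', -⟩ := (h.outer i x hx y' hy').exists_arc h.omega_pos
  have := Billiard.IsOuterArc.end_eq h.omega_pos.ne' harc harc' (by rw [hz0, hz0'])
    (by rw [hv0, hv0', heq]) (by rw [hzT]; exact h.domain.mem_closure y)
    (by rw [hzT']; exact h.domain.mem_closure y')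
  rw [hzT, hzT'] at this
  exact h.inj i i y hy y' hy' this

theorem eq_of_inU_tangential_eq (h : IsAdapted B W L κ ρ l) {i j j' : Fin m}
    (hij : W.NA B.γ i j) (hij' : W.NA B.γ i j') {x y y' : ℝ} (hx : x ∈ W.I i) (hy : y ∈ W.I j)
    (hy' : y' ∈ W.I j') (heq : ⟪l • inU (B.γ x) (B.γ y) (B.μ / (2 * l ^ 2)), B.tangent x⟫_ℝ =
      ⟪l • inU (B.γ x) (B.γ y') (B.μ / (2 * l ^ 2)), B.tangent x⟫_ℝ) : y = y' := by
  have hl := h.scale_pos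
  have hi := h.inner i j hij x hx y hy
  have hi' := h.inner i j' hij' x hx y' hy'
  have hU := eq_of_tangential_eq (h.norm_normal x)
    ((h.norm_smul_inU_sq hij hx hy).trans (h.norm_smul_inU_sq hij' hx hy').symm)
    (by rwa [B.I_mul_normal])
    (by
      rw [real_inner_smul_left, real_inner_smul_left]
      exact mul_pos_of_neg_of_neg (mul_neg_of_pos_of_neg hl hi.inner_neg)
        (mul_neg_of_pos_of_neg hl hi'.inner_neg))
  exact h.inj j j' y hy y' hy' (hi.end_eq hi' hl h.mu_pos (smul_right_injective ℂ hl.ne' hU)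
    (h.domain.notMem y) (h.domain.notMem y'))

theorem firstReturn_right_unique (h : IsAdapted B W L κ ρ l) {p q q' : ℝ × ℂ}
    (hq : FirstReturn B W κ p q) (hq' : FirstReturn B W κ p q') : q = q' := by
  obtain ⟨r, s, η, hrs, hp, hη, hqs, hv, hb, ht, hpos, hn⟩ := h.exists_of_firstReturn hq
  obtain ⟨r', s', η', hrs', hp', hη', hqs', hv', hb', ht', hpos', hn'⟩ :=
    h.exists_of_firstReturn hq'
  obtain rfl := h.eq_of_mem _ _ _ hp hp'
  obtain rfl := h.eq_of_outV_eq hp hη hη' (hv.symm.trans hv')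
  rw [h.balance_eq_zero_iff] at hb hb'
  have h1 : q.1 = q'.1 := h.eq_of_inU_tangential_eq hrs hrs' hη hqs hqs' (by linarith)
  obtain ⟨y, w⟩ := q
  obtain ⟨y', w'⟩ := q'
  obtain rfl : y = y' := h1
  refine Prod.ext rfl (eq_of_tangential_eq (h.norm_normal y) (hn.trans hn'.symm) ?_
    (mul_pos hpos hpos'))
  rw [B.I_mul_normal]
  exact ht.trans ht'.symm

/-- The forward argument run backwards: the tangential velocity at `q` determines the reversed inner
arc, hence `η` and its window; balance at `η` then determines the reversed outer arc. -/
theorem firstReturn_left_unique (h : IsAdapted B W L κ ρ l) {p p' q : ℝ × ℂ}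
    (hp : FirstReturn B W κ p q) (hp' : FirstReturn B W κ p' q) : p = p' := by
  obtain ⟨r, s, η, hrs, hpr, hη, hqs, hv, hb, ht, hpos, hn⟩ := h.exists_of_firstReturn hp
  obtain ⟨r', s', η', hrs', hpr', hη', hqs', hv', hb', ht', hpos', hn'⟩ :=
    h.exists_of_firstReturn hp'
  obtain rfl := h.eq_of_mem _ _ _ hqs hqs'
  obtain rfl := h.eq_of_inU_tangential_eq hrs.symm hrs'.symm hqs hη hη' (by linarith)
  obtain rfl := h.eq_of_mem _ _ _ hη hη'
  rw [h.balance_eq_zero_iff] at hb hb'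
  have h1 : outV ρ B.ω (B.γ η) (B.γ p.1) = outV ρ B.ω (B.γ η) (B.γ p'.1) := by
    refine eq_of_tangential_eq (h.norm_normal η)
      ((h.norm_outV_sq hη hpr).trans (h.norm_outV_sq hη hpr').symm) ?_ ?_
    · rw [B.I_mul_normal, hb, hb']
    · exact mul_pos ((mul_nonneg h.kappa_mem.1.le (norm_nonneg _)).trans_lt
        (h.outer r _ hpr _ hη).transversal') ((mul_nonneg h.kappa_mem.1.le (norm_nonneg _)).trans_lt
        (h.outer r _ hpr' _ hη).transversal')
  have h2 := h.eq_of_outV_eq hη hpr hpr' h1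
  exact Prod.ext h2 (by rw [hv, hv', h2])

end IsAdapted
end RefractionBilliard

/-! ### Coding of complete orbits by words, and neighbourhoods of the parameters. -/

namespace RefractionBilliard
open scoped InnerProductSpace ComplexConjugate

section Words

variable {m : ℕ} {W : Windows m} {γ : ℝ → ℂ}

theorem Windows.isClosed_words : IsClosed (W.words γ) := by
  have : W.words γ = ⋂ j : ℤ, (fun ℓ : ℤ → Fin m => (ℓ j, ℓ (j + 1))) ⁻¹'
      {p | W.NA γ p.1 p.2} := by
    ext ℓ
    simp [Windows.words]
  rw [this]
  exact isClosed_iInter fun j => (isClosed_discrete _).preimage (by fun_prop)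

theorem Windows.na_side {ℓ : ℤ → Fin m} (hℓ : ℓ ∈ W.words γ) (k : ℤ) (b : Bool) :
    W.NA γ (ℓ k) (ℓ (k + side b)) := by
  cases b with
  | true => exact hℓ k
  | false =>
    have h1 : W.NA γ (ℓ (k + -1)) (ℓ (k + -1 + 1)) := hℓ (k + -1)
    rw [neg_add_cancel_right] at h1
    exact h1.symm

end Words

/-- The Newton step for the balance equation, with slopes `A`. -/
noncomputable def newtonStep {ι : Type*} (γ : ℝ → ℂ) (ρ ω μ δ : ℝ) (A : ι → ι → ℝ) (i j : ι)
    (x y z : ℝ) : ℝ := x - balance γ ρ ω μ x y z δ / A i j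

theorem newtonStep_eq_iff {ι : Type*} {γ : ℝ → ℂ} {ρ ω μ δ : ℝ} {A : ι → ι → ℝ} {i j : ι}
    (hA : A i j ≠ 0) {x y z : ℝ} :
    newtonStep γ ρ ω μ δ A i j x y z = x ↔ balance γ ρ ω μ x y z δ = 0 := by
  rw [newtonStep, sub_eq_self, div_eq_zero_iff, or_iff_left hA]

/-- Two radii have different tasks: solutions are constructed within `ρ₀`, hence inside the compact
windows, while uniqueness holds in the larger `ε`-neighbourhood, which contains all orbits. -/
theorem IsAdapted.exists_conjugacy {m : ℕ} {B : Billiard} {W : Windows m} {L κ ρ l : ℝ}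
    (h : IsAdapted B W L κ ρ l) {A : Fin m → Fin m → ℝ} {ξ : Fin m → ℝ} {ε ρ₀ : ℝ}
    (hA : ∀ i j, A i j ≠ 0)
    (hT : IsContraction (newtonStep B.γ ρ B.ω B.μ l⁻¹ A) (W.NA B.γ) ξ ε) (h0 : 0 ≤ ρ₀)
    (hε : ρ₀ < ε) (hc : ∀ i j, W.NA B.γ i j →
      |newtonStep B.γ ρ B.ω B.μ l⁻¹ A i j (ξ i) (ξ i) (ξ j) - ξ i| ≤ ρ₀ / 2)
    (hsub : ∀ i, ∀ x ∈ W.I i, |x - ξ i| < ε) (hsup : ∀ i x, |x - ξ i| ≤ ρ₀ → x ∈ W.I i) :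
    ∃ (F : Equiv.Perm (invariantSet B W κ)) (π : invariantSet B W κ → W.words B.γ),
      (∀ (x : invariantSet B W κ) (y : ℝ × ℂ), FirstReturn B W κ x y ↔ (F x : ℝ × ℂ) = y) ∧
      (∀ x (j : ℤ) (r : Fin m),
        (π x : ℤ → Fin m) j = r ↔ ((F ^ j) x : ℝ × ℂ).1 ∈ W.I r) ∧
      (∀ x, (π (F x) : ℤ → Fin m) = shift (π x : ℤ → Fin m)) ∧
      Continuous π ∧ Function.Surjective π ∧ Function.Injective π ∧ IsHomeomorph π := by
  have hna : ∀ ℓ ∈ W.words B.γ, ∀ k b, W.NA B.γ (ℓ k) (ℓ (k + side b)) :=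
    fun ℓ hℓ k b => Windows.na_side hℓ k b
  choose s hs hsρ using fun ℓ : W.words B.γ =>
    hT.exists_isSolution h0 hε hc (hna ℓ ℓ.2)
  have hsε : ∀ (ℓ : W.words B.γ) k b, |s ℓ k b - ξ ((ℓ : ℤ → Fin m) k)| < ε :=
    fun ℓ k b => (hsρ ℓ k b).trans_lt hε
  have hsI : ∀ (ℓ : W.words B.γ) k b, s ℓ k b ∈ W.I ((ℓ : ℤ → Fin m) k) :=
    fun ℓ k b => hsup _ _ (hsρ ℓ k b)
  have hcont := fun b => hT.continuous_solution hna hs hsε b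
  have hcγ : Continuous B.γ := h.domain.contDiff.continuous
  -- The unknown `s ℓ k false` is the start and `s ℓ k true` the end of the outer arc over the
  -- `k`-th window. The return from `j` to `j + 1` uses the equations at `(j, true)` and `(j + 1,
  -- false)`.
  refine RefractionBilliard.exists_conjugacy (R := FirstReturn B W κ) (fun i => {p | p.1 ∈ W.I i})
    (X := invariantSet B W κ) (Y := W.words B.γ) (fun _ => Iff.rfl) Windows.isClosed_words
    (fun _ _ _ => h.firstReturn_right_unique) (fun _ _ _ => h.firstReturn_left_unique)
    (fun z i j => h.eq_of_mem z.1 i j)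
    (Φ := fun ℓ => (s ℓ 0 false, outV ρ B.ω (B.γ (s ℓ 0 false)) (B.γ (s ℓ 0 true)))) ?_ ?_ ?_ ?_
  · refine (hcont false).prodMk ?_
    rw [continuous_iff_continuousAt]
    intro ℓ
    have ho := h.outer _ _ (hsI ℓ 0 false) _ (hsI ℓ 0 true)
    have hpair : Continuous fun ℓ => (B.γ (s ℓ 0 false), B.γ (s ℓ 0 true)) :=
      (hcγ.comp (hcont false)).prodMk (hcγ.comp (hcont true))
    exact ContinuousAt.comp (g := fun z : ℂ × ℂ => outV ρ B.ω z.1 z.2)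
      (f := fun ℓ => (B.γ (s ℓ 0 false), B.γ (s ℓ 0 true))) (x := ℓ)
      (contDiffAt_outV ho.disc ho.neg_one_lt ho.lt_one).continuousAt hpair.continuousAt
  · intro ℓ
    refine ⟨fun j => (s ℓ j false, outV ρ B.ω (B.γ (s ℓ j false)) (B.γ (s ℓ j true))), rfl,
      fun j => ?_, fun j => hsI ℓ j false⟩
    refine h.firstReturn (ℓ.2 j) (hsI ℓ j false) (hsI ℓ j true) (hsI ℓ _ false) (hsI ℓ _ true)
      ((newtonStep_eq_iff (hA _ _)).mp (hs ℓ j true)) ?_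
    have h2 := (newtonStep_eq_iff (hA _ _)).mp (hs ℓ (j + 1) false)
    rwa [show j + 1 + side false = j by simp [side]] at h2
  · intro o ho
    choose r r' η hr hor hη hor' _ _ _ _ _ using fun j => h.exists_of_firstReturn (ho j)
    refine ⟨r, fun j => ?_, hor⟩
    rw [h.eq_of_mem _ _ _ (hor (j + 1)) (hor' j)]
    exact hr j
  · intro o ho ℓ hℓ
    choose r r' η hr hor hη hor' hv hbal htan _ _ using fun j => h.exists_of_firstReturn (ho j)
    have hrℓ : ∀ j, r j = (ℓ : ℤ → Fin m) j := fun j => h.eq_of_mem _ _ _ (hor j) (hℓ j)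
    -- The base points of an orbit and the intermediate ends of its outer arcs form a solution. The
    -- exit equation at `k` combines the arrival from return `k - 1` with the outer velocity
    -- identified in return `k`.
    let s' : ℤ → Bool → ℝ := fun j b => if b then η j else (o j).1
    have hs' : IsSolution (newtonStep B.γ ρ B.ω B.μ l⁻¹ A) ℓ s' := by
      intro k b
      rw [newtonStep_eq_iff (hA _ _)]
      cases b with
      | true => exact hbal k
      | false =>
        change balance B.γ ρ B.ω B.μ (o k).1 (η k) (η (k + -1)) l⁻¹ = 0
        have h1 := htan (k + -1)
        rw [neg_add_cancel_right] at h1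
        rw [h.balance_eq_zero_iff, ← hv k, h1]
    have hsε' : ∀ k b, |s' k b - ξ ((ℓ : ℤ → Fin m) k)| < ε := by
      intro k b
      cases b with
      | true => exact hsub _ _ (hrℓ k ▸ hη k)
      | false => exact hsub _ _ (hℓ k)
    have heq := hT.isSolution_unique (hna ℓ ℓ.2) hs' (hs ℓ) hsε' (hsε ℓ)
    have e1 : (o 0).1 = s ℓ 0 false := congrFun (congrFun heq 0) false
    have e2 : η 0 = s ℓ 0 true := congrFun (congrFun heq 0) true
    exact Prod.ext e1 (by rw [hv 0, e1, e2])

section Parameters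

theorem eventually_box {p : ℝ → ℝ → ℝ → Prop} {a b : ℝ}
    (h : ∀ᶠ w : ℝ × ℝ × ℝ in 𝓝 (a, b, 0), p w.1 w.2.1 w.2.2) :
    ∀ᶠ ε : ℝ in 𝓝[>] 0, ∀ x y δ, |x - a| < ε → |y - b| < ε → |δ| < ε → p x y δ := by
  obtain ⟨r, hr, hball⟩ := Metric.eventually_nhds_iff.mp h
  filter_upwards [Ioo_mem_nhdsGT hr] with ε hε x y δ hx hy hδ
  refine hball (y := (x, y, δ)) ?_
  simp only [Prod.dist_eq, Real.dist_eq, sub_zero, max_lt_iff]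
  exact ⟨hx.trans hε.2, hy.trans hε.2, hδ.trans hε.2⟩

theorem eventually_box_two {p : ℝ → ℝ → Prop} {a b : ℝ}
    (h : ∀ᶠ w : ℝ × ℝ in 𝓝 (a, b), p w.1 w.2) :
    ∀ᶠ ε : ℝ in 𝓝[>] 0, ∀ x y, |x - a| < ε → |y - b| < ε → p x y := by
  obtain ⟨r, hr, hball⟩ := Metric.eventually_nhds_iff.mp h
  filter_upwards [Ioo_mem_nhdsGT hr] with ε hε x y hx hy
  refine hball (y := (x, y)) ?_
  simp only [Prod.dist_eq, Real.dist_eq, max_lt_iff]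
  exact ⟨hx.trans hε.2, hy.trans hε.2⟩

variable {D : Set ℂ} {γ : ℝ → ℂ} {L : ℝ}

theorem IsDomainWithBoundary.eventually_injective (hD : IsDomainWithBoundary D γ L) (ξ : ℝ) :
    ∀ᶠ w : ℝ × ℝ in 𝓝 (ξ, ξ), γ w.1 = γ w.2 → w.1 = w.2 := by
  filter_upwards [hD.eventually_chord ξ (show (0 : ℝ) < 1 / 2 by norm_num)] with w hw heq
  rw [heq, sub_self, zero_sub, norm_neg, norm_smul, hD.unit_speed, mul_one,
    Real.norm_eq_abs] at hw
  have := abs_nonneg (w.2 - w.1)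
  have h0 : |w.2 - w.1| = 0 := by linarith
  linarith [abs_eq_zero.mp h0]

/-- At most one other central configuration is antipodal to a given point. -/
theorem IsCentralConfiguration.eq_of_antipodal (hD : IsDomainWithBoundary D γ L) {ξ η η' : ℝ}
    (h : IsCentralConfiguration γ η) (h1 : Antipodal γ ξ η) (h2 : Antipodal γ ξ η') :
    γ η = γ η' := by
  rw [Antipodal, mem_segment_iff_sameRay, zero_sub, sub_zero] at h1 h2
  have h3 : SameRay ℝ (γ η) (γ η') := h1.symm.trans h2 fun h0 =>
    absurd (neg_eq_zero.mp h0) (hD.ne_zero ξ)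
  obtain ⟨t, ht, h4⟩ := h3.exists_nonneg_left (hD.ne_zero η)
  rw [← h4]
  exact (h.2 t ht ⟨η', h4.symm⟩).symm

/-- For `m ≥ 3` there are two other symbols, and star-convexity allows only one of them to be
antipodal to `i`. -/
theorem exists_ne_not_antipodal (hD : IsDomainWithBoundary D γ L) {m : ℕ} (hm : 2 ≤ m)
    {ξ : Fin m → ℝ} (hdistinct : Function.Injective fun i => γ (ξ i))
    (hξ : ∀ i, IsCentralConfiguration γ (ξ i))
    (hanti : m = 2 → ∀ i j, ¬ Antipodal γ (ξ i) (ξ j)) (i : Fin m) :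
    ∃ j, j ≠ i ∧ ¬ Antipodal γ (ξ i) (ξ j) := by
  have hcard : (Finset.univ.erase i).card = m - 1 := by
    rw [Finset.card_erase_of_mem (Finset.mem_univ i), Finset.card_univ, Fintype.card_fin]
  rcases hm.eq_or_lt with h2 | h3
  · obtain ⟨j, hj⟩ := Finset.card_pos.mp (show 0 < (Finset.univ.erase i).card by omega)
    exact ⟨j, Finset.ne_of_mem_erase hj, hanti h2.symm i j⟩
  · obtain ⟨j, hj, k, hk, hjk⟩ :=
      Finset.one_lt_card.mp (show 1 < (Finset.univ.erase i).card by omega)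
    by_contra hno
    push Not at hno
    exact hjk (hdistinct ((hξ j).eq_of_antipodal hD (hno j (Finset.ne_of_mem_erase hj))
      (hno k (Finset.ne_of_mem_erase hk))))

theorem not_antipodal_self (hD : IsDomainWithBoundary D γ L) (ξ : ℝ) : ¬ Antipodal γ ξ ξ := by
  have := norm_pos_iff.mpr (hD.ne_zero ξ)
  rw [← nonantipodal_iff, real_inner_self_eq_norm_sq]
  positivity

end Parameters

end RefractionBilliard

/-! ### A common radius, and the main theorem. -/

namespace RefractionBilliard
open scoped InnerProductSpace ComplexConjugate

theorem eventually_lt_of_pos {r : ℝ} (hr : 0 < r) : ∀ᶠ ε : ℝ in 𝓝[>] 0, ε < r :=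
  Filter.mem_of_superset (Ioo_mem_nhdsGT hr) fun _ h => h.2

/-- A common radius for the neighbourhoods of finitely many central configurations in which all
arcs and the balance equation are controlled. -/
theorem exists_radius {D : Set ℂ} {γ : ℝ → ℂ} {L : ℝ} (hD : IsDomainWithBoundary D γ L) {m : ℕ}
    {ξ : Fin m → ℝ} (hdistinct : Function.Injective fun i => γ (ξ i))
    (hξ : ∀ i, IsNondegenerateCC γ (ξ i)) {ρ ω κ : ℝ} (hρ : ∀ i, ‖γ (ξ i)‖ ^ 2 < ρ) (hω : 0 < ω)
    (hκ : κ ∈ Ioo (0 : ℝ) 1) (μ b : ℝ) :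
    ∃ A : Fin m → Fin m → ℝ, (∀ i j, A i j ≠ 0) ∧ ∃ ε > 0,
      (∀ i j, ¬ Antipodal γ (ξ i) (ξ j) → ∀ x y δ, |x - ξ i| < ε → |y - ξ j| < ε → |δ| < ε →
        InnerGood D μ δ⁻¹ b (γ x) (-Complex.I * deriv γ x) (γ y) (-Complex.I * deriv γ y)) ∧
      (∀ i x y, |x - ξ i| < ε → |y - ξ i| < ε →
        OuterGood D ρ ω κ (γ x) (-Complex.I * deriv γ x) (γ y) (-Complex.I * deriv γ y)) ∧
      (∀ δ, |δ| < ε → IsContraction (newtonStep γ ρ ω μ δ A)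
        (fun i j => ¬ Antipodal γ (ξ i) (ξ j)) ξ ε) ∧
      (∀ i j x y, |x - ξ i| < ε → |y - ξ j| < ε → γ x = γ y → x = y ∧ i = j) := by
  have hcγ : Continuous γ := hD.contDiff.continuous
  have hex : ∀ i j, ∃ A : ℝ, A ≠ 0 ∧ ∃ r > 0, ¬ Antipodal γ (ξ i) (ξ j) →
      ∀ x y z x' y' z' δ : ℝ, |x - ξ i| < r → |y - ξ i| < r → |z - ξ j| < r →
      |x' - ξ i| < r → |y' - ξ i| < r → |z' - ξ j| < r → |δ| < r →
      |(x - balance γ ρ ω μ x y z δ / A) - (x' - balance γ ρ ω μ x' y' z' δ / A)| ≤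
        max |x - x'| (max |y - y'| |z - z'|) / 2 := by
    intro i j
    by_cases hna : Antipodal γ (ξ i) (ξ j)
    -- Dummy values: antipodal pairs never occur in a word, but the finite families `A` and `r` must
    -- be total.
    · exact ⟨1, one_ne_zero, 1, one_pos, fun h => absurd hna h⟩
    · obtain ⟨A, hA, r, hr, h⟩ :=
        (hξ i).exists_contraction hD (ω := ω) (μ := μ) (hρ i) (nonantipodal_iff.mpr hna)
      exact ⟨A, hA, r, hr, fun _ => h⟩
  choose A hA r hr hcon using hex
  have e1 : ∀ᶠ ε : ℝ in 𝓝[>] 0, ∀ i j, ¬ Antipodal γ (ξ i) (ξ j) → ∀ x y δ,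
      |x - ξ i| < ε → |y - ξ j| < ε → |δ| < ε →
      InnerGood D μ δ⁻¹ b (γ x) (-Complex.I * deriv γ x) (γ y) (-Complex.I * deriv γ y) := by
    refine eventually_all.mpr fun i => eventually_all.mpr fun j => ?_
    by_cases hna : Antipodal γ (ξ i) (ξ j)
    · exact Eventually.of_forall fun _ h => absurd hna h
    · refine (eventually_box ((hξ i).1.eventually_innerGood hD (hξ j).1
        (nonantipodal_iff.mpr hna) ?_ μ b)).mono fun _ h _ => h
      by_cases hij : i = j
      · exact Or.inl (by rw [hij])
      · exact Or.inr (hdistinct.ne hij)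
  have e2 : ∀ᶠ ε : ℝ in 𝓝[>] 0, ∀ i x y, |x - ξ i| < ε → |y - ξ i| < ε →
      OuterGood D ρ ω κ (γ x) (-Complex.I * deriv γ x) (γ y) (-Complex.I * deriv γ y) :=
    eventually_all.mpr fun i =>
      eventually_box_two ((hξ i).1.eventually_outerGood hD (hρ i) hω hκ)
  have e3 : ∀ᶠ ε : ℝ in 𝓝[>] 0, ∀ i j, ε < r i j :=
    eventually_all.mpr fun i => eventually_all.mpr fun j =>
      eventually_lt_of_pos (hr i j)
  have e4 : ∀ᶠ ε : ℝ in 𝓝[>] 0, ∀ i j x y, |x - ξ i| < ε → |y - ξ j| < ε → γ x = γ y →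
      x = y ∧ i = j := by
    refine eventually_all.mpr fun i => eventually_all.mpr fun j => ?_
    by_cases hij : i = j
    · subst hij
      exact (eventually_box_two (p := fun x y => γ x = γ y → x = y)
        (hD.eventually_injective (ξ i))).mono
        fun _ h x y hx hy hxy => ⟨h x y hx hy hxy, rfl⟩
    · have : ∀ᶠ w : ℝ × ℝ in 𝓝 (ξ i, ξ j), γ w.1 ≠ γ w.2 :=
        (isOpen_ne_fun (f := fun w : ℝ × ℝ => γ w.1) (g := fun w : ℝ × ℝ => γ w.2)
          (by fun_prop) (by fun_prop)).mem_nhds (hdistinct.ne hij)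
      exact (eventually_box_two (p := fun x y => γ x ≠ γ y) this).mono
        fun _ h x y hx hy hxy => absurd hxy (h x y hx hy)
  obtain ⟨ε, hε, h1, h2, h3, h4⟩ :=
    (eventually_mem_nhdsWithin.and (e1.and (e2.and (e3.and e4)))).exists
  refine ⟨A, hA, ε, hε, h1, h2, ?_, h4⟩
  intro δ hδ i j hij x y z x' y' z' a1 a2 a3 a4 a5 a6
  have := h3 i j
  exact hcon i j hij x y z x' y' z' δ (a1.trans this) (a2.trans this) (a3.trans this)
    (a4.trans this) (a5.trans this) (a6.trans this) (hδ.trans this)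

theorem exists_pos_radius {m : ℕ} {f : Fin m → ℝ} (hf : ∀ i, 0 < f i) {ε : ℝ} (hε : 0 < ε) :
    ∃ ρ₀ > 0, ρ₀ < ε ∧ ∀ i, ρ₀ < f i := by
  have : ∀ᶠ ρ₀ : ℝ in 𝓝[>] 0, ∀ i, ρ₀ < f i :=
    eventually_all.mpr fun i => eventually_lt_of_pos (hf i)
  obtain ⟨ρ₀, h1, h2, h3⟩ :=
    (eventually_mem_nhdsWithin.and
      ((eventually_lt_of_pos hε).and this)).exists
  exact ⟨ρ₀, h1, h2, h3⟩

end RefractionBilliard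

open RefractionBilliard in
theorem theorem1p11 (E ω μ : ℝ) (hE : 0 < E) (hω : 0 < ω) (hμ : 0 < μ)
    (D : Set ℂ) (γ : ℝ → ℂ) (L : ℝ)
    (hD : RefractionBilliard.IsDomainWithBoundary D γ L)
    (hill : closure D ⊆ Metric.ball 0 (√(2 * E) / ω))
    (m : ℕ) (hm : 2 ≤ m) (ξ : Fin m → ℝ)
    (hdistinct : Function.Injective fun i => γ (ξ i))
    (hξ : ∀ i, RefractionBilliard.IsNondegenerateCC γ (ξ i))
    (hanti : m = 2 → ∀ i j, ¬ RefractionBilliard.Antipodal γ (ξ i) (ξ j))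
    (κ : ℝ) (hκ : κ ∈ Set.Ioo (0 : ℝ) 1) :
    ∃ ε > 0, ∀ W : RefractionBilliard.Windows m, W.IsAround ξ ε →
      -- the intervals are disjoint, also as arcs of the boundary
      ((Pairwise fun i j => Disjoint (Set.Ioo (W.a i) (W.b i)) (Set.Ioo (W.a j) (W.b j))) ∧
        Set.InjOn γ (⋃ i, Set.Ioo (W.a i) (W.b i))) ∧
      -- each symbol may be followed by itself and by some other symbol
      (∀ i, W.NA γ i i ∧ ∃ j, j ≠ i ∧ W.NA γ i j) ∧
      ∃ h₁ : ℝ, ∀ h > h₁,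
        ∃ (F : Equiv.Perm (RefractionBilliard.invariantSet ⟨E, ω, μ, h, D, γ⟩ W κ))
          (π : RefractionBilliard.invariantSet ⟨E, ω, μ, h, D, γ⟩ W κ → W.words γ),
          -- `F` is the first return map
          (∀ (x : RefractionBilliard.invariantSet ⟨E, ω, μ, h, D, γ⟩ W κ) (y : ℝ × ℂ),
            RefractionBilliard.FirstReturn ⟨E, ω, μ, h, D, γ⟩ W κ x y ↔ (F x : ℝ × ℂ) = y) ∧
          -- `π` is the projection to the sequence of visited intervals
          (∀ x (j : ℤ) (r : Fin m),
            (π x : ℤ → Fin m) j = r ↔ ((F ^ j) x : ℝ × ℂ).1 ∈ W.I r) ∧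
          -- `π` semi-conjugates `F` to the shift, is onto, one-to-one, and a homeomorphism
          (∀ x, (π (F x) : ℤ → Fin m) = RefractionBilliard.shift (π x : ℤ → Fin m)) ∧
          Continuous π ∧ Function.Surjective π ∧ Function.Injective π ∧ IsHomeomorph π := by
  set ρ := 2 * E / ω ^ 2 with hρdef
  have hρ0 : 0 < ρ := by positivity
  have hR : (√(2 * E) / ω) ^ 2 = ρ := by rw [div_pow, Real.sq_sqrt (by positivity)]
  have hρ : ∀ x, ‖γ x‖ ^ 2 < ρ := fun x => by
    rw [← hR]
    have := hD.norm_lt hill x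
    gcongr
  -- The bound `√(2 * E)` is the largest tangential velocity on the outer energy shell. The radius
  -- `ε` also bounds `δ`, so it is chosen before the windows and before `h`.
  obtain ⟨A, hA, ε, hε, hinner, houter, hcon, hinj⟩ :=
    exists_radius hD hdistinct hξ (fun i => hρ _) hω hκ μ √(2 * E)
  refine ⟨ε, hε, fun W hW => ?_⟩
  have hab : ∀ i, ∀ x ∈ Ioo (W.a i) (W.b i), |x - ξ i| < ε := fun i x hx => by
    obtain ⟨h1, -, -, -, -, h2⟩ := hW i
    rw [abs_lt]
    constructor <;> linarith [hx.1, hx.2]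
  have hIab : ∀ i, ∀ x ∈ W.I i, x ∈ Ioo (W.a i) (W.b i) := fun i x hx => by
    obtain ⟨-, h1, -, -, h2, -⟩ := hW i
    exact ⟨h1.trans_le hx.1, hx.2.trans_lt h2⟩
  have hξab : ∀ i, ξ i ∈ Ioo (W.a i) (W.b i) := fun i =>
    hIab i _ ⟨(hW i).2.2.1.le, (hW i).2.2.2.1.le⟩
  have hNA : ∀ i j, W.NA γ i j ↔ ¬ Antipodal γ (ξ i) (ξ j) := fun i j =>
    ⟨fun h => h _ (hξab i) _ (hξab j), fun h x hx y hy => by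
      rw [← nonantipodal_iff]
      -- Non-antipodality does not involve `δ`; any admissible value serves.
      exact (hinner i j h x y (ε / 2) (hab i x hx) (hab j y hy)
        (by rw [abs_of_pos (half_pos hε)]; exact half_lt_self hε)).nonantipodal⟩
  refine ⟨⟨fun i j hij => Set.disjoint_left.mpr fun x hx hx' =>
      hij (hinj i j x x (hab i x hx) (hab j x hx') rfl).2, ?_⟩, fun i => ⟨?_, ?_⟩, ?_⟩
  · intro x hx y hy hxy
    obtain ⟨i, hx⟩ := mem_iUnion.mp hx
    obtain ⟨j, hy⟩ := mem_iUnion.mp hy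
    exact (hinj i j x y (hab i x hx) (hab j y hy) hxy).1
  · rw [hNA]; exact not_antipodal_self hD _
  · obtain ⟨j, hj, h⟩ := exists_ne_not_antipodal hD hm hdistinct (fun i => (hξ i).1) hanti i
    exact ⟨j, hj, (hNA i j).mpr h⟩
  -- `ρ₀` depends on the windows: the `ρ₀`-neighbourhood of each center must fit into `[α i, β i]`.
  -- The threshold `h₁` is then chosen so that the centers solve the balance equations up to `ρ₀/2`
  -- after the Newton step.
  obtain ⟨ρ₀, hρ₀, hρε, hρ₀lt⟩ := exists_pos_radius
    (f := fun i => min (ξ i - W.α i) (W.β i - ξ i))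
    (fun i => lt_min (sub_pos.mpr (hW i).2.2.1) (sub_pos.mpr (hW i).2.2.2.1)) hε
  have hl : Tendsto (fun h : ℝ => (√((E + h) / 2))⁻¹) atTop (𝓝 0) :=
    tendsto_inv_atTop_zero.comp (Real.tendsto_sqrt_atTop.comp
      ((tendsto_atTop_add_const_left _ E tendsto_id).atTop_div_const two_pos))
  have hbal : ∀ᶠ δ : ℝ in 𝓝 0, ∀ i j, ¬ Antipodal γ (ξ i) (ξ j) →
      |newtonStep γ ρ ω μ δ A i j (ξ i) (ξ i) (ξ j) - ξ i| ≤ ρ₀ / 2 := by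
    refine eventually_all.mpr fun i => eventually_all.mpr fun j => ?_
    by_cases hna : Antipodal γ (ξ i) (ξ j)
    · exact Eventually.of_forall fun _ h => absurd hna h
    · have h1 := ((hξ i).tendsto_balance hD (ω := ω) (μ := μ) (hρ (ξ i))
        (nonantipodal_iff.mpr hna)).div_const (A i j)
      rw [zero_div] at h1
      have h2 := h1.abs
      rw [abs_zero] at h2
      filter_upwards [h2.eventually_lt_const (half_pos hρ₀)] with δ hδ _
      rw [newtonStep, sub_sub_cancel_left, abs_neg]
      exact hδ.le
  have hδε : ∀ᶠ δ : ℝ in 𝓝 0, |δ| < ε := by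
    have : Tendsto (fun δ : ℝ => |δ|) (𝓝 0) (𝓝 0) := by
      simpa using (continuous_abs (G := ℝ)).tendsto 0
    exact this.eventually_lt_const hε
  -- Here `δ = 1/l` with `l² = (E + h)/2`. The condition `0 ≤ h` gives `l > 0` and `2E ≤ 4l²`.
  obtain ⟨h₁, hh₁⟩ := eventually_atTop.mp
    ((hl.eventually (hbal.and hδε)).and (eventually_ge_atTop (0 : ℝ)))
  refine ⟨h₁, fun h hh => ?_⟩
  obtain ⟨⟨hb, hδ⟩, h0⟩ := hh₁ h hh.le
  set l := √((E + h) / 2) with hldef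
  have hl2 : l ^ 2 = (E + h) / 2 := Real.sq_sqrt (by positivity)
  have hlpos : 0 < l := Real.sqrt_pos.mpr (by positivity)
  have hadapt : IsAdapted ⟨E, ω, μ, h, D, γ⟩ W L κ ρ l :=
    { domain := hD
      omega_pos := hω
      mu_pos := hμ
      kappa_mem := hκ
      rho_pos := hρ0
      scale_pos := hlpos
      outer_energy := by simp only [hρdef]; field_simp
      inner_energy := by simp only [hl2]; ring
      energy_le := by simp only [hl2]; linarith
      outer := fun i x hx y hy => houter i x y (hab i x (hIab i x hx)) (hab i y (hIab i y hy))
      inner := fun i j hij x hx y hy => by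
        have := hinner i j ((hNA i j).mp hij) x y l⁻¹ (hab i x (hIab i x hx))
          (hab j y (hIab j y hy)) hδ
        rwa [inv_inv] at this
      eq_of_mem := fun x i j hi hj =>
        (hinj i j x x (hab i x (hIab i x hi)) (hab j x (hIab j x hj)) rfl).2
      inj := fun i j x hx y hy hxy =>
        (hinj i j x y (hab i x (hIab i x hx)) (hab j y (hIab j y hy)) hxy).1 }
  refine hadapt.exists_conjugacy hA (fun i j hij => hcon _ hδ i j ((hNA i j).mp hij)) hρ₀.le hρε
    (fun i j hij => hb i j ((hNA i j).mp hij)) (fun i x hx => hab i x (hIab i x hx))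
    (fun i x hx => ?_)
  have h1 := (lt_min_iff.mp (hρ₀lt i))
  rw [abs_le] at hx
  exact ⟨by linarith [h1.1, hx.1], by linarith [h1.2, hx.2]⟩
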